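/- Let $0<\beta\le 1$ and $\lambda>1$, let $\theta_1,\theta_2,\dots$ be independent random variables, each uniformly distributed on $[0,1]$, let $\Theta=(\theta_n)_{n\ge1}$, and put $$W_{\beta,\lambda,\Theta}(x)=\sum_{n=1}^{\infty}\lambda^{-\beta n}e^{2\pi i(\lambda^n x+\theta_n)}\in\mathbb{C}=\mathbb{R}^2,\qquad x\in\mathbb{R}.$$ For $A\subset\mathbb{R}$ write $W_{\beta,\lambda,\Theta}(A)$ for the image of $A$ and $G_{W_{\beta,\lambda,\Theta}}(A)=\{(x,W_{\beta,\lambda,\Theta}(x)):x\in A\}\subset\mathbb{R}^3$ for the graph over $A$. Let $\dim_{\mathcal H}$ denote Hausdorff dimension. For a bounded set $E$ in a Euclidean space let $N_\varepsilon(E)$ be the least number of closed balls of radius $\varepsilon$ that cover $E$; the box-counting dimension of $E$ is $\dim_{\mathcal B}E=\lim_{\varepsilon\to0^+}\log N_\varepsilon(E)/\log(1/\varepsilon)$ when this limit exists (and $\dim_{\mathcal B}\emptyset=0$). Then, for every Borel set $A\subset\mathbb{R}$ (the exceptional null events may depend on $A$): (i) almost surely, $$\dim_{\mathcal H}W_{\beta,\lambda,\Theta}(A)=\min\Bigl\{2,\frac{\dim_{\mathcal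 H}A}{\beta}\Bigr\},\qquad \dim_{\mathcal H}G_{W_{\beta,\lambda,\Theta}}(A)=\min\Bigl\{\frac{\dim_{\mathcal H}A}{\beta},\ \dim_{\mathcal H}A+2-2\beta\Bigr\};$$ (ii) if $\beta<\frac12\dim_{\mathcal H}A$, then almost surely $W_{\beta,\lambda,\Theta}(A)$ has positive two-dimensional Lebesgue measure; (iii) if $\beta<\frac14\dim_{\mathcal H}A$, then almost surely $W_{\beta,\lambda,\Theta}(A)$ has non-empty interior; (iv) if $A$ is bounded, $\dim_{\mathcal B}A$ exists and $\dim_{\mathcal B}A=\dim_{\mathcal H}A$, then almost surely the box-counting dimensions of $W_{\beta,\lambda,\Theta}(A)$ and $G_{W_{\beta,\lambda,\Theta}}(A)$ exist and $$\dim_{\mathcal B}W_{\beta,\lambda,\Theta}(A)=\min\Bigl\{2,\frac{\dim_{\mathcal B}A}{\beta}\Bigr\},\qquad \dim_{\mathcal B}G_{W_{\beta,\lambda,\Theta}}(A)=\min\Bigl\{\frac{\dim_{\mathcal B}A}{\beta},\ \dim_{\mathcal B}A+2-2\beta\Bigr\}.$$ -/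

import Mathlib

open Filter Topology MeasureTheory ProbabilityTheory
open scoped NNReal ENNReal

noncomputable section

/-- The complex Weierstrass series with phases `θ`,
`W(x) = ∑_{k ≥ 1} lam ^ (-β k) * exp (2 π i (lam ^ k x + θ_k))`.
The summation index is shifted by one: `n = k - 1` runs through `ℕ`, and `θ n` is the phase of the
term `k = n + 1`. -/
def weierstrass (β lam : ℝ) (θ : ℕ → ℝ) (x : ℝ) : ℂ :=
  ∑' n : ℕ, ((lam ^ (-β * ((n : ℝ) + 1)) : ℝ) : ℂ) *
    Complex.exp (2 * (Real.pi : ℂ) * Complex.I * ((lam ^ (n + 1) * x + θ n : ℝ) : ℂ))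

/-- The graph `{(x, f x) : x ∈ A}` of `f : ℝ → ℂ` over `A`, as a subset of `ℝ × ℂ = ℝ³` with the
Euclidean metric. -/
def graphOver (f : ℝ → ℂ) (A : Set ℝ) : Set (WithLp 2 (ℝ × ℂ)) :=
  (fun x : ℝ => WithLp.toLp 2 (x, f x)) '' A

/-- `HasBoxDim s d`: the box-counting dimension of `s` exists and equals `d`, that is,
`s` is totally bounded (in a Euclidean space: bounded) and, `N(s, ε)` being the least number of
closed balls of radius `ε` that cover `s`, `log N(s, ε) / log (1 / ε) → d` as `ε → 0+`.
(For the empty set `N = 0`, and `Real.log 0 = 0` gives the usual convention that it has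
dimension `0`.) -/
def HasBoxDim {X : Type*} [PseudoMetricSpace X] (s : Set X) (d : ℝ≥0∞) : Prop :=
  TotallyBounded s ∧
    Tendsto (fun ε : ℝ≥0 => ENNReal.ofReal
        (Real.log ((Metric.externalCoveringNumber ε s).toNat : ℝ) / Real.log (1 / (ε : ℝ))))
      (𝓝[>] 0) (𝓝 d)

end

/-! The increment W(x) - W(y) is a sum of independent random vectors c_n exp(2πi θ_n), each uniform
on a circle. For any N, once |x - y| is small enough, N consecutive circles have radius at least a
constant times |x - y|^β. By independence the characteristic function of the increment at ξ is a
product of Bessel factors, so it decays like (|x - y|^β |ξ|)^(-M) with M as large as desired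
(`exists_norm_charFun_increment_le`). All lower bounds come from this one estimate.

Order M = 3 > 2 gives a bounded density at scale |x - y|^β: P(|W(x) - W(y)| ≤ r) ≤ C r² |x -
y|^(-2β) (`exists_measure_increment_le`). A Frostman measure μ on a compact part of A has finite
p-energy for every p < dim A (`exists_energy_lt_top`), and integrating the probability bound against
μ × μ controls the image measure. For the image, raising the bound to the power q/2 ≤ 1 gives r^q |x
- y|^(-βq). For the graph, closeness also forces |x - y| ≤ r, so r² |x - y|^(-2β) ≤ r^q |x - y|^(-(q
+ 2β - 2)) for q > 2. An integrated mass distribution principle turns both into dimension bounds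
(`ae_le_dimH_image`). When 2β < dim A the exponent 2 itself is allowed, and Cauchy–Schwarz with
Fatou gives positive area (`ae_volume_image_pos`). When 4β < dim A the Fourier transform of the
image measure has mean square of order |ξ|^(-γ) with γ > 4. It is therefore almost surely integrable
on the plane, and its inverse transform is a continuous function supported in the image and not
identically zero (`ae_interior_image_nonempty`).

Upper bounds are deterministic. W is Hölder of every order b < β, uniformly in the phases, so a set
of diameter δ has image in a ball of radius Cδ^b, and graph in Cδ^(-(2 - 2b)) balls of radius
comparable to δ. Such a covering estimate (`CoverBound`) transfers both Hausdorff and box-counting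
bounds from A. Lower box counts follow from the Hausdorff dimension.

Frostman's lemma for Borel sets is derived from dyadic contents. Nestedness makes dyadic covers
strongly subadditive, hence the content is continuous along increasing sequences of arbitrary sets
(`dyadicContent_iUnion_le`), and Borel sets, being analytic, contain compact sets of positive
content. On the line, the content of K ∩ (-∞, x] as a function of x is then the distribution
function of a Frostman measure. -/

/-! ### Dyadic contents on the line -/

/-- The half-open dyadic interval `[k / 2 ^ n, (k + 1) / 2 ^ n)`, for `q = (n, k)`. -/
def dyadicIco (q : ℕ × ℤ) : Set ℝ := {x | ⌊x * 2 ^ q.1⌋ = q.2}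

/-- The union of a family of dyadic intervals. -/
def dyadicUnion (S : Set (ℕ × ℤ)) : Set ℝ := ⋃ q ∈ S, dyadicIco q

/-- The total weight of a family of dyadic intervals. -/
noncomputable def weightSum (w : ℕ × ℤ → ℝ≥0∞) (S : Set (ℕ × ℤ)) : ℝ≥0∞ :=
  ∑' q, S.indicator w q

/-- The content attached to a weight on dyadic intervals. -/
noncomputable def dyadicContent (w : ℕ × ℤ → ℝ≥0∞) (E : Set ℝ) : ℝ≥0∞ :=
  ⨅ (S : Set (ℕ × ℤ)) (_ : E ⊆ dyadicUnion S), weightSum w S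

/-- The members of a family not contained in a coarser member. -/
def maxDyadic (S : Set (ℕ × ℤ)) : Set (ℕ × ℤ) :=
  {q | q ∈ S ∧ ∀ q' ∈ S, q'.1 < q.1 → ¬ dyadicIco q ⊆ dyadicIco q'}

theorem mem_dyadicUnion {S : Set (ℕ × ℤ)} {x : ℝ} :
    x ∈ dyadicUnion S ↔ ∃ q ∈ S, x ∈ dyadicIco q := by
  simp [dyadicUnion]

theorem floor_mul_two_pow (x : ℝ) {n m : ℕ} (h : n ≤ m) :
    ⌊x * 2 ^ n⌋ = ⌊x * 2 ^ m⌋ / (2 ^ (m - n) : ℕ) := by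
  rw [← Int.floor_div_natCast]
  congr 1
  push_cast
  rw [eq_div_iff (by positivity), mul_assoc, ← pow_add]
  congr 2
  omega

theorem dyadicIco_subset_of_mem {q q' : ℕ × ℤ} {x : ℝ} (hx : x ∈ dyadicIco q)
    (hx' : x ∈ dyadicIco q') (h : q'.1 ≤ q.1) : dyadicIco q ⊆ dyadicIco q' := by
  intro y hy
  simp only [dyadicIco, Set.mem_ofPred_eq] at *
  rw [floor_mul_two_pow _ h] at hx' ⊢
  rw [hy, ← hx, hx']

theorem eq_of_mem_dyadicIco {q q' : ℕ × ℤ} {x : ℝ} (hx : x ∈ dyadicIco q)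
    (hx' : x ∈ dyadicIco q') (h : q'.1 = q.1) : q = q' := by
  refine Prod.ext h.symm ?_
  simp only [dyadicIco, Set.mem_ofPred_eq] at *
  rw [← hx, ← hx', h]

/-- Levels are natural numbers, so among the members containing a point there is a coarsest one;
discarding the others uncovers nothing. -/
theorem exists_mem_maxDyadic {S : Set (ℕ × ℤ)} {x : ℝ} {q : ℕ × ℤ} (hq : q ∈ S)
    (hx : x ∈ dyadicIco q) : ∃ q' ∈ maxDyadic S, x ∈ dyadicIco q' ∧ q'.1 ≤ q.1 := by
  classical
  have hex : ∃ n : ℕ, ∃ q' ∈ S, x ∈ dyadicIco q' ∧ q'.1 = n := ⟨q.1, q, hq, hx, rfl⟩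
  obtain ⟨q', hq', hx', hn⟩ := Nat.find_spec hex
  refine ⟨q', ⟨hq', fun p hp hlt hsub => ?_⟩, hx', hn ▸ Nat.find_min' hex ⟨q, hq, hx, rfl⟩⟩
  exact Nat.find_min hex (hn ▸ hlt) ⟨p, hp, hsub hx', rfl⟩

theorem dyadicContent_le {w : ℕ × ℤ → ℝ≥0∞} {E : Set ℝ} {S : Set (ℕ × ℤ)}
    (h : E ⊆ dyadicUnion S) : dyadicContent w E ≤ weightSum w S :=
  iInf₂_le S h

theorem dyadicContent_mono (w : ℕ × ℤ → ℝ≥0∞) {E F : Set ℝ} (h : E ⊆ F) :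
    dyadicContent w E ≤ dyadicContent w F :=
  le_iInf₂ fun _ hS => dyadicContent_le (h.trans hS)

theorem exists_cover_lt {w : ℕ × ℤ → ℝ≥0∞} {E : Set ℝ} {c : ℝ≥0∞}
    (h : dyadicContent w E < c) : ∃ S, E ⊆ dyadicUnion S ∧ weightSum w S < c := by
  simpa [dyadicContent, iInf_lt_iff] using h

theorem weightSum_add_le {w : ℕ × ℤ → ℝ≥0∞} {R L S T : Set (ℕ × ℤ)}
    (h : ∀ q, R.indicator w q + L.indicator w q ≤ S.indicator w q + T.indicator w q) :
    weightSum w R + weightSum w L ≤ weightSum w S + weightSum w T := by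
  simp only [weightSum, ← ENNReal.tsum_add]
  exact ENNReal.tsum_le_tsum h

theorem weightSum_union_le (w : ℕ × ℤ → ℝ≥0∞) (S T : Set (ℕ × ℤ)) :
    weightSum w (S ∪ T) ≤ weightSum w S + weightSum w T := by
  simp only [weightSum, ← ENNReal.tsum_add]
  refine ENNReal.tsum_le_tsum fun q => ?_
  classical
  simp only [Set.indicator_apply, Set.mem_union]
  split_ifs <;> simp_all

theorem dyadicContent_union_le (w : ℕ × ℤ → ℝ≥0∞) (E F : Set ℝ) :
    dyadicContent w (E ∪ F) ≤ dyadicContent w E + dyadicContent w F := by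
  refine ENNReal.le_of_forall_pos_le_add fun ε hε hfin => ?_
  have hε' : (ε / 2 : ℝ≥0∞) ≠ 0 := by simpa using hε.ne'
  obtain ⟨hE, hF⟩ := ENNReal.add_lt_top.1 hfin
  obtain ⟨S, hS, hS'⟩ := exists_cover_lt (ENNReal.lt_add_right hE.ne hε')
  obtain ⟨T, hT, hT'⟩ := exists_cover_lt (ENNReal.lt_add_right hF.ne hε')
  have hcov : E ∪ F ⊆ dyadicUnion (S ∪ T) := by
    rw [dyadicUnion, Set.biUnion_union]
    exact Set.union_subset_union hS hT
  calc dyadicContent w (E ∪ F) ≤ weightSum w (S ∪ T) := dyadicContent_le hcov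
    _ ≤ weightSum w S + weightSum w T := weightSum_union_le w S T
    _ ≤ (dyadicContent w E + ε / 2) + (dyadicContent w F + ε / 2) :=
        add_le_add hS'.le hT'.le
    _ = dyadicContent w E + dyadicContent w F + ε := by
        rw [add_add_add_comm, ENNReal.add_halves]

/-- Strong subadditivity of dyadic covers. -/
theorem weightSum_maxDyadic_add_le (w : ℕ × ℤ → ℝ≥0∞) (S T : Set (ℕ × ℤ)) :
    weightSum w (maxDyadic (S ∪ T)) + dyadicContent w (dyadicUnion S ∩ dyadicUnion T) ≤
      weightSum w S + weightSum w T := by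
  set R := maxDyadic (S ∪ T)
  have hR : R ⊆ S ∪ T := fun q hq => hq.1
  -- The intersection is covered by the members of `S` and `T` lost in passing to `R`, together with
  -- `S ∩ T`. Of two members containing a point the strictly finer one is lost, and at equal levels
  -- they coincide. No interval then counts more often on the left than on the right.
  refine le_trans (add_le_add le_rfl
    (dyadicContent_le (S := ((S \ R) ∪ (T \ R)) ∪ (S ∩ T)) ?_)) (weightSum_add_le fun q => ?_)
  · rintro x ⟨hxS, hxT⟩
    obtain ⟨q, hq, hx⟩ := mem_dyadicUnion.1 hxS
    obtain ⟨q', hq', hx'⟩ := mem_dyadicUnion.1 hxT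
    refine mem_dyadicUnion.2 ?_
    rcases lt_trichotomy q.1 q'.1 with h | h | h
    · refine ⟨q', Or.inl (Or.inr ⟨hq', fun hr => ?_⟩), hx'⟩
      exact hr.2 q (Or.inl hq) h (dyadicIco_subset_of_mem hx' hx h.le)
    · obtain rfl := eq_of_mem_dyadicIco hx hx' h.symm
      exact ⟨q, Or.inr ⟨hq, hq'⟩, hx⟩
    · refine ⟨q, Or.inl (Or.inl ⟨hq, fun hr => ?_⟩), hx⟩
      exact hr.2 q' (Or.inr hq') h (dyadicIco_subset_of_mem hx hx' h.le)
  · classical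
    have := @hR q
    by_cases h1 : q ∈ R <;> by_cases h2 : q ∈ S <;> by_cases h3 : q ∈ T <;>
      simp_all

/-- The coarsest members of the first `k + 1` families. -/
def iterMax (S : ℕ → Set (ℕ × ℤ)) : ℕ → Set (ℕ × ℤ)
  | 0 => S 0
  | k + 1 => maxDyadic (iterMax S k ∪ S (k + 1))

theorem exists_mem_iterMax_of_le {S : ℕ → Set (ℕ × ℤ)} {x : ℝ} {k j : ℕ} (hkj : k ≤ j)
    {q : ℕ × ℤ} (hq : q ∈ iterMax S k) (hx : x ∈ dyadicIco q) :
    ∃ q' ∈ iterMax S j, x ∈ dyadicIco q' ∧ q'.1 ≤ q.1 := by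
  induction j, hkj using Nat.le_induction with
  | base => exact ⟨q, hq, hx, le_rfl⟩
  | succ j _ ih =>
    obtain ⟨q', hq', hx', hle⟩ := ih
    obtain ⟨p, hp, hxp, hle'⟩ :=
      exists_mem_maxDyadic (S := iterMax S j ∪ S (j + 1)) (Or.inl hq') hx'
    exact ⟨p, hp, hxp, hle'.trans hle⟩

theorem subset_dyadicUnion_iterMax (S : ℕ → Set (ℕ × ℤ)) (k : ℕ) :
    dyadicUnion (S k) ⊆ dyadicUnion (iterMax S k) := by
  intro x hx
  cases k with
  | zero => exact hx
  | succ k =>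
    obtain ⟨q, hq, hxq⟩ := mem_dyadicUnion.1 hx
    obtain ⟨p, hp, hxp, -⟩ :=
      exists_mem_maxDyadic (S := iterMax S k ∪ S (k + 1)) (Or.inr hq) hxq
    exact mem_dyadicUnion.2 ⟨p, hp, hxp⟩

/-- Take the coarsest interval containing the point that occurs at any stage. Later stages contain
one at least as coarse around the point, so by minimality the same one: it survives for ever. -/
theorem subset_dyadicUnion_eventually {S : ℕ → Set (ℕ × ℤ)} (k : ℕ) :
    dyadicUnion (S k) ⊆ dyadicUnion {q | ∀ᶠ j in atTop, q ∈ iterMax S j} := by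
  classical
  intro x hx
  obtain ⟨q₀, hq₀, hx₀⟩ := mem_dyadicUnion.1 (subset_dyadicUnion_iterMax S k hx)
  have hex : ∃ n : ℕ, ∃ j, ∃ q ∈ iterMax S j, x ∈ dyadicIco q ∧ q.1 = n :=
    ⟨q₀.1, k, q₀, hq₀, hx₀, rfl⟩
  obtain ⟨j, q, hq, hxq, hn⟩ := Nat.find_spec hex
  refine mem_dyadicUnion.2 ⟨q, ?_, hxq⟩
  refine eventually_atTop.2 ⟨j, fun i hi => ?_⟩
  obtain ⟨q', hq', hx', hle⟩ := exists_mem_iterMax_of_le hi hq hxq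
  have hge : q.1 ≤ q'.1 := by
    rw [hn]; exact Nat.find_min' hex ⟨i, q', hq', hx', rfl⟩
  obtain rfl := eq_of_mem_dyadicIco hxq hx' (le_antisymm hle hge)
  exact hq'

/-- Finitely many intervals that are eventually present are all present at one common stage, so
every partial sum is bounded by `c`. -/
theorem weightSum_eventually_le (w : ℕ × ℤ → ℝ≥0∞) {T : ℕ → Set (ℕ × ℤ)} {c : ℝ≥0∞}
    (h : ∀ k, weightSum w (T k) ≤ c) : weightSum w {q | ∀ᶠ j in atTop, q ∈ T j} ≤ c := by
  rw [weightSum, ENNReal.tsum_eq_iSup_sum]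
  refine iSup_le fun F => ?_
  classical
  have hev : ∀ᶠ j in atTop, ∀ q ∈ F, q ∈ {q | ∀ᶠ j in atTop, q ∈ T j} → q ∈ T j := by
    rw [eventually_all_finset]
    intro q _
    by_cases hq : q ∈ {q | ∀ᶠ j in atTop, q ∈ T j}
    · exact hq.mono fun j hj _ => hj
    · exact Eventually.of_forall fun j hj => absurd hj hq
  obtain ⟨j, hj⟩ := hev.exists
  refine le_trans (Finset.sum_le_sum fun q hq => ?_) ((ENNReal.sum_le_tsum F).trans (h j))
  by_cases hq' : q ∈ {q | ∀ᶠ j in atTop, q ∈ T j}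
  · rw [Set.indicator_of_mem hq', Set.indicator_of_mem (hj q hq hq')]
  · rw [Set.indicator_of_notMem hq']; exact zero_le

/-- Dyadic contents are continuous along increasing sequences of arbitrary sets. -/
theorem dyadicContent_iUnion_le (w : ℕ × ℤ → ℝ≥0∞) {A : ℕ → Set ℝ} (hA : Monotone A) {c : ℝ≥0∞}
    (h : ∀ k, dyadicContent w (A k) ≤ c) : dyadicContent w (⋃ k, A k) ≤ c := by
  rcases eq_or_ne c ⊤ with rfl | hc
  · exact le_top
  refine ENNReal.le_of_forall_pos_le_add fun ε hε _ => ?_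
  obtain ⟨e, he, hsum⟩ := ENNReal.exists_pos_sum_of_countable (ε := (ε : ℝ≥0∞)) (by simpa using hε.ne') ℕ
  have hfin : ∀ k, dyadicContent w (A k) ≠ ⊤ := fun k => ne_top_of_le_ne_top hc (h k)
  have hex : ∀ k, ∃ S, A k ⊆ dyadicUnion S ∧ weightSum w S < dyadicContent w (A k) + e k :=
    fun k => exists_cover_lt (ENNReal.lt_add_right (hfin k) (by simpa using (he k).ne'))
  choose S hS hSw using hex
  -- Near-optimality of the covers `S k` makes the errors telescope: merging in `S (k + 1)` costs
  -- its weight minus the content of `A k`, by strong subadditivity, since both covers contain `A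
  -- k`. That content is finite, so it can be cancelled.
  have key : ∀ k, weightSum w (iterMax S k) ≤
      dyadicContent w (A k) + ∑ i ∈ Finset.range (k + 1), (e i : ℝ≥0∞) := by
    intro k
    induction k with
    | zero => simpa [iterMax] using (hSw 0).le
    | succ k ih =>
      have h1 := weightSum_maxDyadic_add_le w (iterMax S k) (S (k + 1))
      have h2 : dyadicContent w (A k) ≤
          dyadicContent w (dyadicUnion (iterMax S k) ∩ dyadicUnion (S (k + 1))) :=
        dyadicContent_mono w (Set.subset_inter ((hS k).trans (subset_dyadicUnion_iterMax S k))
          ((hA k.le_succ).trans (hS (k + 1))))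
      refine (ENNReal.add_le_add_iff_left (hfin k)).1 ?_
      calc dyadicContent w (A k) + weightSum w (iterMax S (k + 1))
          ≤ weightSum w (iterMax S k) + weightSum w (S (k + 1)) := by
            rw [add_comm]; exact le_trans (add_le_add le_rfl h2) h1
        _ ≤ _ := add_le_add ih (hSw (k + 1)).le
        _ = _ := by rw [Finset.sum_range_succ (n := k + 1)]; ring
  refine (dyadicContent_le (S := {q | ∀ᶠ j in atTop, q ∈ iterMax S j})
    (Set.iUnion_subset fun k => (hS k).trans (subset_dyadicUnion_eventually k))).trans ?_
  refine weightSum_eventually_le w fun k => (key k).trans (add_le_add (h k) ?_)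
  exact (ENNReal.sum_le_tsum _).trans hsum.le

/-! ### Compact subsets of positive content and Frostman measures -/

/-- The weight `2 ^ (-s n)` of a dyadic interval of level `n`. -/
noncomputable def dyadicWeight (s : ℝ) (q : ℕ × ℤ) : ℝ≥0∞ := ENNReal.ofReal ((2 : ℝ) ^ (-(s * q.1)))

/-- The open interval obtained from a dyadic interval by adding its two neighbours. -/
def dyadicNhd (q : ℕ × ℤ) : Set ℝ := {x | (q.2 - 1 : ℝ) < x * 2 ^ q.1 ∧ x * 2 ^ q.1 < q.2 + 2}

theorem isOpen_dyadicNhd (q : ℕ × ℤ) : IsOpen (dyadicNhd q) :=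
  (isOpen_lt (f := fun _ : ℝ => (q.2 - 1 : ℝ)) (g := fun x : ℝ => x * 2 ^ q.1) (by fun_prop)
    (by fun_prop)).inter (isOpen_lt (f := fun x : ℝ => x * 2 ^ q.1) (g := fun _ => (q.2 + 2 : ℝ))
    (by fun_prop) (by fun_prop))

theorem dyadicIco_subset_dyadicNhd (q : ℕ × ℤ) : dyadicIco q ⊆ dyadicNhd q := by
  intro x hx
  simp only [dyadicIco, Set.mem_ofPred_eq, Int.floor_eq_iff] at hx
  exact ⟨by linarith [hx.1], by linarith [hx.2]⟩

/-- A family together with all neighbours of its members. -/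
def withNeighbours (S : Set (ℕ × ℤ)) : Set (ℕ × ℤ) :=
  S ∪ ({q | (q.1, q.2 + 1) ∈ S} ∪ {q | (q.1, q.2 - 1) ∈ S})

theorem dyadicNhd_subset {S : Set (ℕ × ℤ)} {q : ℕ × ℤ} (hq : q ∈ S) :
    dyadicNhd q ⊆ dyadicUnion (withNeighbours S) := by
  rintro x ⟨h1, h2⟩
  have hf1 : q.2 - 1 ≤ ⌊x * 2 ^ q.1⌋ := by
    rw [Int.le_floor]; push_cast; exact h1.le
  have hf2 : ⌊x * 2 ^ q.1⌋ < q.2 + 2 := by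
    rw [Int.floor_lt]; push_cast; exact h2
  refine mem_dyadicUnion.2 ⟨(q.1, ⌊x * 2 ^ q.1⌋), ?_, rfl⟩
  have : ⌊x * 2 ^ q.1⌋ = q.2 - 1 ∨ ⌊x * 2 ^ q.1⌋ = q.2 ∨ ⌊x * 2 ^ q.1⌋ = q.2 + 1 := by omega
  rcases this with h | h | h <;> rw [h]
  · exact Or.inr (Or.inl (by simpa using hq))
  · exact Or.inl hq
  · exact Or.inr (Or.inr (by simpa using hq))

/-- The weight sees only the level, so permuting positions leaves the sum unchanged; this makes
adding both neighbours cost a factor 3. -/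
theorem weightSum_shift (s : ℝ) (S : Set (ℕ × ℤ)) (e : ℤ ≃ ℤ) :
    weightSum (dyadicWeight s) {q | (q.1, e q.2) ∈ S} = weightSum (dyadicWeight s) S := by
  classical
  rw [weightSum, weightSum, ← (Equiv.prodCongr (Equiv.refl ℕ) e).tsum_eq (S.indicator _)]
  refine tsum_congr fun q => ?_
  simp [Set.indicator_apply, dyadicWeight, Prod.map]

theorem weightSum_withNeighbours_le (s : ℝ) (S : Set (ℕ × ℤ)) :
    weightSum (dyadicWeight s) (withNeighbours S) ≤ 3 * weightSum (dyadicWeight s) S := by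
  refine (weightSum_union_le _ _ _).trans ?_
  refine (add_le_add le_rfl (weightSum_union_le _ _ _)).trans ?_
  rw [show {q : ℕ × ℤ | (q.1, q.2 + 1) ∈ S} = {q | (q.1, Equiv.addRight 1 q.2) ∈ S} from rfl,
    show {q : ℕ × ℤ | (q.1, q.2 - 1) ∈ S} = {q | (q.1, Equiv.subRight 1 q.2) ∈ S} from rfl,
    weightSum_shift, weightSum_shift]
  apply le_of_eq
  ring

/-- An open set containing a compact box of the Baire space contains a cylinder over it. -/
theorem exists_cylinder_subset {N : ℕ → ℕ} {O : Set (ℕ → ℕ)} (hO : IsOpen O)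
    (h : {σ : ℕ → ℕ | ∀ i, σ i ≤ N i} ⊆ O) :
    ∃ k, {σ : ℕ → ℕ | ∀ i < k, σ i ≤ N i} ⊆ O := by
  by_contra! hcon
  have hcon' : ∀ k, ∃ σ : ℕ → ℕ, (∀ i < k, σ i ≤ N i) ∧ σ ∉ O := by
    intro k
    obtain ⟨σ, h1, h2⟩ := Set.not_subset.1 (hcon k)
    exact ⟨σ, h1, h2⟩
  choose σ hσ hσO using hcon'
  have hcpt : IsCompact {σ : ℕ → ℕ | ∀ i, σ i ≤ N i} := by
    have : {σ : ℕ → ℕ | ∀ i, σ i ≤ N i} = Set.univ.pi fun i => Set.Iic (N i) := by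
      ext; simp [Pi.le_def]
    rw [this]
    exact isCompact_univ_pi fun i => (Set.finite_Iic _).isCompact
  -- Truncating the escaping points puts them in the compact box. The `i`-th coordinate of `σ k` is
  -- unaffected once `k > i`, so a limit of the truncations is a limit of the points themselves.
  obtain ⟨τ, hτ, φ, hφ, hlim⟩ := hcpt.tendsto_subseq
    (x := fun k i => min (σ k i) (N i)) fun k i => min_le_right _ _
  have hlim' : Tendsto (fun k => σ (φ k)) atTop (𝓝 τ) := by
    rw [tendsto_pi_nhds] at hlim ⊢
    intro i
    refine (hlim i).congr' ?_
    filter_upwards [eventually_gt_atTop i] with k hk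
    exact min_eq_left (hσ (φ k) i (hk.trans_le (hφ.id_le k)))
  obtain ⟨k, hk⟩ := (hlim'.eventually (hO.mem_nhds (h hτ))).exists
  exact hσO _ hk

/-- Borel sets contain compact sets of comparable dyadic content. -/
theorem exists_isCompact_dyadicContent_pos (s : ℝ) {A : Set ℝ} (hA : MeasurableSet A)
    (h : 0 < dyadicContent (dyadicWeight s) A) :
    ∃ K ⊆ A, IsCompact K ∧ 0 < dyadicContent (dyadicWeight s) K := by
  set w := dyadicWeight s
  obtain ⟨c, hc0, hc⟩ := exists_between h
  have hAn := hA.analyticSet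
  rw [AnalyticSet_def] at hAn
  rcases hAn with rfl | ⟨f, hf, rfl⟩
  · exact ⟨∅, subset_rfl, isCompact_empty, h⟩
  -- Continuity along increasing sets allows the coordinates of the Baire space to be bounded one at
  -- a time while the content stays above `c`.
  have step : ∀ (k : ℕ) (C : Set (ℕ → ℕ)), c < dyadicContent w (f '' C) →
      ∃ n, c < dyadicContent w (f '' (C ∩ {σ | σ k ≤ n})) := by
    intro k C hC
    by_contra! hcon
    refine (dyadicContent_iUnion_le w (A := fun n => f '' (C ∩ {σ | σ k ≤ n})) ?_ hcon).not_gt ?_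
    · exact fun a b hab => Set.image_mono
        (Set.inter_subset_inter_right _ fun σ hσ => le_trans hσ hab)
    · rw [← Set.image_iUnion, ← Set.inter_iUnion]
      convert hC
      rw [Set.inter_eq_left]
      exact fun σ _ => Set.mem_iUnion.2 ⟨σ k, le_refl (σ k)⟩
  choose! g hg using step
  let C : ℕ → Set (ℕ → ℕ) := fun k => Nat.rec Set.univ (fun k C => C ∩ {σ | σ k ≤ g k C}) k
  have hC : ∀ k, c < dyadicContent w (f '' C k) := by
    intro k
    induction k with
    | zero => simpa [C] using hc
    | succ k ih => exact hg k (C k) ih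
  let N : ℕ → ℕ := fun k => g k (C k)
  have hCN : ∀ k, C k = {σ : ℕ → ℕ | ∀ i < k, σ i ≤ N i} := by
    intro k
    induction k with
    | zero => ext; simp [C]
    | succ k ih =>
      have : C (k + 1) = C k ∩ {σ | σ k ≤ N k} := rfl
      rw [this, ih]
      ext σ
      simp only [Set.mem_inter_iff, Set.mem_ofPred_eq, Nat.lt_succ_iff_lt_or_eq]
      constructor
      · rintro ⟨h1, h2⟩ i (hi | rfl)
        exacts [h1 i hi, h2]
      · exact fun h => ⟨fun i hi => h i (Or.inl hi), h k (Or.inr rfl)⟩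
  have hbox : {σ : ℕ → ℕ | ∀ i, σ i ≤ N i} = Set.univ.pi fun i => Set.Iic (N i) := by
    ext; simp [Pi.le_def]
  refine ⟨f '' {σ | ∀ i, σ i ≤ N i}, Set.image_subset_range _ _, ?_, ?_⟩
  · rw [hbox]
    exact (isCompact_univ_pi fun i => (Set.finite_Iic _).isCompact).image hf
  -- Contents are not continuous along decreasing sequences for half-open covers. Enlarging each
  -- member to an open set makes the cover contain the image of some cylinder `C k`, of content
  -- above `c`; the enlargement costs the factor 3.
  · have hle : c / 3 ≤ dyadicContent w (f '' {σ | ∀ i, σ i ≤ N i}) := by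
      refine le_iInf₂ fun S hS => ?_
      have hO : IsOpen (⋃ q ∈ S, dyadicNhd q) :=
        isOpen_biUnion fun q _ => isOpen_dyadicNhd q
      obtain ⟨k, hk⟩ := exists_cylinder_subset (hO.preimage hf) (N := N) (by
        refine Set.image_subset_iff.1 (hS.trans ?_)
        exact Set.iUnion₂_mono fun q _ => dyadicIco_subset_dyadicNhd q)
      rw [← hCN] at hk
      have h1 : f '' C k ⊆ dyadicUnion (withNeighbours S) :=
        (Set.image_subset_iff.2 hk).trans (Set.iUnion₂_subset fun q hq => dyadicNhd_subset hq)
      have h2 := (hC k).le.trans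
        ((dyadicContent_le h1).trans (weightSum_withNeighbours_le s S))
      exact ENNReal.div_le_of_le_mul (by rwa [mul_comm])
    exact lt_of_lt_of_le (ENNReal.div_pos hc0.ne' (by simp)) hle

theorem ediam_dyadicIco_le (q : ℕ × ℤ) :
    Metric.ediam (dyadicIco q) ≤ ENNReal.ofReal ((2 : ℝ) ^ (-(q.1 : ℝ))) := by
  refine Metric.ediam_le fun x hx y hy => ?_
  rw [edist_dist]
  refine ENNReal.ofReal_le_ofReal ?_
  simp only [dyadicIco, Set.mem_ofPred_eq, Int.floor_eq_iff] at hx hy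
  rw [Real.dist_eq, Real.rpow_neg zero_le_two, Real.rpow_natCast, inv_eq_one_div,
    le_div_iff₀ (by positivity), ← abs_of_pos (show (0 : ℝ) < 2 ^ q.1 by positivity), ← abs_mul,
    sub_mul, abs_le]
  constructor <;> linarith

/-- Sets of dimension larger than `s` have positive content. -/
theorem dyadicContent_pos_of_lt_dimH {s : ℝ≥0} (hs : 0 < s) {A : Set ℝ} (h : (s : ℝ≥0∞) < dimH A) :
    0 < dyadicContent (dyadicWeight s) A := by
  by_contra hcon
  have h0 : dyadicContent (dyadicWeight s) A = 0 := by simpa using hcon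
  have hinf := hausdorffMeasure_of_lt_dimH h
  -- A total weight below 2^(-sn) forces every member to have level above `n`, so the same choice
  -- sends both the weights and the diameters to zero.
  have hcov : ∀ n : ℕ, ∃ S, A ⊆ dyadicUnion S ∧
      weightSum (dyadicWeight s) S < ENNReal.ofReal ((2 : ℝ) ^ (-((s : ℝ) * n))) := by
    intro n
    exact exists_cover_lt (by rw [h0]; exact ENNReal.ofReal_pos.2 (by positivity))
  choose S hS hSw using hcov
  have hlim : Tendsto (fun n : ℕ => ENNReal.ofReal ((2 : ℝ) ^ (-((s : ℝ) * n)))) atTop (𝓝 0) := by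
    rw [← ENNReal.ofReal_zero]
    refine ENNReal.tendsto_ofReal ?_
    have h1 : ((2 : ℝ) ^ (-(s : ℝ))) < 1 :=
      Real.rpow_lt_one_of_one_lt_of_neg one_lt_two (by simpa using hs)
    refine (tendsto_pow_atTop_nhds_zero_of_lt_one (by positivity) h1).congr fun n => ?_
    rw [← Real.rpow_natCast, ← Real.rpow_mul zero_le_two, neg_mul]
  have hlim1 : Tendsto (fun n : ℕ => ENNReal.ofReal ((2 : ℝ) ^ (-(n : ℝ)))) atTop (𝓝 0) := by
    rw [← ENNReal.ofReal_zero]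
    refine ENNReal.tendsto_ofReal ?_
    refine (tendsto_pow_atTop_nhds_zero_of_lt_one (r := (1 / 2 : ℝ)) (by positivity)
      (by norm_num)).congr fun n => ?_
    rw [Real.rpow_neg zero_le_two, Real.rpow_natCast, one_div, inv_pow]
  have hle := Measure.hausdorffMeasure_le_liminf_tsum (ι := fun n => S n) (s : ℝ) A
    (l := atTop) (fun n : ℕ => ENNReal.ofReal ((2 : ℝ) ^ (-(n : ℝ)))) hlim1
    (fun n q => dyadicIco q.1)
    (Eventually.of_forall fun n q => ?_) (Eventually.of_forall fun n => ?_)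
  · rw [hinf, top_le_iff] at hle
    have : liminf (fun n => ∑' q : S n, Metric.ediam (dyadicIco q.1) ^ (s : ℝ)) atTop ≤ 0 := by
      rw [← hlim.liminf_eq]
      refine liminf_le_liminf (Eventually.of_forall fun n => ?_)
      refine le_trans ?_ (hSw n).le
      rw [weightSum, ← tsum_subtype]
      refine ENNReal.tsum_le_tsum fun q => ?_
      refine (ENNReal.rpow_le_rpow (ediam_dyadicIco_le _) s.2).trans ?_
      rw [ENNReal.ofReal_rpow_of_nonneg (by positivity) s.2, ← Real.rpow_mul zero_le_two,
        dyadicWeight]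
      apply le_of_eq; congr 2; simp [mul_comm]
    rw [hle] at this
    simp at this
  · refine (ediam_dyadicIco_le _).trans (ENNReal.ofReal_le_ofReal ?_)
    have h1 : dyadicWeight s q.1 ≤ weightSum (dyadicWeight s) (S n) := by
      refine le_trans ?_ (ENNReal.le_tsum q.1)
      rw [Set.indicator_of_mem q.2]
    have h2 := (h1.trans_lt (hSw n))
    rw [dyadicWeight, ENNReal.ofReal_lt_ofReal_iff (by positivity),
      Real.rpow_lt_rpow_left_iff one_lt_two, neg_lt_neg_iff] at h2
    have h3 := lt_of_mul_lt_mul_left h2 s.2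
    exact Real.rpow_le_rpow_of_exponent_le one_le_two (by linarith)
  · exact (hS n).trans (by rw [dyadicUnion, Set.biUnion_eq_iUnion])

theorem exists_two_pow_bracket {d : ℝ} (h0 : 0 < d) (h1 : d ≤ 1) :
    ∃ n : ℕ, d ≤ (2 : ℝ) ^ (-(n : ℝ)) ∧ (2 : ℝ) ^ (-(n : ℝ)) < 2 * d := by
  obtain ⟨n, hn1, hn2⟩ := exists_nat_pow_near_of_lt_one h0 h1 (y := (1 / 2 : ℝ)) (by norm_num)
    (by norm_num)
  have e : ∀ m : ℕ, (2 : ℝ) ^ (-(m : ℝ)) = (1 / 2) ^ m := fun m => by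
    rw [Real.rpow_neg zero_le_two, Real.rpow_natCast, one_div, inv_pow]
  refine ⟨n, by rw [e]; exact hn2, ?_⟩
  rw [e]
  rw [pow_succ] at hn1
  linarith

/-- At the dyadic scale just above the length, two adjacent dyadic intervals suffice. -/
theorem dyadicContent_Icc_le {s : ℝ} (hs : 0 ≤ s) {a b : ℝ} (h0 : a < b) (h1 : b - a ≤ 1) :
    dyadicContent (dyadicWeight s) (Set.Icc a b) ≤ ENNReal.ofReal (2 * (2 * (b - a)) ^ s) := by
  obtain ⟨n, hn1, hn2⟩ := exists_two_pow_bracket (sub_pos.2 h0) h1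
  rw [Real.rpow_neg zero_le_two, Real.rpow_natCast] at hn1 hn2
  have hp : (0 : ℝ) < 2 ^ n := by positivity
  set k := ⌊a * 2 ^ n⌋
  refine (dyadicContent_le (S := {(n, k)} ∪ {(n, k + 1)}) ?_).trans
    ((weightSum_union_le _ _ _).trans ?_)
  · intro x hx
    have hk1 : (k : ℝ) ≤ a * 2 ^ n := Int.floor_le _
    have hk2 : a * 2 ^ n < k + 1 := Int.lt_floor_add_one _
    have hx1 : a * 2 ^ n ≤ x * 2 ^ n := by gcongr; exact hx.1
    have hx2 : x * 2 ^ n ≤ a * 2 ^ n + 1 := by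
      have : (x - a) * 2 ^ n ≤ 1 := by
        calc (x - a) * 2 ^ n ≤ (2 ^ n)⁻¹ * 2 ^ n := by
              gcongr; linarith [hx.2]
          _ = 1 := inv_mul_cancel₀ hp.ne'
      linarith
    have h1 : k ≤ ⌊x * 2 ^ n⌋ := Int.le_floor.2 (hk1.trans hx1)
    have h2 : ⌊x * 2 ^ n⌋ < k + 2 := by rw [Int.floor_lt]; push_cast; linarith
    refine mem_dyadicUnion.2 ⟨(n, ⌊x * 2 ^ n⌋), ?_, rfl⟩
    have : ⌊x * 2 ^ n⌋ = k ∨ ⌊x * 2 ^ n⌋ = k + 1 := by omega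
    rcases this with h | h <;> simp [h]
  · have hw : ∀ j, weightSum (dyadicWeight s) {(n, j)} ≤ ENNReal.ofReal ((2 * (b - a)) ^ s) := by
      intro j
      rw [weightSum, ← tsum_subtype, tsum_singleton, dyadicWeight]
      refine ENNReal.ofReal_le_ofReal ?_
      rw [mul_comm s, ← neg_mul, Real.rpow_mul zero_le_two]
      refine Real.rpow_le_rpow (by positivity) ?_ hs
      rw [Real.rpow_neg zero_le_two, Real.rpow_natCast]
      exact hn2.le
    rw [two_mul (_ ^ s), ENNReal.ofReal_add (by have := sub_pos.2 h0; positivity)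
      (by have := sub_pos.2 h0; positivity)]
    exact add_le_add (hw _) (hw _)

theorem dyadicContent_empty (w : ℕ × ℤ → ℝ≥0∞) : dyadicContent w ∅ = 0 :=
  le_antisymm ((dyadicContent_le (S := ∅) (Set.empty_subset _)).trans (by simp [weightSum]))
    zero_le

/-- The Frostman measure of a compact set: its distribution function is the content of the part
of the set to the left of a point. -/
theorem exists_frostman_of_isCompact {s : ℝ} (hs : 0 < s) {K : Set ℝ} (hK : IsCompact K)
    {a : ℝ} (hKa : K ⊆ Set.Icc a (a + 1)) (h : 0 < dyadicContent (dyadicWeight s) K) :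
    ∃ μ : Measure ℝ, IsFiniteMeasure μ ∧ μ ≠ 0 ∧ μ Kᶜ = 0 ∧
      ∀ x y, x < y → y - x ≤ 1 → μ (Set.Icc x y) ≤ ENNReal.ofReal (2 * (2 * (y - x)) ^ s) := by
  set w := dyadicWeight s
  have hfin : dyadicContent w K ≠ ⊤ := ne_top_of_le_ne_top ENNReal.ofReal_ne_top
    ((dyadicContent_mono w hKa).trans (dyadicContent_Icc_le hs.le (by linarith) (by linarith)))
  have hfin' : ∀ x, dyadicContent w (K ∩ Set.Iic x) ≠ ⊤ := fun x =>
    ne_top_of_le_ne_top hfin (dyadicContent_mono w Set.inter_subset_left)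
  let F : ℝ → ℝ := fun x => (dyadicContent w (K ∩ Set.Iic x)).toReal
  have hmono : Monotone F := fun x y hxy => ENNReal.toReal_mono (hfin' y)
    (dyadicContent_mono w (Set.inter_subset_inter_right _ (Set.Iic_subset_Iic.2 hxy)))
  have hle : ∀ x y, x < y → y - x ≤ 1 → F y - F x ≤ 2 * (2 * (y - x)) ^ s := by
    intro x y hxy h1
    have hsub : K ∩ Set.Iic y ⊆ (K ∩ Set.Iic x) ∪ Set.Icc x y := by
      rintro z ⟨hz, hzy⟩
      rcases le_total z x with hzx | hzx
      · exact Or.inl ⟨hz, hzx⟩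
      · exact Or.inr ⟨hzx, hzy⟩
    have h2 := (dyadicContent_mono w hsub).trans ((dyadicContent_union_le w _ _).trans
      (add_le_add le_rfl (dyadicContent_Icc_le hs.le hxy h1)))
    have h3 := ENNReal.toReal_mono (ENNReal.add_ne_top.2 ⟨hfin' x, ENNReal.ofReal_ne_top⟩) h2
    rw [ENNReal.toReal_add (hfin' x) ENNReal.ofReal_ne_top, ENNReal.toReal_ofReal
      (by have := sub_pos.2 hxy; positivity)] at h3
    simp only [F]
    linarith
  have hle' : ∀ x y, |y - x| ≤ 1 → |F y - F x| ≤ 2 * (2 * |y - x|) ^ s := by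
    intro x y h1
    rcases lt_trichotomy x y with hxy | rfl | hxy
    · rw [abs_of_pos (sub_pos.2 hxy)] at h1 ⊢
      rw [abs_of_nonneg (sub_nonneg.2 (hmono hxy.le))]
      exact hle x y hxy h1
    · simp [Real.zero_rpow hs.ne']
    · rw [abs_sub_comm] at h1 ⊢
      rw [abs_sub_comm y x]
      rw [abs_of_pos (sub_pos.2 hxy)] at h1 ⊢
      rw [abs_of_nonneg (sub_nonneg.2 (hmono hxy.le))]
      exact hle y x hxy h1
  have hcont : Continuous F := by
    refine continuous_iff_continuousAt.2 fun x => ?_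
    rw [ContinuousAt, tendsto_iff_dist_tendsto_zero]
    have hb : Tendsto (fun y => 2 * (2 * |y - x|) ^ s) (𝓝 x) (𝓝 0) := by
      have : Continuous fun y => 2 * (2 * |y - x|) ^ s := by
        refine continuous_const.mul (Continuous.rpow_const (by fun_prop) fun _ => Or.inr hs.le)
      convert this.tendsto x using 2
      simp [Real.zero_rpow hs.ne']
    refine squeeze_zero' (Eventually.of_forall fun _ => dist_nonneg) ?_ hb
    filter_upwards [Metric.closedBall_mem_nhds x one_pos] with y hy
    rw [Real.dist_eq]
    exact hle' x y (by simpa [Real.dist_eq] using hy)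
  let f : StieltjesFunction ℝ := ⟨F, hmono, fun x => hcont.continuousWithinAt⟩
  have hIcc : ∀ x y, f.measure (Set.Icc x y) = ENNReal.ofReal (F y - F x) := by
    intro x y
    rw [StieltjesFunction.measure_Icc]
    congr 2
    exact (hcont.continuousAt.continuousWithinAt).leftLim_eq
  have hnull : f.measure Kᶜ = 0 := by
    refine measure_null_of_locally_null _ fun x hx => ?_
    obtain ⟨ε, hε, hball⟩ := Metric.isOpen_iff.1 hK.isClosed.isOpen_compl x hx
    refine ⟨Set.Icc (x - ε / 2) (x + ε / 2),
      mem_nhdsWithin_of_mem_nhds (Icc_mem_nhds (by linarith) (by linarith)), ?_⟩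
    -- `K` misses a neighbourhood of `x`, so `F` is constant there and the measure gives it no mass.
    have : K ∩ Set.Iic (x + ε / 2) = K ∩ Set.Iic (x - ε / 2) := by
      ext z
      refine and_congr_right fun hz => ⟨fun h1 => ?_, fun h1 => ?_⟩
      · by_contra h2
        refine hball (a := z) ?_ hz
        simp only [Set.mem_Iic, not_le] at h1 h2
        rw [Metric.mem_ball, Real.dist_eq, abs_lt]
        constructor <;> linarith
      · simp only [Set.mem_Iic] at h1 ⊢
        linarith
    rw [hIcc]
    simp [F, this]
  refine ⟨f.measure, ⟨?_⟩, ?_, hnull, fun x y hxy h1 => ?_⟩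
  · have h1 : f.measure Set.univ ≤ f.measure (Set.Icc a (a + 1)) + f.measure Kᶜ := by
      refine (measure_mono ?_).trans (measure_union_le _ _)
      intro x _
      by_cases hx : x ∈ K
      exacts [Or.inl (hKa hx), Or.inr hx]
    refine h1.trans_lt ?_
    rw [hnull, add_zero, hIcc]
    exact ENNReal.ofReal_lt_top
  · intro h0
    have h1 := hIcc (a - 1) (a + 1)
    rw [h0] at h1
    have e1 : K ∩ Set.Iic (a - 1) = ∅ := by
      ext z
      simp only [Set.mem_inter_iff, Set.mem_Iic, Set.mem_empty_iff_false, iff_false, not_and, not_le]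
      intro hz
      linarith [(hKa hz).1]
    have e2 : K ∩ Set.Iic (a + 1) = K := Set.inter_eq_left.2 fun z hz => (hKa hz).2
    simp only [F, e1, e2, dyadicContent_empty, ENNReal.toReal_zero, sub_zero,
      ENNReal.ofReal_toReal hfin] at h1
    exact h.ne h1
  · rw [hIcc]
    exact ENNReal.ofReal_le_ofReal (hle x y hxy h1)

/-- **Frostman's lemma** for Borel subsets of the line. -/
theorem exists_frostman {s : ℝ≥0} (hs : 0 < s) {A : Set ℝ} (hA : MeasurableSet A)
    (h : (s : ℝ≥0∞) < dimH A) {δ : ℝ} (hδ : 0 < δ) :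
    ∃ K ⊆ A, IsCompact K ∧ (∀ x ∈ K, ∀ y ∈ K, |x - y| ≤ δ) ∧ ∃ μ : Measure ℝ,
      IsFiniteMeasure μ ∧ μ ≠ 0 ∧ μ Kᶜ = 0 ∧
      ∀ x y, x < y → y - x ≤ 1 →
        μ (Set.Icc x y) ≤ ENNReal.ofReal (2 * (2 * (y - x)) ^ (s : ℝ)) := by
  wlog hδ1 : δ ≤ 1 generalizing δ
  · obtain ⟨K, hKA, hK, hd, hμ⟩ := this one_pos le_rfl
    exact ⟨K, hKA, hK, fun x hx y hy => (hd x hx y hy).trans (not_le.1 hδ1).le, hμ⟩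
  -- Countable stability of the dimension leaves one piece of length `δ` whose dimension still
  -- exceeds `s`.
  have hun : A = ⋃ k : ℤ, A ∩ Set.Icc (k * δ) (k * δ + δ) := by
    rw [← Set.inter_iUnion, eq_comm, Set.inter_eq_left]
    intro x _
    refine Set.mem_iUnion.2 ⟨⌊x / δ⌋, ?_, ?_⟩
    · rw [← le_div_iff₀ hδ]; exact Int.floor_le _
    · have := (Int.lt_floor_add_one (x / δ)).le
      rw [div_le_iff₀ hδ] at this
      linarith
  rw [hun, dimH_iUnion, lt_iSup_iff] at h
  obtain ⟨k, hk⟩ := h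
  obtain ⟨K, hKA, hK, hpos⟩ := exists_isCompact_dyadicContent_pos s (hA.inter measurableSet_Icc)
    (dyadicContent_pos_of_lt_dimH hs hk)
  refine ⟨K, hKA.trans Set.inter_subset_left, hK, fun x hx y hy => ?_, ?_⟩
  · have h1 := (hKA hx).2
    have h2 := (hKA hy).2
    rw [abs_le]
    constructor <;> linarith [h1.1, h1.2, h2.1, h2.2]
  · refine exists_frostman_of_isCompact (s := s) (by exact_mod_cast hs) hK (a := k * δ)
      (fun x hx => ?_) hpos
    have h1 := (hKA hx).2
    exact ⟨h1.1, h1.2.trans (by linarith)⟩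

/-! ### Energies of Frostman measures -/

/-- Off the diagonal, the single term whose dyadic scale brackets |x - y| already suffices. On the
diagonal every term is at least 1, so the sum is infinite. -/
theorem edist_rpow_neg_le_tsum {p : ℝ} (hp : 0 ≤ p) {x y : ℝ} (h : |x - y| ≤ 1) :
    edist x y ^ (-p) ≤ ∑' n : ℕ, ENNReal.ofReal ((2 : ℝ) ^ (p * (n + 1))) *
      (Metric.closedBall x ((2 : ℝ) ^ (-(n : ℝ)))).indicator 1 y := by
  rcases eq_or_ne x y with rfl | hxy
  · refine le_top.trans (top_le_iff.2 ?_)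
    refine top_le_iff.1 (le_trans (le_of_eq
      (ENNReal.tsum_const_eq_top_of_ne_zero (α := ℕ) one_ne_zero).symm)
      (ENNReal.tsum_le_tsum fun n => ?_))
    rw [Set.indicator_of_mem (Metric.mem_closedBall_self (by positivity)), Pi.one_apply, mul_one,
      ← ENNReal.ofReal_one]
    exact ENNReal.ofReal_le_ofReal (Real.one_le_rpow one_le_two (by positivity))
  · have hd : 0 < |x - y| := abs_pos.2 (sub_ne_zero.2 hxy)
    obtain ⟨n, hn1, hn2⟩ := exists_two_pow_bracket hd h
    refine le_trans ?_ (ENNReal.le_tsum n)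
    rw [Set.indicator_of_mem (by rwa [Metric.mem_closedBall, dist_comm, Real.dist_eq]),
      Pi.one_apply, mul_one, edist_dist, Real.dist_eq, ENNReal.ofReal_rpow_of_pos hd]
    refine ENNReal.ofReal_le_ofReal ?_
    rw [Real.rpow_neg hd.le, mul_comm p, Real.rpow_mul zero_le_two,
      ← Real.inv_rpow hd.le]
    refine Real.rpow_le_rpow (by positivity) ?_ hp
    rw [Real.rpow_neg zero_le_two, inv_lt_iff_one_lt_mul₀ (by positivity)] at hn2
    rw [inv_le_iff_one_le_mul₀ hd, Real.rpow_add zero_lt_two, Real.rpow_one]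
    nlinarith

/-- Frostman measures have finite energy of smaller orders. -/
theorem energy_lt_top {s p : ℝ} (hp : 0 ≤ p) (hps : p < s) {μ : Measure ℝ} [IsFiniteMeasure μ]
    {K : Set ℝ} (hμK : μ Kᶜ = 0) (hK : ∀ x ∈ K, ∀ y ∈ K, |x - y| ≤ 1)
    (hμ : ∀ x y, x < y → y - x ≤ 1 → μ (Set.Icc x y) ≤ ENNReal.ofReal (2 * (2 * (y - x)) ^ s)) :
    ∫⁻ x, ∫⁻ y, edist x y ^ (-p) ∂μ ∂μ < ⊤ := by
  have hae : ∀ᵐ x ∂μ, x ∈ K := by rwa [ae_iff]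
  -- For `n = 0` the ball has length 2, outside the range of the Frostman bound, and the total mass
  -- is used instead.
  have hball : ∀ x (n : ℕ), μ (Metric.closedBall x ((2 : ℝ) ^ (-(n : ℝ)))) ≤
      ENNReal.ofReal (4 ^ s * 2) * ENNReal.ofReal ((2 : ℝ) ^ (-(s * n))) +
        if n = 0 then μ Set.univ else 0 := by
    intro x n
    rcases Nat.eq_zero_or_pos n with rfl | hn
    · simpa using le_add_left (measure_mono (Set.subset_univ _))
    · rw [if_neg hn.ne', add_zero, Real.closedBall_eq_Icc, ← ENNReal.ofReal_mul (by positivity)]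
      have hpos : (0 : ℝ) < 2 ^ (-(n : ℝ)) := by positivity
      have hhalf : (2 : ℝ) ^ (-(n : ℝ)) ≤ 1 / 2 := by
        calc (2 : ℝ) ^ (-(n : ℝ)) ≤ 2 ^ (-1 : ℝ) :=
              Real.rpow_le_rpow_of_exponent_le one_le_two (by
                have : (1 : ℝ) ≤ n := by exact_mod_cast hn
                linarith)
          _ = 1 / 2 := by rw [Real.rpow_neg_one]; norm_num
      refine (hμ _ _ (by linarith) (by linarith)).trans (ENNReal.ofReal_le_ofReal (le_of_eq ?_))
      rw [show 2 * (x + 2 ^ (-(n : ℝ)) - (x - 2 ^ (-(n : ℝ)))) = 4 * (2 : ℝ) ^ (-(n : ℝ)) by ring,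
        Real.mul_rpow (by norm_num) hpos.le, ← Real.rpow_mul zero_le_two, neg_mul, mul_comm s]
      ring
  set B : ℝ≥0∞ := ∑' n : ℕ, ENNReal.ofReal ((2 : ℝ) ^ (p * (n + 1))) *
    (ENNReal.ofReal (4 ^ s * 2) * ENNReal.ofReal ((2 : ℝ) ^ (-(s * n))) +
        if n = 0 then μ Set.univ else 0)
  have hB : B < ⊤ := by
    simp only [B]
    simp_rw [mul_add (ENNReal.ofReal _)]
    rw [ENNReal.tsum_add]
    refine ENNReal.add_lt_top.2 ⟨?_, ?_⟩
    · have : ∀ n : ℕ, ENNReal.ofReal ((2 : ℝ) ^ (p * (n + 1))) *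
          (ENNReal.ofReal (4 ^ s * 2) * ENNReal.ofReal ((2 : ℝ) ^ (-(s * n)))) =
          ENNReal.ofReal (2 ^ p * (4 ^ s * 2) * (2 ^ (p - s)) ^ n) := by
        intro n
        rw [← ENNReal.ofReal_mul (by positivity), ← ENNReal.ofReal_mul (by positivity)]
        congr 1
        rw [← Real.rpow_natCast, ← Real.rpow_mul zero_le_two, mul_add, mul_one,
          Real.rpow_add zero_lt_two, sub_mul, sub_eq_add_neg, Real.rpow_add zero_lt_two]
        ring
      simp only [this]
      refine Summable.tsum_ofReal_lt_top ?_
      refine (summable_geometric_of_lt_one (by positivity) ?_).mul_left _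
      exact Real.rpow_lt_one_of_one_lt_of_neg one_lt_two (by linarith)
    · rw [tsum_eq_single 0 (by intro n hn; simp [hn])]
      simp [ENNReal.mul_lt_top]
  have hin : ∀ᵐ x ∂μ, ∫⁻ y, edist x y ^ (-p) ∂μ ≤ B := by
    filter_upwards [hae] with x hx
    calc ∫⁻ y, edist x y ^ (-p) ∂μ
        ≤ ∫⁻ y, ∑' n : ℕ, ENNReal.ofReal ((2 : ℝ) ^ (p * (n + 1))) *
            (Metric.closedBall x ((2 : ℝ) ^ (-(n : ℝ)))).indicator 1 y ∂μ := by
          refine lintegral_mono_ae ?_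
          filter_upwards [hae] with y hy
          exact edist_rpow_neg_le_tsum hp (hK x hx y hy)
      _ = ∑' n : ℕ, ENNReal.ofReal ((2 : ℝ) ^ (p * (n + 1))) *
            μ (Metric.closedBall x ((2 : ℝ) ^ (-(n : ℝ)))) := by
          rw [lintegral_tsum fun n => ((measurable_one.indicator
            Metric.isClosed_closedBall.measurableSet).const_mul _).aemeasurable]
          refine tsum_congr fun n => ?_
          rw [lintegral_const_mul _ (measurable_one.indicator
            Metric.isClosed_closedBall.measurableSet),
            lintegral_indicator_one Metric.isClosed_closedBall.measurableSet]
      _ ≤ B := ENNReal.tsum_le_tsum fun n => mul_le_mul_right (hball x n) _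
  calc ∫⁻ x, ∫⁻ y, edist x y ^ (-p) ∂μ ∂μ ≤ ∫⁻ _, B ∂μ := lintegral_mono_ae hin
    _ < ⊤ := by
      rw [lintegral_const]
      exact ENNReal.mul_lt_top hB (measure_lt_top _ _)

/-! ### Decay of the characteristic function of a random phase -/

theorem norm_cexp_I_mul_ofReal (x : ℝ) : ‖Complex.exp (Complex.I * (x : ℂ))‖ = 1 := by
  rw [mul_comm]; exact Complex.norm_exp_ofReal_mul_I x

/-- Away from the stationary points 0 and π of the cosine, integrate by parts: with g = i / (r sin
u) and f the exponential, (g f)' = f + g' f. The boundary terms and g' are controlled by sin u ≥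
2ε/π. -/
theorem norm_integral_phase_middle_le {r ε : ℝ} (hr : r ≠ 0) (hε : 0 < ε) (hε1 : ε ≤ 1) :
    ‖∫ u in ε..(Real.pi - ε), Complex.exp (Complex.I * ((r * Real.cos u : ℝ) : ℂ))‖ ≤
      Real.pi / (|r| * ε) + Real.pi ^ 3 / (4 * |r| * ε ^ 2) := by
  have hpi := Real.pi_gt_three
  have hr0 : 0 < |r| := abs_pos.2 hr
  have hab : ε ≤ Real.pi - ε := by linarith
  have hsin : ∀ u ∈ Set.Icc ε (Real.pi - ε), 2 / Real.pi * ε ≤ Real.sin u := by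
    intro u hu
    rcases le_total u (Real.pi / 2) with h | h
    · exact (by gcongr; exact hu.1 : 2 / Real.pi * ε ≤ 2 / Real.pi * u).trans
        (Real.mul_le_sin (hε.le.trans hu.1) h)
    · rw [← Real.sin_pi_sub]
      exact (by gcongr; linarith [hu.2] : 2 / Real.pi * ε ≤ 2 / Real.pi * (Real.pi - u)).trans
        (Real.mul_le_sin (by linarith [hu.2]) (by linarith))
  have hsin0 : ∀ u ∈ Set.Icc ε (Real.pi - ε), 0 < Real.sin u := fun u hu =>
    lt_of_lt_of_le (by positivity) (hsin u hu)
  set f : ℝ → ℂ := fun u => Complex.exp (Complex.I * ((r * Real.cos u : ℝ) : ℂ))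
  set g : ℝ → ℂ := fun u => Complex.I * (((r * Real.sin u)⁻¹ : ℝ) : ℂ)
  set g' : ℝ → ℂ := fun u => Complex.I * ((-(r * Real.cos u) / (r * Real.sin u) ^ 2 : ℝ) : ℂ)
  have hf : ∀ u, HasDerivAt f (f u * (Complex.I * ((r * (-Real.sin u) : ℝ) : ℂ))) u := by
    intro u
    exact (((Real.hasDerivAt_cos u).const_mul r).ofReal_comp.const_mul Complex.I).cexp
  have hg : ∀ u ∈ Set.Icc ε (Real.pi - ε), HasDerivAt g (g' u) u := by
    intro u hu
    exact ((((Real.hasDerivAt_sin u).const_mul r).inv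
      (mul_ne_zero hr (hsin0 u hu).ne')).ofReal_comp.const_mul Complex.I)
  have hfn : ∀ u, ‖f u‖ = 1 := fun u => norm_cexp_I_mul_ofReal _
  have hfc : Continuous f := continuous_iff_continuousAt.2 fun u => (hf u).continuousAt
  have hgc : ContinuousOn g' (Set.uIcc ε (Real.pi - ε)) := by
    rw [Set.uIcc_of_le hab]
    refine continuousOn_const.mul (Complex.continuous_ofReal.comp_continuousOn ?_)
    refine ContinuousOn.div (by fun_prop) (by fun_prop) fun u hu => ?_
    exact pow_ne_zero _ (mul_ne_zero hr (hsin0 u hu).ne')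
  have hderiv : ∀ u ∈ Set.uIcc ε (Real.pi - ε),
      HasDerivAt (fun u => g u * f u) (f u + g' u * f u) u := by
    rw [Set.uIcc_of_le hab]
    intro u hu
    refine ((hg u hu).mul (hf u)).congr_deriv ?_
    rw [add_comm]
    congr 1
    have h1 : (r : ℂ) ≠ 0 := by exact_mod_cast hr
    have h2 : Complex.sin u ≠ 0 := by exact_mod_cast (hsin0 u hu).ne'
    simp only [g]
    push_cast
    field_simp
    rw [Complex.I_sq]
    ring
  have hint1 : IntervalIntegrable f volume ε (Real.pi - ε) := hfc.intervalIntegrable _ _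
  have hint2 : IntervalIntegrable (fun u => g' u * f u) volume ε (Real.pi - ε) :=
    (hgc.mul hfc.continuousOn).intervalIntegrable
  have key := intervalIntegral.integral_eq_sub_of_hasDerivAt hderiv (hint1.add hint2)
  rw [intervalIntegral.integral_add hint1 hint2] at key
  have key' := eq_sub_of_add_eq key
  rw [key']
  have hgn : ∀ u ∈ Set.Icc ε (Real.pi - ε), ‖g u * f u‖ ≤ Real.pi / (2 * |r| * ε) := by
    intro u hu
    rw [norm_mul, hfn, mul_one, norm_mul, Complex.norm_I, one_mul, Complex.norm_real, norm_inv,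
      norm_mul, Real.norm_eq_abs, Real.norm_eq_abs, abs_of_pos (hsin0 u hu),
      inv_le_iff_one_le_mul₀ (mul_pos hr0 (hsin0 u hu))]
    calc (1 : ℝ) = Real.pi / (2 * |r| * ε) * (|r| * (2 / Real.pi * ε)) := by
          field_simp
      _ ≤ _ := by gcongr; exact hsin u hu
  have hgn' : ∀ u ∈ Set.uIoc ε (Real.pi - ε), ‖g' u * f u‖ ≤ Real.pi ^ 2 / (4 * |r| * ε ^ 2) := by
    rw [Set.uIoc_of_le hab]
    intro u hu
    have hu' : u ∈ Set.Icc ε (Real.pi - ε) := ⟨hu.1.le, hu.2⟩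
    have hs := hsin u hu'
    have hs0 := hsin0 u hu'
    rw [norm_mul, hfn, mul_one, norm_mul, Complex.norm_I, one_mul, Complex.norm_real, norm_div,
      norm_neg, norm_pow, norm_mul, norm_mul, Real.norm_eq_abs, Real.norm_eq_abs, Real.norm_eq_abs,
      abs_of_pos hs0, div_le_iff₀ (by positivity)]
    calc |r| * |Real.cos u| ≤ |r| * 1 := by gcongr; exact Real.abs_cos_le_one u
      _ = Real.pi ^ 2 / (4 * |r| * ε ^ 2) * (|r| * (2 / Real.pi * ε)) ^ 2 := by
          field_simp
          norm_num
      _ ≤ _ := by gcongr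
  have hI := intervalIntegral.norm_integral_le_of_norm_le_const hgn'
  rw [abs_of_nonneg (show 0 ≤ Real.pi - ε - ε by linarith)] at hI
  refine (norm_sub_le _ _).trans (add_le_add ((norm_sub_le _ _).trans ?_) (hI.trans ?_))
  · refine (add_le_add (hgn _ ⟨hab, le_rfl⟩) (hgn _ ⟨le_rfl, hab⟩)).trans (le_of_eq ?_)
    field_simp
    norm_num
  · calc Real.pi ^ 2 / (4 * |r| * ε ^ 2) * (Real.pi - ε - ε)
        ≤ Real.pi ^ 2 / (4 * |r| * ε ^ 2) * Real.pi := by gcongr; linarith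
      _ = _ := by ring

/-- The cut-off ε = |r|^(-1/3) balances the length ε of the discarded ends against the term |r|^(-1)
ε^(-2) of the middle part. The order 1/3 is not sharp, but any power works since arbitrarily many
factors will be multiplied. -/
theorem norm_integral_phase_half_le {r : ℝ} (hr : r ≠ 0) :
    ‖∫ u in (0 : ℝ)..Real.pi, Complex.exp (Complex.I * ((r * Real.cos u : ℝ) : ℂ))‖ ≤
      (2 + Real.pi + Real.pi ^ 3) * |r| ^ (-(1 / 3) : ℝ) := by
  have hpi := Real.pi_gt_three
  have hr0 : 0 < |r| := abs_pos.2 hr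
  set ε := |r| ^ (-(1 / 3) : ℝ)
  have hε : 0 < ε := Real.rpow_pos_of_pos hr0 _
  have hb : ∀ a b : ℝ, ‖∫ u in a..b, Complex.exp (Complex.I * ((r * Real.cos u : ℝ) : ℂ))‖ ≤
      |b - a| := by
    intro a b
    simpa using intervalIntegral.norm_integral_le_of_norm_le_const (a := a) (b := b) (C := 1)
      fun u _ => (norm_cexp_I_mul_ofReal (r * Real.cos u)).le
  rcases le_total ε 1 with h1 | h1
  · have hr3 : |r| * ε ^ 3 = 1 := by
      rw [← Real.rpow_natCast, ← Real.rpow_mul hr0.le]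
      norm_num
      rw [Real.rpow_neg_one, mul_inv_cancel₀ hr0.ne']
    have hii : ∀ a b : ℝ, IntervalIntegrable
        (fun u => Complex.exp (Complex.I * ((r * Real.cos u : ℝ) : ℂ))) volume a b :=
      fun a b => Continuous.intervalIntegrable (by fun_prop) _ _
    rw [← intervalIntegral.integral_add_adjacent_intervals (hii 0 ε) (hii ε Real.pi),
      ← intervalIntegral.integral_add_adjacent_intervals (hii ε (Real.pi - ε)) (hii _ Real.pi)]
    have b1 := hb 0 ε
    have b3 := hb (Real.pi - ε) Real.pi
    rw [abs_of_pos (by linarith)] at b1 b3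
    have b2 := norm_integral_phase_middle_le hr hε h1
    have e1 : Real.pi / (|r| * ε) ≤ Real.pi * ε := by
      rw [div_le_iff₀ (by positivity)]
      nlinarith
    have e2 : Real.pi ^ 3 / (4 * |r| * ε ^ 2) ≤ Real.pi ^ 3 * ε := by
      rw [div_le_iff₀ (by positivity)]
      nlinarith [show Real.pi ^ 3 > 0 by positivity]
    refine (norm_add_le _ _).trans ((add_le_add b1 ((norm_add_le _ _).trans
      (add_le_add b2 b3))).trans ?_)
    linarith
  · refine (hb _ _).trans ?_
    rw [sub_zero, abs_of_pos Real.pi_pos]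
    nlinarith [show Real.pi ^ 3 > 0 by positivity]

/-- Decay of the zeroth Bessel function. -/
theorem exists_norm_integral_phase_le : ∃ C : ℝ, 0 < C ∧ ∀ r φ : ℝ, r ≠ 0 →
    ‖∫ x in (0 : ℝ)..1, Complex.exp (Complex.I *
      ((r * Real.cos (2 * Real.pi * x + φ) : ℝ) : ℂ))‖ ≤ C * |r| ^ (-(1 / 3) : ℝ) := by
  have hpi := Real.pi_pos
  refine ⟨2 + Real.pi + Real.pi ^ 3, by positivity, fun r φ hr => ?_⟩
  set f : ℝ → ℂ := fun u => Complex.exp (Complex.I * ((r * Real.cos u : ℝ) : ℂ))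
  have hii : ∀ a b : ℝ, IntervalIntegrable f volume a b :=
    fun a b => Continuous.intervalIntegrable (by fun_prop) _ _
  have hper : Function.Periodic f (2 * Real.pi) := fun u => by
    simp only [f, Real.cos_add_two_pi]
  have h1 := intervalIntegral.integral_comp_mul_add f (c := 2 * Real.pi) (by positivity) φ
    (a := 0) (b := 1)
  rw [h1, mul_zero, zero_add, mul_one, add_comm (2 * Real.pi), hper.intervalIntegral_add_eq φ 0,
    zero_add, ← intervalIntegral.integral_add_adjacent_intervals (hii 0 Real.pi) (hii _ _)]
  -- A shift by π changes the sign of the cosine, so the second half-period is the first one with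
  -- `-r`.
  have h2 : ∫ u in Real.pi..(2 * Real.pi), f u =
      ∫ u in (0 : ℝ)..Real.pi, Complex.exp (Complex.I * (((-r) * Real.cos u : ℝ) : ℂ)) := by
    have := intervalIntegral.integral_comp_add_right f Real.pi (a := 0) (b := Real.pi)
    rw [zero_add, ← two_mul] at this
    rw [← this]
    refine intervalIntegral.integral_congr fun u _ => ?_
    simp only [f, Real.cos_add_pi, mul_neg, neg_mul]
  rw [h2, norm_smul, norm_inv, Real.norm_of_nonneg (by positivity),
    inv_mul_le_iff₀ (by positivity)]
  refine (norm_add_le _ _).trans ((add_le_add (norm_integral_phase_half_le hr)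
    (norm_integral_phase_half_le (neg_ne_zero.2 hr))).trans ?_)
  rw [abs_neg]
  have : 0 ≤ |r| ^ (-(1 / 3) : ℝ) := by positivity
  nlinarith [Real.pi_gt_three, mul_nonneg (show (0 : ℝ) ≤ 2 + Real.pi + Real.pi ^ 3 by positivity) this]

/-! ### The Weierstrass series -/

/-- The amplitudes of the Weierstrass series. -/
noncomputable def wAmp (β lam : ℝ) (n : ℕ) : ℝ := lam ^ (-β * ((n : ℝ) + 1))

/-- The coefficient of the `n`-th phase in the increment of the Weierstrass series. -/
noncomputable def wDiff (β lam x y : ℝ) (n : ℕ) : ℂ :=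
  (wAmp β lam n : ℂ) * (Complex.exp (2 * (Real.pi : ℂ) * Complex.I * ((lam ^ (n + 1) * x : ℝ) : ℂ)) -
    Complex.exp (2 * (Real.pi : ℂ) * Complex.I * ((lam ^ (n + 1) * y : ℝ) : ℂ)))

/-- The point of the unit circle with phase `t`. -/
noncomputable def unitPhase (t : ℝ) : ℂ := Complex.exp (2 * (Real.pi : ℂ) * Complex.I * (t : ℂ))

theorem norm_unitPhase (t : ℝ) : ‖unitPhase t‖ = 1 := by
  rw [unitPhase, show 2 * (Real.pi : ℂ) * Complex.I * (t : ℂ) =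
    Complex.I * ((2 * Real.pi * t : ℝ) : ℂ) by push_cast; ring]
  exact norm_cexp_I_mul_ofReal _

theorem unitPhase_add (s t : ℝ) : unitPhase (s + t) = unitPhase s * unitPhase t := by
  rw [unitPhase, unitPhase, unitPhase, ← Complex.exp_add]
  push_cast
  ring_nf

theorem continuous_unitPhase : Continuous unitPhase := by
  unfold unitPhase; fun_prop

theorem norm_unitPhase_sub (s t : ℝ) :
    ‖unitPhase s - unitPhase t‖ = 2 * |Real.sin (Real.pi * (s - t))| := by
  have : unitPhase s - unitPhase t = unitPhase t * (unitPhase (s - t) - 1) := by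
    rw [mul_sub, ← unitPhase_add, mul_one, add_sub_cancel]
  rw [this, norm_mul, norm_unitPhase, one_mul, unitPhase,
    show 2 * (Real.pi : ℂ) * Complex.I * ((s - t : ℝ) : ℂ) =
    Complex.I * ((2 * Real.pi * (s - t) : ℝ) : ℂ) by push_cast; ring,
    Complex.norm_exp_I_mul_ofReal_sub_one, norm_mul, Real.norm_eq_abs, Real.norm_eq_abs, abs_two]
  ring_nf

theorem wAmp_pos (β : ℝ) {lam : ℝ} (hlam : 1 < lam) (n : ℕ) : 0 < wAmp β lam n :=
  Real.rpow_pos_of_pos (by linarith) _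

theorem summable_wAmp {β lam : ℝ} (hβ : 0 < β) (hlam : 1 < lam) : Summable (wAmp β lam) := by
  have h0 : 0 < lam := by linarith
  have h1 : lam ^ (-β) < 1 := Real.rpow_lt_one_of_one_lt_of_neg hlam (by linarith)
  refine ((summable_geometric_of_lt_one (by positivity) h1).mul_left (lam ^ (-β))).congr
    fun n => ?_
  rw [wAmp, ← Real.rpow_natCast, ← Real.rpow_mul h0.le, ← Real.rpow_add h0]
  ring_nf

theorem norm_wAmp_mul (β : ℝ) {lam : ℝ} (hlam : 1 < lam) (n : ℕ) (t : ℝ) :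
    ‖(wAmp β lam n : ℂ) * unitPhase t‖ = wAmp β lam n := by
  rw [norm_mul, norm_unitPhase, mul_one, Complex.norm_real,
    Real.norm_of_nonneg (wAmp_pos β hlam n).le]

theorem summable_weierstrass {β lam : ℝ} (hβ : 0 < β) (hlam : 1 < lam) (θ : ℕ → ℝ) (x : ℝ) :
    Summable fun n => (wAmp β lam n : ℂ) * unitPhase (lam ^ (n + 1) * x + θ n) :=
  .of_norm ((summable_wAmp hβ hlam).congr fun n => (norm_wAmp_mul β hlam n _).symm)

theorem continuous_weierstrass {β lam : ℝ} (hβ : 0 < β) (hlam : 1 < lam) :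
    Continuous fun p : (ℕ → ℝ) × ℝ => weierstrass β lam p.1 p.2 := by
  refine continuous_tsum (fun n => ?_) (summable_wAmp hβ hlam) fun n p =>
    (norm_wAmp_mul β hlam n (lam ^ (n + 1) * p.2 + p.1 n)).le
  exact continuous_const.mul (continuous_unitPhase.comp (by fun_prop))

theorem wDiff_eq (β lam x y : ℝ) (n : ℕ) : wDiff β lam x y n =
    (wAmp β lam n : ℂ) * (unitPhase (lam ^ (n + 1) * x) - unitPhase (lam ^ (n + 1) * y)) := rfl

theorem norm_wDiff (β : ℝ) {lam : ℝ} (hlam : 1 < lam) (x y : ℝ) (n : ℕ) :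
    ‖wDiff β lam x y n‖ =
      wAmp β lam n * (2 * |Real.sin (Real.pi * (lam ^ (n + 1) * (x - y)))|) := by
  rw [wDiff_eq, norm_mul, norm_unitPhase_sub, Complex.norm_real,
    Real.norm_of_nonneg (wAmp_pos β hlam n).le, mul_sub (lam ^ (n + 1))]

theorem hasSum_weierstrass_sub {β lam : ℝ} (hβ : 0 < β) (hlam : 1 < lam) (θ : ℕ → ℝ) (x y : ℝ) :
    HasSum (fun n => wDiff β lam x y n * unitPhase (θ n))
      (weierstrass β lam θ x - weierstrass β lam θ y) := by
  refine ((summable_weierstrass hβ hlam θ x).hasSum.sub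
    (summable_weierstrass hβ hlam θ y).hasSum).congr_fun ?_
  intro n
  rw [wDiff_eq, unitPhase_add, unitPhase_add]
  ring

/-- The Weierstrass function is Hölder continuous of every exponent below `β`. -/
theorem exists_norm_weierstrass_sub_le {β lam : ℝ} (hlam : 1 < lam) (hβ' : β ≤ 1)
    {b : ℝ} (hb : 0 < b) (hbβ : b < β) : ∃ C : ℝ, 0 < C ∧ ∀ (θ : ℕ → ℝ) (x y : ℝ),
      ‖weierstrass β lam θ x - weierstrass β lam θ y‖ ≤ C * |x - y| ^ b := by
  have h0 : 0 < lam := by linarith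
  have hpi := Real.pi_pos
  have hs := summable_wAmp (sub_pos.2 hbβ) hlam
  have hS : 0 < ∑' n, wAmp (β - b) lam n :=
    hs.tsum_pos (fun n => (wAmp_pos _ hlam n).le) 0 (wAmp_pos _ hlam 0)
  refine ⟨2 * Real.pi ^ b * ∑' n, wAmp (β - b) lam n, by positivity, fun θ x y => ?_⟩
  have hterm : ∀ n, ‖wDiff β lam x y n * unitPhase (θ n)‖ ≤
      2 * Real.pi ^ b * |x - y| ^ b * wAmp (β - b) lam n := by
    intro n
    rw [norm_mul, norm_unitPhase, mul_one, norm_wDiff β hlam]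
    -- Interpolation between |sin t| ≤ 1 and |sin t| ≤ |t|. The power b of the frequency lowers the
    -- decay exponent of the amplitude from β to β - b, still positive, so the series converges.
    have hsin : |Real.sin (Real.pi * (lam ^ (n + 1) * (x - y)))| ≤
        |Real.pi * (lam ^ (n + 1) * (x - y))| ^ b := by
      rcases le_total 1 |Real.pi * (lam ^ (n + 1) * (x - y))| with h | h
      · exact (Real.abs_sin_le_one _).trans (Real.one_le_rpow h hb.le)
      · refine Real.abs_sin_le_abs.trans ?_
        rcases (abs_nonneg (Real.pi * (lam ^ (n + 1) * (x - y)))).eq_or_lt with h' | h'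
        · rw [← h', Real.zero_rpow hb.ne']
        · simpa using Real.rpow_le_rpow_of_exponent_ge h' h (hbβ.le.trans hβ')
    have hamp : wAmp (β - b) lam n = wAmp β lam n * (lam ^ (n + 1)) ^ b := by
      rw [wAmp, wAmp, ← Real.rpow_natCast, ← Real.rpow_mul h0.le, ← Real.rpow_add h0]
      push_cast
      ring_nf
    calc wAmp β lam n * (2 * |Real.sin (Real.pi * (lam ^ (n + 1) * (x - y)))|)
        ≤ wAmp β lam n * (2 * |Real.pi * (lam ^ (n + 1) * (x - y))| ^ b) := by
          have := (wAmp_pos β hlam n).le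
          gcongr
      _ = _ := by
          rw [hamp, abs_mul, abs_mul, abs_of_pos hpi, abs_of_pos (pow_pos h0 _),
            Real.mul_rpow hpi.le (by positivity), Real.mul_rpow (by positivity) (by positivity)]
          ring
  have := tsum_of_norm_bounded (hs.hasSum.mul_left (2 * Real.pi ^ b * |x - y| ^ b)) hterm
  rw [(hasSum_weierstrass_sub (hb.trans hbβ) hlam θ x y).tsum_eq] at this
  linarith

/-- Many frequencies contribute to the increment at its natural scale. -/
theorem exists_norm_wDiff_ge {β lam : ℝ} (hβ : 0 < β) (hlam : 1 < lam) (N : ℕ) {x y : ℝ}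
    (hxy : x ≠ y) (ht : |x - y| ≤ (2 * lam ^ N)⁻¹) :
    ∃ m, ∀ n ∈ Finset.Ico m (m + N), 2 * (lam ^ N)⁻¹ * |x - y| ^ β ≤ ‖wDiff β lam x y n‖ := by
  have h0 : 0 < lam := by linarith
  have hpi := Real.pi_pos
  have hd : 0 < |x - y| := abs_pos.2 (sub_ne_zero.2 hxy)
  have hN : (1 : ℝ) ≤ lam ^ N := one_le_pow₀ hlam.le
  have hN' : lam ^ N ≤ (2 * |x - y|)⁻¹ := by
    rw [le_inv_comm₀ (by positivity) (by positivity)]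
    rw [mul_inv] at ht
    linarith
  -- `n₀` is the last exponent with lam^n₀ ≤ 1 / (2|x - y|), and smallness of |x - y| gives `N ≤
  -- n₀`. For the `N` indices n just below `n₀`, lam^(n + 1) |x - y| lies between lam^(-N) / 2 and
  -- 1/2, so the sine is bounded below.
  obtain ⟨n₀, hn1, hn2⟩ := exists_nat_pow_near (hN.trans hN') hlam
  have hNn : N ≤ n₀ := Nat.lt_succ_iff.1 ((pow_lt_pow_iff_right₀ hlam).1 (hN'.trans_lt hn2))
  refine ⟨n₀ - N, fun n hn => ?_⟩
  rw [Nat.sub_add_cancel hNn, Finset.mem_Ico] at hn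
  rw [norm_wDiff β hlam]
  have hup : lam ^ (n + 1) * |x - y| ≤ 1 / 2 := by
    have : lam ^ (n + 1) ≤ lam ^ n₀ := pow_le_pow_right₀ hlam.le hn.2
    calc lam ^ (n + 1) * |x - y| ≤ (2 * |x - y|)⁻¹ * |x - y| := by gcongr; exact this.trans hn1
      _ = 1 / 2 := by field_simp
  have hlow : (lam ^ N)⁻¹ / 2 ≤ lam ^ (n + 1) * |x - y| := by
    have h1 : lam ^ (n₀ + 1) ≤ lam ^ (n + 1) * lam ^ N := by
      rw [← pow_add]; exact pow_le_pow_right₀ hlam.le (by omega)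
    have h2 : 1 < lam ^ (n₀ + 1) * (2 * |x - y|) := by
      rwa [inv_lt_iff_one_lt_mul₀ (by positivity)] at hn2
    rw [inv_eq_one_div, div_div, div_le_iff₀ (by positivity)]
    calc 1 ≤ lam ^ (n₀ + 1) * (2 * |x - y|) := h2.le
      _ ≤ (lam ^ (n + 1) * lam ^ N) * (2 * |x - y|) := by gcongr
      _ = _ := by ring
  have hsin : (lam ^ N)⁻¹ ≤ |Real.sin (Real.pi * (lam ^ (n + 1) * (x - y)))| := by
    have habs : |Real.pi * (lam ^ (n + 1) * (x - y))| = Real.pi * (lam ^ (n + 1) * |x - y|) := by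
      rw [abs_mul, abs_mul, abs_of_pos hpi, abs_of_pos (pow_pos h0 _)]
    refine le_trans ?_ (Real.mul_abs_le_abs_sin (by rw [habs]; nlinarith))
    rw [habs]
    calc (lam ^ N)⁻¹ = 2 / Real.pi * (Real.pi * ((lam ^ N)⁻¹ / 2)) := by field_simp
      _ ≤ _ := by gcongr
  have hamp : |x - y| ^ β ≤ wAmp β lam n := by
    have h1 : |x - y| ≤ (lam ^ (n + 1))⁻¹ := by
      rw [le_inv_comm₀ hd (by positivity), ← one_div, le_div_iff₀ hd]
      linarith
    refine (Real.rpow_le_rpow hd.le h1 hβ.le).trans (le_of_eq ?_)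
    rw [wAmp, ← Real.rpow_natCast, ← Real.rpow_neg h0.le, ← Real.rpow_mul h0.le]
    push_cast
    ring_nf
  calc 2 * (lam ^ N)⁻¹ * |x - y| ^ β = |x - y| ^ β * (2 * (lam ^ N)⁻¹) := by ring
    _ ≤ _ := by
      have := (wAmp_pos β hlam n).le
      gcongr

/-! ### Random phases and characteristic functions of increments -/

/-- A sequence of independent phases, uniformly distributed on `[0, 1]`. -/
structure IsRandomPhase {Ω : Type*} [MeasurableSpace Ω] (P : Measure Ω) (θ : ℕ → Ω → ℝ) : Prop where
  measurable : ∀ n, Measurable (θ n)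
  indep : iIndepFun θ P
  uniform : ∀ n, pdf.IsUniform (θ n) (Set.Icc 0 1) P volume

/-- Projecting a circle of radius ‖c‖ on ξ gives a cosine of amplitude ‖c‖ ‖ξ‖. Each independent
factor is thus a Bessel integral, and `φ` plays no role in its bound. -/
theorem exists_inner_mul_unitPhase (c ξ : ℂ) : ∃ φ : ℝ, ∀ t,
    inner ℝ (c * unitPhase t) ξ = ‖c‖ * ‖ξ‖ * Real.cos (2 * Real.pi * t + φ) := by
  refine ⟨-(starRingEnd ℂ c * ξ).arg, fun t => ?_⟩
  have h1 := Complex.norm_mul_exp_arg_mul_I (starRingEnd ℂ c * ξ)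
  have h2 : starRingEnd ℂ (c * unitPhase t) * ξ = ((‖c‖ * ‖ξ‖ : ℝ) : ℂ) *
      Complex.exp (((-(2 * Real.pi * t + -(starRingEnd ℂ c * ξ).arg) : ℝ) : ℂ) * Complex.I) := by
    have e1 : starRingEnd ℂ (unitPhase t) =
        Complex.exp (((-(2 * Real.pi * t) : ℝ) : ℂ) * Complex.I) := by
      rw [unitPhase, ← Complex.exp_conj]
      congr 1
      simp only [map_mul, Complex.conj_ofReal, Complex.conj_I, map_ofNat]
      push_cast
      ring
    have e2 : ‖c‖ * ‖ξ‖ = ‖starRingEnd ℂ c * ξ‖ := by rw [norm_mul, RCLike.norm_conj]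
    rw [map_mul, mul_right_comm, e1, e2]
    nth_rw 1 [← h1]
    rw [mul_assoc, ← Complex.exp_add]
    congr 2
    push_cast
    ring
  rw [Complex.inner, mul_comm ξ, h2, Complex.re_ofReal_mul, Complex.exp_ofReal_mul_I_re, Real.cos_neg]

section RandomPhase

variable {Ω : Type*} [MeasurableSpace Ω] {P : Measure Ω} {θ : ℕ → Ω → ℝ}

theorem integral_phase_eq (hθ : IsRandomPhase P θ) (n : ℕ) {f : ℝ → ℂ} (hf : Continuous f) :
    ∫ ω, f (θ n ω) ∂P = ∫ x in (0 : ℝ)..1, f x := by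
  have h := hθ.uniform n
  rw [← integral_map (hθ.measurable n).aemeasurable hf.aestronglyMeasurable, h,
    ProbabilityTheory.cond, Real.volume_Icc, intervalIntegral.integral_of_le zero_le_one,
    integral_Icc_eq_integral_Ioc.symm]
  simp

theorem norm_integral_cexp_le_one [IsProbabilityMeasure P] (f : Ω → ℝ) :
    ‖∫ ω, Complex.exp (Complex.I * (f ω : ℂ)) ∂P‖ ≤ 1 := by
  refine (norm_integral_le_of_norm_le_const (C := 1)
    (Eventually.of_forall fun ω => (norm_cexp_I_mul_ofReal (f ω)).le)).trans ?_
  simp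

/-- Decay of the characteristic function of an increment. -/
theorem exists_norm_charFun_increment_le {β lam : ℝ} (hβ : 0 < β) (hlam : 1 < lam) (M : ℕ) :
    ∃ C : ℝ, 0 < C ∧ ∃ t₀ : ℝ, 0 < t₀ ∧
    ∀ {Ω : Type*} [MeasurableSpace Ω] {P : Measure Ω} [IsProbabilityMeasure P] {θ : ℕ → Ω → ℝ},
    IsRandomPhase P θ → ∀ x y : ℝ, x ≠ y → |x - y| ≤ t₀ → ∀ ξ : ℂ, ξ ≠ 0 →
    ‖∫ ω, Complex.exp (Complex.I * ((inner ℝ (weierstrass β lam (fun n => θ n ω) x -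
      weierstrass β lam (fun n => θ n ω) y) ξ : ℝ) : ℂ)) ∂P‖ ≤
      C * (‖ξ‖ * |x - y| ^ β) ^ (-(M : ℝ)) := by
  have h0 : 0 < lam := by linarith
  obtain ⟨C, hC, hJ⟩ := exists_norm_integral_phase_le
  -- A window of `3 * M` frequencies is used: each factor decays with exponent 1/3, so their product
  -- has exponent `M`. The constant `c₀` is the lower bound for the coefficients on this window.
  set c₀ : ℝ := 2 * (lam ^ (3 * M))⁻¹
  have hc₀ : 0 < c₀ := by positivity
  refine ⟨C ^ (3 * M) * c₀ ^ (-(M : ℝ)), by positivity, (2 * lam ^ (3 * M))⁻¹, by positivity,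
    fun {Ω} _ {P} _ {θ} hθ x y hxy ht ξ hξ => ?_⟩
  have hξ' : 0 < ‖ξ‖ := norm_pos_iff.2 hξ
  have hd : 0 < |x - y| := abs_pos.2 (sub_ne_zero.2 hxy)
  obtain ⟨m, hm⟩ := exists_norm_wDiff_ge hβ hlam (3 * M) hxy ht
  set f : ℕ → ℝ → ℂ := fun n t =>
    Complex.exp (Complex.I * ((inner ℝ (wDiff β lam x y n * unitPhase t) ξ : ℝ) : ℂ))
  have hfc : ∀ n, Continuous (f n) := by
    intro n
    have := continuous_unitPhase
    fun_prop
  have hfn : ∀ n t, ‖f n t‖ = 1 := fun n t => norm_cexp_I_mul_ofReal _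
  have hfac1 : ∀ n, ‖∫ ω, f n (θ n ω) ∂P‖ ≤ 1 := fun n => norm_integral_cexp_le_one _
  have hfac : ∀ n ∈ Finset.Ico m (m + 3 * M), ‖∫ ω, f n (θ n ω) ∂P‖ ≤
      C * (c₀ * (‖ξ‖ * |x - y| ^ β)) ^ (-(1 / 3) : ℝ) := by
    intro n hn
    have hlow := hm n hn
    have hpos : 0 < ‖wDiff β lam x y n‖ := lt_of_lt_of_le (by positivity) hlow
    rw [integral_phase_eq hθ n (hfc n)]
    obtain ⟨φ, hφ⟩ := exists_inner_mul_unitPhase (wDiff β lam x y n) ξ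
    simp only [f, hφ]
    refine (hJ _ φ (mul_pos hpos hξ').ne').trans ?_
    rw [abs_of_pos (mul_pos hpos hξ')]
    refine mul_le_mul_of_nonneg_left ?_ hC.le
    refine Real.rpow_le_rpow_of_nonpos (by positivity) ?_ (by norm_num)
    calc c₀ * (‖ξ‖ * |x - y| ^ β) = (c₀ * |x - y| ^ β) * ‖ξ‖ := by ring
      _ ≤ _ := by gcongr
  -- Factors outside the window have modulus at most 1. The bound is uniform in `k` and passes to
  -- the full series by dominated convergence.
  have hpart : ∀ k, m + 3 * M ≤ k → ‖∫ ω, ∏ n ∈ Finset.range k, f n (θ n ω) ∂P‖ ≤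
      C ^ (3 * M) * c₀ ^ (-(M : ℝ)) * (‖ξ‖ * |x - y| ^ β) ^ (-(M : ℝ)) := by
    intro k hk
    have hind : ∫ ω, ∏ n ∈ Finset.range k, f n (θ n ω) ∂P =
        ∏ n ∈ Finset.range k, ∫ ω, f n (θ n ω) ∂P := by
      have := (hθ.indep.precomp (g := fun i : Fin k => (i : ℕ)) Fin.val_injective
        ).integral_fun_prod_comp (f := fun i : Fin k => f i)
        (fun i => (hθ.measurable i).aemeasurable) (fun i => (hfc i).aestronglyMeasurable)
      simp only [Finset.prod_range]
      exact this
    rw [hind, norm_prod]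
    have hsub : Finset.Ico m (m + 3 * M) ⊆ Finset.range k := by
      intro i hi
      rw [Finset.mem_Ico] at hi
      exact Finset.mem_range.2 (by omega)
    calc ∏ n ∈ Finset.range k, ‖∫ ω, f n (θ n ω) ∂P‖
        ≤ ∏ n ∈ Finset.Ico m (m + 3 * M), ‖∫ ω, f n (θ n ω) ∂P‖ := by
          rw [← Finset.prod_sdiff hsub]
          exact mul_le_of_le_one_left (Finset.prod_nonneg fun _ _ => norm_nonneg _)
            (Finset.prod_le_one (fun _ _ => norm_nonneg _) fun n _ => hfac1 n)
      _ ≤ ∏ n ∈ Finset.Ico m (m + 3 * M), C * (c₀ * (‖ξ‖ * |x - y| ^ β)) ^ (-(1 / 3) : ℝ) :=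
          Finset.prod_le_prod (fun _ _ => norm_nonneg _) hfac
      _ = _ := by
          rw [Finset.prod_const, Nat.card_Ico, Nat.add_sub_cancel_left, mul_pow,
            ← Real.rpow_natCast (_ ^ (-(1 / 3) : ℝ)), ← Real.rpow_mul (by positivity),
            Real.mul_rpow hc₀.le (by positivity), mul_assoc]
          push_cast
          rw [show (-(1 / 3) : ℝ) * (3 * M) = -M by ring]
  refine le_of_tendsto (Tendsto.norm (tendsto_integral_of_dominated_convergence (μ := P)
    (F := fun k ω => ∏ n ∈ Finset.range k, f n (θ n ω)) (fun _ => 1) (fun k => ?_)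
    (integrable_const 1) (fun k => Eventually.of_forall fun ω => ?_)
    (Eventually.of_forall fun ω => ?_))) (eventually_atTop.2 ⟨_, hpart⟩)
  · refine Measurable.aestronglyMeasurable (Finset.measurable_prod _ fun n _ => ?_)
    exact (hfc n).measurable.comp (hθ.measurable n)
  · rw [norm_prod]
    simp [hfn]
  · have hs := (hasSum_weierstrass_sub hβ hlam (fun n => θ n ω) x y).tendsto_sum_nat
    have hprod : ∀ k, ∏ n ∈ Finset.range k, f n (θ n ω) = Complex.exp (Complex.I *
        ((inner ℝ (∑ n ∈ Finset.range k, wDiff β lam x y n * unitPhase (θ n ω)) ξ : ℝ) : ℂ)) := by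
      intro k
      rw [sum_inner, Complex.ofReal_sum, Finset.mul_sum, Complex.exp_sum]
    simp only [hprod]
    have hcont : Continuous fun z : ℂ =>
        Complex.exp (Complex.I * ((inner ℝ z ξ : ℝ) : ℂ)) := by fun_prop
    exact (hcont.tendsto _).comp hs

end RandomPhase

/-! ### Small balls -/

/-- The trivial bound serves for u ≤ 1 and the decay for u ≥ 1; together they remove the singularity
at frequency zero. -/
theorem norm_le_of_decay {u v C : ℝ} {M : ℕ} (hC : 0 < C) (hu : 0 < u) (h1 : v ≤ 1)
    (h2 : v ≤ C * u ^ (-(M : ℝ))) : v ≤ (1 + C) * 2 ^ M * (1 + u) ^ (-(M : ℝ)) := by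
  rw [Real.rpow_neg (by positivity), Real.rpow_natCast]
  rw [Real.rpow_neg hu.le, Real.rpow_natCast] at h2
  rcases le_total u 1 with h | h
  · refine h1.trans ?_
    rw [← div_eq_mul_inv, le_div_iff₀ (by positivity), one_mul]
    calc (1 + u) ^ M ≤ 2 ^ M := pow_le_pow_left₀ (by positivity) (by linarith) _
      _ ≤ (1 + C) * 2 ^ M := le_mul_of_one_le_left (by positivity) (by linarith)
  · refine h2.trans ?_
    rw [← div_eq_mul_inv, ← div_eq_mul_inv, div_le_div_iff₀ (by positivity) (by positivity)]
    calc C * (1 + u) ^ M ≤ (1 + C) * (2 * u) ^ M := by gcongr <;> linarith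
      _ = _ := by rw [mul_pow]; ring

/-- A smoothed inversion formula for characteristic functions in the plane. -/
theorem integral_gaussian_eq {Ω : Type*} [MeasurableSpace Ω] {P : Measure Ω}
    [IsFiniteMeasure P] {X : Ω → ℂ} (hX : Measurable X) {b : ℝ} (hb : 0 < b) :
    ((Real.pi / b * ∫ ω, Real.exp (-(‖X ω‖ ^ 2 / (4 * b))) ∂P : ℝ) : ℂ) =
      ∫ ξ : ℂ, ∫ ω, Complex.exp (-(b : ℂ) * ‖ξ‖ ^ 2 + Complex.I * (inner ℝ (X ω) ξ : ℝ)) ∂P := by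
  have hb' : 0 < ((b : ℂ)).re := by simpa using hb
  have hint : Integrable (Function.uncurry fun (ω : Ω) (ξ : ℂ) =>
      Complex.exp (-(b : ℂ) * ‖ξ‖ ^ 2 + Complex.I * (inner ℝ (X ω) ξ : ℝ)))
      (P.prod volume) := by
    have hg := (GaussianFourier.integrable_cexp_neg_mul_sq_norm_add (V := ℂ) hb' 0 0).norm.comp_snd P
    refine Integrable.mono' hg (Measurable.aestronglyMeasurable ?_)
      (Eventually.of_forall fun p => ?_)
    · have h1 : Measurable fun p : Ω × ℂ => (inner ℝ (X p.1) p.2 : ℝ) :=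
        (hX.comp measurable_fst).inner measurable_snd
      unfold Function.uncurry
      fun_prop
    · simp only [Function.uncurry, Complex.norm_exp]
      apply le_of_eq
      congr 1
      simp
  rw [← integral_integral_swap hint]
  have hfr : (Module.finrank ℝ ℂ / 2 : ℂ) = 1 := by
    rw [Complex.finrank_real_complex]; norm_num
  simp only [GaussianFourier.integral_cexp_neg_mul_sq_norm_add (V := ℂ) hb', hfr, Complex.cpow_one]
  rw [integral_const_mul]
  push_cast
  rw [← integral_complex_ofReal]
  congr 2
  ext ω
  simp only [Complex.I_sq]
  push_cast
  ring_nf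

/-- A Gaussian of width comparable to r dominates e^(-1) times the indicator of the ball. Its mean
is an integral of the characteristic function against a Gaussian bounded by 1. Decay of order 3 is
integrable on the plane, and rescaling the frequency by `a` yields a^(-2). -/
theorem exists_measure_norm_le_le : ∃ C : ℝ, 0 < C ∧
    ∀ {Ω : Type*} [MeasurableSpace Ω] {P : Measure Ω} [IsProbabilityMeasure P] {X : Ω → ℂ},
    Measurable X → ∀ {D a r : ℝ}, 0 < a → 0 < r →
    (∀ ξ : ℂ, ‖∫ ω, Complex.exp (Complex.I * ((inner ℝ (X ω) ξ : ℝ) : ℂ)) ∂P‖ ≤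
      D * (1 + a * ‖ξ‖) ^ (-(3 : ℝ))) →
    P {ω | ‖X ω‖ ≤ r} ≤ ENNReal.ofReal (C * D * r ^ 2 / a ^ 2) := by
  have hpi := Real.pi_pos
  have hJ : Integrable (fun ξ : ℂ => (1 + ‖ξ‖) ^ (-(3 : ℝ))) :=
    integrable_one_add_norm (by rw [Complex.finrank_real_complex]; norm_num)
  set J := ∫ ξ : ℂ, (1 + ‖ξ‖) ^ (-(3 : ℝ))
  have hJ0 : 0 ≤ J := integral_nonneg fun ξ => by positivity
  refine ⟨Real.exp 1 / (4 * Real.pi) * (J + 1), by positivity,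
    fun {Ω} _ {P} _ {X} hX {D a r} ha hr hφ => ?_⟩
  have hD : 0 ≤ D := by
    have := hφ 0
    simp only [norm_zero, mul_zero, add_zero, Real.one_rpow, mul_one] at this
    exact (norm_nonneg _).trans this
  -- With 4b = r² the Gaussian exp(-‖X‖² / (4b)) is at least e^(-1) on ‖X‖ ≤ r.
  set b : ℝ := r ^ 2 / 4
  have hb : 0 < b := by positivity
  have hJa : ∫ ξ : ℂ, D * (1 + a * ‖ξ‖) ^ (-(3 : ℝ)) = D * ((a ^ 2)⁻¹ * J) := by
    rw [integral_const_mul]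
    congr 1
    have := Measure.integral_comp_smul_of_nonneg (volume : Measure ℂ)
      (fun ξ : ℂ => (1 + ‖ξ‖) ^ (-(3 : ℝ))) a (hR := ha.le)
    rw [Complex.finrank_real_complex, smul_eq_mul] at this
    rw [← this]
    simp [abs_of_pos ha]
  have hJi : Integrable (fun ξ : ℂ => D * (1 + a * ‖ξ‖) ^ (-(3 : ℝ))) := by
    have := (hJ.comp_smul ha.ne').const_mul D
    simpa [abs_of_pos ha] using this
  have hmain : Real.pi / b * ∫ ω, Real.exp (-(‖X ω‖ ^ 2 / (4 * b))) ∂P ≤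
      D * ((a ^ 2)⁻¹ * J) := by
    rw [← hJa]
    have h0 : 0 ≤ Real.pi / b * ∫ ω, Real.exp (-(‖X ω‖ ^ 2 / (4 * b))) ∂P :=
      mul_nonneg (by positivity) (integral_nonneg fun _ => (Real.exp_pos _).le)
    rw [← abs_of_nonneg h0, ← Real.norm_eq_abs, ← Complex.norm_real, integral_gaussian_eq hX hb]
    refine norm_integral_le_of_norm_le hJi (Eventually.of_forall fun ξ => ?_)
    simp only [Complex.exp_add]
    rw [integral_const_mul, norm_mul]
    refine (mul_le_of_le_one_left (norm_nonneg _) ?_).trans (hφ ξ)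
    rw [Complex.norm_exp, Real.exp_le_one_iff]
    norm_cast
    rw [neg_mul]
    exact neg_nonpos.2 (by positivity)
  have hmeas : MeasurableSet {ω | ‖X ω‖ ≤ r} := hX.norm measurableSet_Iic
  have hint : Integrable (fun ω => Real.exp (-(‖X ω‖ ^ 2 / (4 * b)))) P := by
    refine Integrable.of_bound (C := 1) ?_ (Eventually.of_forall fun ω => ?_)
    · exact Measurable.aestronglyMeasurable (by fun_prop)
    · rw [Real.norm_of_nonneg (Real.exp_pos _).le, Real.exp_le_one_iff, neg_nonpos]
      positivity
  have hcheb : Real.exp (-1) * P.real {ω | ‖X ω‖ ≤ r} ≤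
      ∫ ω, Real.exp (-(‖X ω‖ ^ 2 / (4 * b))) ∂P := by
    rw [mul_comm, ← smul_eq_mul, ← integral_indicator_const _ hmeas]
    refine integral_mono ((integrable_const _).indicator hmeas) hint fun ω => ?_
    by_cases hω : ω ∈ {ω | ‖X ω‖ ≤ r}
    · simp only [Set.indicator_of_mem hω]
      rw [Real.exp_le_exp, neg_le_neg_iff, div_le_one (by positivity),
        show 4 * b = r ^ 2 by simp only [b]; ring]
      exact pow_le_pow_left₀ (norm_nonneg _) hω 2
    · simp only [Set.indicator_of_notMem hω]
      exact (Real.exp_pos _).le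
  rw [← ofReal_measureReal]
  refine ENNReal.ofReal_le_ofReal ?_
  have h1 : Real.pi / b * (Real.exp (-1) * P.real {ω | ‖X ω‖ ≤ r}) ≤ D * ((a ^ 2)⁻¹ * J) :=
    (mul_le_mul_of_nonneg_left hcheb (by positivity)).trans hmain
  have h2 : P.real {ω | ‖X ω‖ ≤ r} =
      b / Real.pi * Real.exp 1 * (Real.pi / b * (Real.exp (-1) * P.real {ω | ‖X ω‖ ≤ r})) := by
    rw [Real.exp_neg]
    field_simp
  rw [h2]
  calc b / Real.pi * Real.exp 1 * (Real.pi / b * (Real.exp (-1) * P.real {ω | ‖X ω‖ ≤ r}))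
      ≤ b / Real.pi * Real.exp 1 * (D * ((a ^ 2)⁻¹ * J)) := by gcongr
    _ ≤ b / Real.pi * Real.exp 1 * (D * ((a ^ 2)⁻¹ * (J + 1))) := by gcongr; linarith
    _ = _ := by simp only [b]; field_simp

attribute [local irreducible] weierstrass

/-! ### Small-ball estimates for the Weierstrass increments -/

theorem measurable_weierstrass {β lam : ℝ} (hβ : 0 < β) (hlam : 1 < lam) {Ω : Type*}
    [MeasurableSpace Ω] {θ : ℕ → Ω → ℝ} (hθ : ∀ n, Measurable (θ n)) :
    Measurable fun p : Ω × ℝ => weierstrass β lam (fun n => θ n p.1) p.2 := by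
  have h1 : Measurable fun p : Ω × ℝ => ((fun n => θ n p.1 : ℕ → ℝ), p.2) :=
    (measurable_pi_lambda _ fun n => (hθ n).comp measurable_fst).prodMk measurable_snd
  have h2 : Measurable fun p : (ℕ → ℝ) × ℝ => weierstrass β lam p.1 p.2 :=
    (continuous_weierstrass hβ hlam).measurable
  exact h2.comp h1

/-- Decay of the characteristic function of an increment, in a form valid at all frequencies. -/
theorem exists_norm_charFun_increment_le_one_add {β lam : ℝ} (hβ : 0 < β) (hlam : 1 < lam) (M : ℕ) :
    ∃ C : ℝ, 0 < C ∧ ∃ t₀ : ℝ, 0 < t₀ ∧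
    ∀ {Ω : Type*} [MeasurableSpace Ω] {P : Measure Ω} [IsProbabilityMeasure P] {θ : ℕ → Ω → ℝ},
    IsRandomPhase P θ → ∀ x y : ℝ, x ≠ y → |x - y| ≤ t₀ → ∀ ξ : ℂ,
    ‖∫ ω, Complex.exp (Complex.I * ((inner ℝ (weierstrass β lam (fun n => θ n ω) x -
      weierstrass β lam (fun n => θ n ω) y) ξ : ℝ) : ℂ)) ∂P‖ ≤
      C * (1 + |x - y| ^ β * ‖ξ‖) ^ (-(M : ℝ)) := by
  obtain ⟨C, hC, t₀, ht₀, h⟩ := exists_norm_charFun_increment_le hβ hlam M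
  refine ⟨(1 + C) * 2 ^ M, by positivity, t₀, ht₀, fun hθ x y hxy ht ξ => ?_⟩
  rcases eq_or_ne ξ 0 with rfl | hξ
  · refine (norm_integral_cexp_le_one _).trans ?_
    simp only [norm_zero, mul_zero, add_zero, Real.one_rpow, mul_one]
    nlinarith [one_le_pow₀ (one_le_two (α := ℝ)) (n := M)]
  · have hd : 0 < |x - y| := abs_pos.2 (sub_ne_zero.2 hxy)
    have hξ' := norm_pos_iff.2 hξ
    refine norm_le_of_decay hC (by positivity) (norm_integral_cexp_le_one _) ?_
    rw [mul_comm (_ ^ β)]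
    exact h hθ x y hxy ht ξ hξ

/-- Increments of the Weierstrass function have bounded densities at their natural scale. -/
theorem exists_measure_increment_le {β lam : ℝ} (hβ : 0 < β) (hlam : 1 < lam) :
    ∃ C : ℝ, 0 < C ∧ ∃ t₀ : ℝ, 0 < t₀ ∧
    ∀ {Ω : Type*} [MeasurableSpace Ω] {P : Measure Ω} [IsProbabilityMeasure P] {θ : ℕ → Ω → ℝ},
    IsRandomPhase P θ → ∀ x y : ℝ, |x - y| ≤ t₀ → ∀ r : ℝ, 0 < r →
    P {ω | dist (weierstrass β lam (fun n => θ n ω) x) (weierstrass β lam (fun n => θ n ω) y) ≤ r}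
      ≤ ENNReal.ofReal (C * r ^ 2) * edist x y ^ (-(2 * β)) := by
  obtain ⟨C₁, hC₁, h₁⟩ := exists_measure_norm_le_le
  obtain ⟨D, hD, t₀, ht₀, h₂⟩ := exists_norm_charFun_increment_le_one_add hβ hlam 3
  refine ⟨C₁ * D, by positivity, t₀, ht₀, fun {Ω} _ {P} _ {θ} hθ x y ht r hr => ?_⟩
  rcases eq_or_ne x y with rfl | hxy
  · rw [edist_self, ENNReal.zero_rpow_of_neg (by linarith),
      ENNReal.mul_top (ENNReal.ofReal_pos.2 (by positivity)).ne']
    exact le_top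
  · have hd : 0 < |x - y| := abs_pos.2 (sub_ne_zero.2 hxy)
    have hm : ∀ z, Measurable fun ω => weierstrass β lam (fun n => θ n ω) z := fun z =>
      (measurable_weierstrass hβ hlam hθ.measurable).comp measurable_prodMk_right
    have h₃ := h₂ hθ x y hxy ht
    rw [Nat.cast_ofNat] at h₃
    have := h₁ ((hm x).sub (hm y)) (r := r) (a := |x - y| ^ β) (by positivity) hr h₃
    simp only [dist_eq_norm]
    refine this.trans (le_of_eq ?_)
    rw [edist_dist, Real.dist_eq, ENNReal.ofReal_rpow_of_pos hd,
      ← ENNReal.ofReal_mul (by positivity), Real.rpow_neg hd.le, mul_comm 2 β, Real.rpow_mul hd.le,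
      div_eq_mul_inv]
    norm_num

/-! ### Lower bounds for the dimension of random images -/

/-- The mass distribution principle for the image of a measure, in integrated dyadic form. -/
theorem le_dimH_image_of_lintegral_lt_top {X : Type*} [MetricSpace X] {f : ℝ → X} {K : Set ℝ}
    {μ : Measure ℝ} [IsFiniteMeasure μ] (hμ0 : μ ≠ 0) (hμK : μ Kᶜ = 0) {s : ℝ≥0} (hs : 0 < s)
    (hm : ∀ n : ℕ, Measurable fun x =>
      μ {y | dist (f x) (f y) ≤ (2 : ℝ) ^ (-(n : ℝ))})
    (h : ∑' n : ℕ, ENNReal.ofReal ((2 : ℝ) ^ (s * n : ℝ)) *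
      ∫⁻ x, μ {y | dist (f x) (f y) ≤ (2 : ℝ) ^ (-(n : ℝ))} ∂μ < ⊤) :
    (s : ℝ≥0∞) ≤ dimH (f '' K) := by
  borelize X
  set g : ℝ → ℝ≥0∞ := fun x => ∑' n : ℕ, ENNReal.ofReal ((2 : ℝ) ^ (s * n : ℝ)) *
    μ {y | dist (f x) (f y) ≤ (2 : ℝ) ^ (-(n : ℝ))}
  have hgm : Measurable g := Measurable.tsum fun n => (hm n).const_mul _
  have hg : ∫⁻ x, g x ∂μ < ⊤ := by
    rw [lintegral_tsum fun n => ((hm n).const_mul _).aemeasurable]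
    simpa only [lintegral_const_mul _ (hm _)] using h
  have hfin : ∀ᵐ x ∂μ, g x < ⊤ := ae_lt_top hgm hg.ne
  have hae : ∀ᵐ x ∂μ, x ∈ K := by rwa [ae_iff]
  -- `g` is finite almost everywhere, hence bounded by some `M` on a set of positive mass. There
  -- each single term of the series gives a ball estimate of order `s`.
  have hpos : ∃ M : ℕ, μ {x | x ∈ K ∧ g x ≤ M} ≠ 0 := by
    by_contra! hcon
    apply hμ0
    rw [← Measure.measure_univ_eq_zero]
    refine measure_mono_null (fun x _ => ?_) (measure_union_null (measure_iUnion_null hcon)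
      (show μ {x | ¬ (x ∈ K ∧ g x < ⊤)} = 0 from ae_iff.1 (hae.and hfin)))
    by_cases hx : x ∈ K ∧ g x < ⊤
    · obtain ⟨M, hM⟩ := ENNReal.exists_nat_gt hx.2.ne
      exact Or.inl (Set.mem_iUnion.2 ⟨M, hx.1, hM.le⟩)
    · exact Or.inr hx
  obtain ⟨M, hM⟩ := hpos
  set B := {x | x ∈ K ∧ g x ≤ M}
  have hball : ∀ x ∈ B, ∀ n : ℕ, μ {y | dist (f x) (f y) ≤ (2 : ℝ) ^ (-(n : ℝ))} ≤
      M * ENNReal.ofReal (((2 : ℝ) ^ (-(n : ℝ))) ^ (s : ℝ)) := by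
    intro x hx n
    have h1 := (ENNReal.le_tsum n).trans hx.2
    have h2 : ENNReal.ofReal (((2 : ℝ) ^ (-(n : ℝ))) ^ (s : ℝ)) *
        ENNReal.ofReal ((2 : ℝ) ^ (s * n : ℝ)) = 1 := by
      rw [← ENNReal.ofReal_mul (by positivity), ← Real.rpow_mul zero_le_two,
        ← Real.rpow_add zero_lt_two]
      ring_nf
      simp
    calc μ {y | dist (f x) (f y) ≤ (2 : ℝ) ^ (-(n : ℝ))}
        = ENNReal.ofReal (((2 : ℝ) ^ (-(n : ℝ))) ^ (s : ℝ)) *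
          (ENNReal.ofReal ((2 : ℝ) ^ (s * n : ℝ)) *
            μ {y | dist (f x) (f y) ≤ (2 : ℝ) ^ (-(n : ℝ))}) := by rw [← mul_assoc, h2, one_mul]
      _ ≤ ENNReal.ofReal (((2 : ℝ) ^ (-(n : ℝ))) ^ (s : ℝ)) * M := by gcongr
      _ = _ := mul_comm _ _
  have hset : ∀ t : Set X, Metric.ediam t ≤ 1 → μ (B ∩ f ⁻¹' t) ≤
      M * ENNReal.ofReal (2 ^ (s : ℝ)) * Metric.ediam t ^ (s : ℝ) := by
    intro t ht
    rcases Set.eq_empty_or_nonempty (B ∩ f ⁻¹' t) with he | ⟨x, hxB, hxt⟩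
    · rw [he]; simp
    have hdist : ∀ y ∈ f ⁻¹' t, dist (f x) (f y) ≤ (Metric.ediam t).toReal := by
      intro y hy
      rw [dist_edist]
      exact ENNReal.toReal_mono (ne_top_of_le_ne_top ENNReal.one_ne_top ht)
        (Metric.edist_le_ediam_of_mem hxt hy)
    have hle : ∀ n : ℕ, (Metric.ediam t).toReal ≤ (2 : ℝ) ^ (-(n : ℝ)) → μ (B ∩ f ⁻¹' t) ≤
        M * ENNReal.ofReal (((2 : ℝ) ^ (-(n : ℝ))) ^ (s : ℝ)) := fun n hn =>
      (measure_mono fun y hy => (hdist y hy.2).trans hn).trans (hball x hxB n)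
    have htop : Metric.ediam t ≠ ⊤ := ne_top_of_le_ne_top ENNReal.one_ne_top ht
    rcases eq_or_ne (Metric.ediam t) 0 with h0 | h0
    -- A covering set of diameter zero has no scale of its own: the ball estimate holds at every
    -- `n`, and the mass is zero in the limit.
    · have hlim : Tendsto (fun n : ℕ => (M : ℝ≥0∞) *
          ENNReal.ofReal (((2 : ℝ) ^ (-(n : ℝ))) ^ (s : ℝ))) atTop (𝓝 (M * 0)) := by
        refine ENNReal.Tendsto.const_mul ?_ (Or.inr (by simp))
        rw [← ENNReal.ofReal_zero]
        refine ENNReal.tendsto_ofReal ?_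
        have h1 : ((2 : ℝ) ^ (-(s : ℝ))) < 1 :=
          Real.rpow_lt_one_of_one_lt_of_neg one_lt_two (by simpa using hs)
        refine (tendsto_pow_atTop_nhds_zero_of_lt_one (by positivity) h1).congr fun n => ?_
        rw [← Real.rpow_natCast, ← Real.rpow_mul zero_le_two, ← Real.rpow_mul zero_le_two]
        ring_nf
      have := ge_of_tendsto' hlim fun n => hle n (by rw [h0]; simp)
      rw [mul_zero] at this
      exact this.trans zero_le
    · obtain ⟨n, hn1, hn2⟩ := exists_two_pow_bracket (ENNReal.toReal_pos h0 htop)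
        (by simpa using ENNReal.toReal_mono ENNReal.one_ne_top ht)
      refine (hle n hn1).trans ?_
      rw [mul_assoc]
      refine mul_le_mul_right ?_ _
      rw [← ENNReal.ofReal_toReal htop]
      rw [ENNReal.ofReal_rpow_of_nonneg ENNReal.toReal_nonneg s.coe_nonneg,
        ← ENNReal.ofReal_mul (by positivity), ← Real.mul_rpow zero_le_two ENNReal.toReal_nonneg]
      exact ENNReal.ofReal_le_ofReal (Real.rpow_le_rpow (by positivity) hn2.le s.2)
  set c : ℝ≥0∞ := M * ENNReal.ofReal (2 ^ (s : ℝ))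
  have hH : μ B / c ≤ μH[s] (f '' B) := by
    rw [Measure.hausdorffMeasure_apply]
    refine le_trans ?_ (le_iSup₂ (f := fun (r : ℝ≥0∞) (_ : 0 < r) =>
      ⨅ (t : ℕ → Set X) (_ : f '' B ⊆ ⋃ n, t n) (_ : ∀ n, Metric.ediam (t n) ≤ r),
        ∑' n, ⨆ _ : (t n).Nonempty, Metric.ediam (t n) ^ (s : ℝ)) 1 one_pos)
    refine le_iInf fun t => le_iInf fun htB => le_iInf fun hd =>
      ENNReal.div_le_of_le_mul ?_
    calc μ B ≤ μ (⋃ n, B ∩ f ⁻¹' (t n)) := by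
          refine measure_mono fun x hx => ?_
          obtain ⟨n, hn⟩ := Set.mem_iUnion.1 (htB (Set.mem_image_of_mem f hx))
          exact Set.mem_iUnion.2 ⟨n, hx, hn⟩
      _ ≤ ∑' n, μ (B ∩ f ⁻¹' (t n)) := measure_iUnion_le _
      _ ≤ ∑' n, (⨆ _ : (t n).Nonempty, Metric.ediam (t n) ^ (s : ℝ)) * c := by
          refine ENNReal.tsum_le_tsum fun n => ?_
          rcases (t n).eq_empty_or_nonempty with he | hne
          · simp [he]
          · rw [iSup_pos hne, mul_comm]
            exact hset (t n) (hd n)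
      _ = _ := ENNReal.tsum_mul_right
  have hne0 : μH[s] (f '' B) ≠ 0 := by
    have hc : c ≠ ⊤ := ENNReal.mul_ne_top (ENNReal.natCast_ne_top M) ENNReal.ofReal_ne_top
    exact (lt_of_lt_of_le (ENNReal.div_pos hM hc) hH).ne'
  exact (le_dimH_of_hausdorffMeasure_ne_zero hne0).trans
    (dimH_mono (Set.image_mono fun x hx => hx.1))

/-- Lower bounds for the dimension of the image of a set under a random function, from small ball
estimates for the increments. -/
theorem ae_le_dimH_image {Ω : Type*} [MeasurableSpace Ω] {P : Measure Ω} [IsProbabilityMeasure P]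
    {X : Type*} [MetricSpace X] {G : Ω → ℝ → X}
    (hG : Measurable fun p : Ω × (ℝ × ℝ) => dist (G p.1 p.2.1) (G p.1 p.2.2))
    {K : Set ℝ} {μ : Measure ℝ} [IsFiniteMeasure μ] (hμ0 : μ ≠ 0) (hμK : μ Kᶜ = 0)
    {p q C : ℝ} {s : ℝ≥0} (hs : 0 < s) (hsq : s < q)
    (hball : ∀ x ∈ K, ∀ y ∈ K, ∀ r : ℝ, 0 < r → r ≤ 1 →
      P {ω | dist (G ω x) (G ω y) ≤ r} ≤ ENNReal.ofReal (C * r ^ q) * edist x y ^ (-p))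
    (henergy : ∫⁻ x, ∫⁻ y, edist x y ^ (-p) ∂μ ∂μ < ⊤) :
    ∀ᵐ ω ∂P, (s : ℝ≥0∞) ≤ dimH (G ω '' K) := by
  wlog hC : 0 ≤ C generalizing C
  · refine this (C := 0) (fun x hx y hy r hr hr1 => (hball x hx y hy r hr hr1).trans ?_) le_rfl
    gcongr
    exact (not_le.1 hC).le
  have hae : ∀ᵐ x ∂μ, x ∈ K := by rwa [ae_iff]
  set S : ℕ → Set (Ω × (ℝ × ℝ)) := fun n =>
    {p | dist (G p.1 p.2.1) (G p.1 p.2.2) ≤ (2 : ℝ) ^ (-(n : ℝ))}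
  have hS : ∀ n, MeasurableSet (S n) := fun n => hG measurableSet_Iic
  set E := ∫⁻ x, ∫⁻ y, edist x y ^ (-p) ∂μ ∂μ
  -- Tonelli turns the expected mass of close pairs into the small-ball probability integrated over
  -- `μ × μ`, that is, into the energy. Since s < q, the series weighted by 2^(sn) is then
  -- geometric.
  have hsec : ∀ n, ∫⁻ ω, (μ.prod μ) (Prod.mk ω ⁻¹' S n) ∂P ≤
      ENNReal.ofReal (C * ((2 : ℝ) ^ (-(n : ℝ))) ^ q) * E := by
    intro n
    rw [← Measure.prod_apply (hS n), Measure.prod_apply_symm (hS n)]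
    have hpm : Measurable fun z : ℝ × ℝ => edist z.1 z.2 ^ (-p) :=
      (measurable_fst.edist measurable_snd).pow_const _
    simp only [E]
    rw [← lintegral_prod (fun z : ℝ × ℝ => edist z.1 z.2 ^ (-p)) hpm.aemeasurable,
      ← lintegral_const_mul _ hpm]
    refine lintegral_mono_ae ?_
    have h1 : ∀ᵐ z ∂(μ.prod μ), z.1 ∈ K := Measure.quasiMeasurePreserving_fst.ae hae
    have h2 : ∀ᵐ z ∂(μ.prod μ), z.2 ∈ K := Measure.quasiMeasurePreserving_snd.ae hae
    filter_upwards [h1, h2] with z hz1 hz2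
    exact hball z.1 hz1 z.2 hz2 _ (by positivity)
      (Real.rpow_le_one_of_one_le_of_nonpos one_le_two (by simp))
  have hSm : ∀ n, Measurable fun ω => (μ.prod μ) (Prod.mk ω ⁻¹' S n) := fun n =>
    measurable_measure_prodMk_left (hS n)
  have hfin : ∫⁻ ω, ∑' n : ℕ, ENNReal.ofReal ((2 : ℝ) ^ (s * n : ℝ)) *
      (μ.prod μ) (Prod.mk ω ⁻¹' S n) ∂P < ⊤ := by
    rw [lintegral_tsum fun n => ((hSm n).const_mul _).aemeasurable]
    calc ∑' n : ℕ, ∫⁻ ω, ENNReal.ofReal ((2 : ℝ) ^ (s * n : ℝ)) *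
          (μ.prod μ) (Prod.mk ω ⁻¹' S n) ∂P
        ≤ ∑' n : ℕ, ENNReal.ofReal (C * (2 ^ (s - q)) ^ n) * E := by
          refine ENNReal.tsum_le_tsum fun n => ?_
          rw [lintegral_const_mul _ (hSm n)]
          refine (mul_le_mul_right (hsec n) _).trans (le_of_eq ?_)
          rw [← mul_assoc, ← ENNReal.ofReal_mul (by positivity)]
          congr 2
          rw [← Real.rpow_natCast, ← Real.rpow_mul zero_le_two, ← Real.rpow_mul zero_le_two,
            sub_mul, sub_eq_add_neg, Real.rpow_add zero_lt_two]
          ring_nf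
      _ < ⊤ := by
          rw [ENNReal.tsum_mul_right]
          refine ENNReal.mul_lt_top (Summable.tsum_ofReal_lt_top ?_) henergy
          refine (summable_geometric_of_lt_one (by positivity) ?_).mul_left _
          exact Real.rpow_lt_one_of_one_lt_of_neg one_lt_two (by linarith)
  filter_upwards [ae_lt_top (Measurable.tsum fun n => (hSm n).const_mul _) hfin.ne] with ω hω
  have hsub : ∀ n, MeasurableSet (Prod.mk ω ⁻¹' S n) := fun n => measurable_prodMk_left (hS n)
  refine le_dimH_image_of_lintegral_lt_top hμ0 hμK hs (fun n => ?_) (lt_of_eq_of_lt ?_ hω)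
  · exact measurable_measure_prodMk_left (hsub n)
  · refine tsum_congr fun n => ?_
    rw [Measure.prod_apply (hsub n)]
    rfl

/-! ### Positive area -/

/-- A Cauchy–Schwarz lower bound for the area of a neighbourhood of a set carrying a measure. -/
theorem measure_sq_mul_le_area {ν : Measure ℂ} [IsFiniteMeasure ν] {L : Set ℂ} (hL : ν Lᶜ = 0)
    {r : ℝ} (hr : 0 < r) :
    ν Set.univ ^ 2 * volume (Metric.closedBall (0 : ℂ) r) ≤
      volume (Metric.cthickening r L) * (ν.prod ν) {p | dist p.1 p.2 ≤ 2 * r} := by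
  set V := volume (Metric.closedBall (0 : ℂ) r)
  have hV : ∀ w : ℂ, volume (Metric.closedBall w r) = V := fun w =>
    Measure.addHaar_closedBall_center volume w r
  have hV0 : V ≠ 0 := (Metric.measure_closedBall_pos volume _ hr).ne'
  have hVt : V ≠ ⊤ := measure_closedBall_lt_top.ne
  set u : ℂ → ℝ≥0∞ := fun z => ν (Metric.closedBall z r)
  have hS : MeasurableSet {p : ℂ × ℂ | dist p.2 p.1 ≤ r} :=
    (measurable_snd.dist measurable_fst) measurableSet_Iic
  have hum : Measurable u := measurable_measure_prodMk_left hS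
  have hu1 : ∫⁻ z, u z = ν Set.univ * V := by
    have h1 : ∫⁻ z, u z = (volume.prod ν) {p : ℂ × ℂ | dist p.2 p.1 ≤ r} :=
      (Measure.prod_apply hS).symm
    rw [h1, Measure.prod_apply_symm hS, mul_comm, ← lintegral_const]
    refine lintegral_congr fun w => ?_
    rw [← hV w]
    congr 1
    ext z
    simp [dist_comm]
  have hsupp : ∀ z, z ∉ Metric.cthickening r L → u z = 0 := by
    intro z hz
    refine measure_mono_null (fun w hw => ?_) hL
    intro hwL
    refine hz ?_
    exact Metric.mem_cthickening_of_dist_le z w r L hwL (by rwa [dist_comm])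
  -- The square of `u` counts pairs both within r of z. Such pairs are within 2r of each other, and
  -- for a given pair the admissible z lie in one ball of area `V`.
  have hu2 : ∫⁻ z, u z ^ (2 : ℝ) ≤ V * (ν.prod ν) {p | dist p.1 p.2 ≤ 2 * r} := by
    have hT : MeasurableSet {q : ℂ × (ℂ × ℂ) | dist q.2.1 q.1 ≤ r ∧ dist q.2.2 q.1 ≤ r} :=
      ((measurable_snd.fst.dist measurable_fst) measurableSet_Iic).inter
        ((measurable_snd.snd.dist measurable_fst) measurableSet_Iic)
    have hD : MeasurableSet {p : ℂ × ℂ | dist p.1 p.2 ≤ 2 * r} :=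
      (measurable_fst.dist measurable_snd) measurableSet_Iic
    have h1 : ∫⁻ z, u z ^ (2 : ℝ) = (volume.prod (ν.prod ν))
        {q : ℂ × (ℂ × ℂ) | dist q.2.1 q.1 ≤ r ∧ dist q.2.2 q.1 ≤ r} := by
      rw [Measure.prod_apply hT]
      refine lintegral_congr fun z => ?_
      rw [ENNReal.rpow_two, sq, ← Measure.prod_prod]
      rfl
    rw [h1, Measure.prod_apply_symm hT, ← lintegral_indicator_one hD,
      ← lintegral_const_mul _ (measurable_one.indicator hD)]
    refine lintegral_mono fun p => ?_
    by_cases hp : p ∈ {p : ℂ × ℂ | dist p.1 p.2 ≤ 2 * r}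
    · rw [Set.indicator_of_mem hp, Pi.one_apply, mul_one, ← hV p.1]
      exact measure_mono fun z hz => by simpa [dist_comm] using hz.1
    · rw [Set.indicator_of_notMem hp, mul_zero, nonpos_iff_eq_zero]
      convert measure_empty (μ := (volume : Measure ℂ))
      ext z
      simp only [Set.mem_preimage, Set.mem_ofPred_eq, Set.mem_empty_iff_false, iff_false]
      rintro ⟨h1, h2⟩
      refine hp ?_
      have := dist_triangle_right p.1 p.2 z
      simp only [Set.mem_ofPred_eq]
      linarith
  have hE : MeasurableSet (Metric.cthickening r L) := Metric.isClosed_cthickening.measurableSet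
  have hCS := ENNReal.lintegral_mul_le_Lp_mul_Lq (volume : Measure ℂ) Real.HolderConjugate.two_two
    hum.aemeasurable
    (measurable_one.indicator hE : Measurable ((Metric.cthickening r L).indicator 1)).aemeasurable
  have e1 : ∫⁻ z, (u * (Metric.cthickening r L).indicator (1 : ℂ → ℝ≥0∞)) z = ν Set.univ * V := by
    rw [← hu1]
    refine lintegral_congr fun z => ?_
    by_cases hz : z ∈ Metric.cthickening r L
    · simp [hz]
    · simp [hz, hsupp z hz]
  have e2 : ∫⁻ z, ((Metric.cthickening r L).indicator (1 : ℂ → ℝ≥0∞) z) ^ (2 : ℝ) =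
      volume (Metric.cthickening r L) := by
    rw [← lintegral_indicator_one hE]
    refine lintegral_congr fun z => ?_
    by_cases hz : z ∈ Metric.cthickening r L
    · simp [hz]
    · simp [hz]
  rw [e1, e2] at hCS
  have h3 : (ν Set.univ * V) ^ 2 ≤
      (V * (ν.prod ν) {p | dist p.1 p.2 ≤ 2 * r}) * volume (Metric.cthickening r L) := by
    calc (ν Set.univ * V) ^ 2 ≤ ((∫⁻ z, u z ^ (2 : ℝ)) ^ (1 / 2 : ℝ) *
          volume (Metric.cthickening r L) ^ (1 / 2 : ℝ)) ^ 2 := by gcongr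
      _ = (∫⁻ z, u z ^ (2 : ℝ)) * volume (Metric.cthickening r L) := by
          rw [mul_pow, ← ENNReal.rpow_two, ← ENNReal.rpow_two, ← ENNReal.rpow_mul,
            ← ENNReal.rpow_mul]
          norm_num
      _ ≤ _ := by gcongr
  refine (ENNReal.mul_le_mul_iff_right hV0 hVt).1 ?_
  calc V * (ν Set.univ ^ 2 * V) = (ν Set.univ * V) ^ 2 := by ring
    _ ≤ _ := h3
    _ = _ := by ring

/-- The areas of the closed neighbourhoods of the compact image tend to that of the image, so the
Cauchy–Schwarz bound passes to the limit. Infinitely many good scales are enough, which is what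
Fatou's lemma supplies. -/
theorem volume_image_pos_of_frequently {f : ℝ → ℂ} (hf : Continuous f) {K : Set ℝ}
    (hK : IsCompact K) {μ : Measure ℝ} [IsFiniteMeasure μ] (hμ0 : μ ≠ 0) (hμK : μ Kᶜ = 0)
    {r : ℕ → ℝ} (hr : ∀ n, 0 < r n) (hr0 : Tendsto r atTop (𝓝 0)) {B : ℝ≥0∞} (hB : B ≠ ⊤)
    (h : ∃ᶠ n in atTop, (μ.prod μ) {p | dist (f p.1) (f p.2) ≤ 2 * r n} ≤
      B * volume (Metric.closedBall (0 : ℂ) (r n))) : 0 < volume (f '' K) := by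
  have hfm := hf.measurable
  set ν := μ.map f
  have hνL : ν (f '' K)ᶜ = 0 := by
    rw [Measure.map_apply hfm (hK.image hf).isClosed.measurableSet.compl]
    exact measure_mono_null (fun x hx hxK => hx (Set.mem_image_of_mem f hxK)) hμK
  have hνu : ν Set.univ = μ Set.univ := by rw [Measure.map_apply hfm .univ, Set.preimage_univ]
  have hprod : ∀ n, (ν.prod ν) {p | dist p.1 p.2 ≤ 2 * r n} =
      (μ.prod μ) {p | dist (f p.1) (f p.2) ≤ 2 * r n} := by
    intro n
    have hm : MeasurableSet {p : ℂ × ℂ | dist p.1 p.2 ≤ 2 * r n} :=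
      (measurable_fst.dist measurable_snd) measurableSet_Iic
    rw [Measure.map_prod_map _ _ hfm hfm, Measure.map_apply (hfm.prodMap hfm) hm]
    rfl
  have hlim : Tendsto (fun n => volume (Metric.cthickening (r n) (f '' K)) * B) atTop
      (𝓝 (volume (f '' K) * B)) :=
    ENNReal.Tendsto.mul_const
      ((tendsto_measure_cthickening_of_isCompact (hK.image hf)).comp hr0) (Or.inr hB)
  have hge : μ Set.univ ^ 2 ≤ volume (f '' K) * B := by
    by_contra! hcon
    obtain ⟨n, hn1, hn2⟩ := ((h.and_eventually (hlim.eventually_lt_const hcon))).exists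
    have h1 := measure_sq_mul_le_area hνL (hr n)
    rw [hprod, hνu] at h1
    set V := volume (Metric.closedBall (0 : ℂ) (r n))
    have hV0 : V ≠ 0 := (Metric.measure_closedBall_pos volume _ (hr n)).ne'
    have hVt : V ≠ ⊤ := measure_closedBall_lt_top.ne
    refine hn2.not_ge ((ENNReal.mul_le_mul_iff_left hV0 hVt).1 ?_)
    calc μ Set.univ ^ 2 * V ≤ _ := h1
      _ ≤ volume (Metric.cthickening (r n) (f '' K)) * (B * V) := by gcongr
      _ = _ := by ring
  refine pos_iff_ne_zero.2 fun h0 => ?_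
  rw [h0, zero_mul, nonpos_iff_eq_zero] at hge
  exact hμ0 (Measure.measure_univ_eq_zero.1 (pow_eq_zero_iff two_ne_zero |>.1 hge))

/-- The expected mass of pairs within 2r, divided by the area of a ball of radius r, is bounded by a
multiple of the energy uniformly in r. By Fatou its lower limit along r = 1/(n + 1) is almost surely
finite. -/
theorem ae_volume_image_pos {Ω : Type*} [MeasurableSpace Ω] {P : Measure Ω}
    [IsProbabilityMeasure P] {G : Ω → ℝ → ℂ}
    (hG : Measurable fun p : Ω × (ℝ × ℝ) => dist (G p.1 p.2.1) (G p.1 p.2.2))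
    (hGc : ∀ ω, Continuous (G ω)) {K : Set ℝ} (hK : IsCompact K)
    {μ : Measure ℝ} [IsFiniteMeasure μ] (hμ0 : μ ≠ 0) (hμK : μ Kᶜ = 0)
    {p C : ℝ} (hC : 0 ≤ C)
    (hball : ∀ x ∈ K, ∀ y ∈ K, ∀ r : ℝ, 0 < r →
      P {ω | dist (G ω x) (G ω y) ≤ r} ≤ ENNReal.ofReal (C * r ^ 2) * edist x y ^ (-p))
    (henergy : ∫⁻ x, ∫⁻ y, edist x y ^ (-p) ∂μ ∂μ < ⊤) :
    ∀ᵐ ω ∂P, 0 < volume (G ω '' K) := by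
  have hae : ∀ᵐ x ∂μ, x ∈ K := by rwa [ae_iff]
  set r : ℕ → ℝ := fun n => 1 / ((n : ℝ) + 1)
  have hr : ∀ n, 0 < r n := fun n => by positivity
  set S : ℕ → Set (Ω × (ℝ × ℝ)) := fun n =>
    {p | dist (G p.1 p.2.1) (G p.1 p.2.2) ≤ 2 * r n}
  have hS : ∀ n, MeasurableSet (S n) := fun n => hG measurableSet_Iic
  have hSm : ∀ n, Measurable fun ω => (μ.prod μ) (Prod.mk ω ⁻¹' S n) := fun n =>
    measurable_measure_prodMk_left (hS n)
  set E := ∫⁻ x, ∫⁻ y, edist x y ^ (-p) ∂μ ∂μ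
  have hsec : ∀ n, ∫⁻ ω, (μ.prod μ) (Prod.mk ω ⁻¹' S n) ∂P ≤
      ENNReal.ofReal (C * (2 * r n) ^ 2) * E := by
    intro n
    rw [← Measure.prod_apply (hS n), Measure.prod_apply_symm (hS n)]
    have hpm : Measurable fun z : ℝ × ℝ => edist z.1 z.2 ^ (-p) :=
      (measurable_fst.edist measurable_snd).pow_const _
    simp only [E]
    rw [← lintegral_prod (fun z : ℝ × ℝ => edist z.1 z.2 ^ (-p)) hpm.aemeasurable,
      ← lintegral_const_mul _ hpm]
    refine lintegral_mono_ae ?_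
    have h1 : ∀ᵐ z ∂(μ.prod μ), z.1 ∈ K := Measure.quasiMeasurePreserving_fst.ae hae
    have h2 : ∀ᵐ z ∂(μ.prod μ), z.2 ∈ K := Measure.quasiMeasurePreserving_snd.ae hae
    filter_upwards [h1, h2] with z hz1 hz2
    exact hball z.1 hz1 z.2 hz2 _ (by have := hr n; positivity)
  set V : ℕ → ℝ≥0∞ := fun n => volume (Metric.closedBall (0 : ℂ) (r n))
  have hV : ∀ n, V n = ENNReal.ofReal (Real.pi * r n ^ 2) := by
    intro n
    simp only [V, Complex.volume_closedBall]
    rw [mul_comm Real.pi, ENNReal.ofReal_mul (by positivity), ENNReal.ofReal_pow (hr n).le]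
    congr 1
    rw [ENNReal.ofReal, Real.toNNReal_of_nonneg Real.pi_pos.le]
    rfl
  have hV0 : ∀ n, V n ≠ 0 := fun n => (Metric.measure_closedBall_pos volume _ (hr n)).ne'
  have hVt : ∀ n, V n ≠ ⊤ := fun n => measure_closedBall_lt_top.ne
  have hexp : ∀ n, ∫⁻ ω, (μ.prod μ) (Prod.mk ω ⁻¹' S n) / V n ∂P ≤
      ENNReal.ofReal (C * 4 / Real.pi) * E := by
    intro n
    simp only [div_eq_mul_inv]
    rw [lintegral_mul_const _ (hSm n), ← div_eq_mul_inv]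
    refine ENNReal.div_le_of_le_mul ((hsec n).trans (le_of_eq ?_))
    rw [hV, mul_right_comm, ← ENNReal.ofReal_mul (by positivity)]
    congr 2
    have := Real.pi_pos
    field_simp
    ring
  have hlim : ∫⁻ ω, liminf (fun n => (μ.prod μ) (Prod.mk ω ⁻¹' S n) / V n) atTop ∂P < ⊤ := by
    refine (lintegral_liminf_le fun n => (hSm n).div_const _).trans_lt ?_
    refine lt_of_le_of_lt (liminf_le_of_frequently_le' (Frequently.of_forall hexp)) ?_
    exact ENNReal.mul_lt_top ENNReal.ofReal_lt_top henergy
  filter_upwards [ae_lt_top (Measurable.liminf fun n => (hSm n).div_const _) hlim.ne] with ω hω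
  obtain ⟨B, hB1, hB2⟩ := exists_between hω
  refine volume_image_pos_of_frequently (hGc ω) hK hμ0 hμK hr
    tendsto_one_div_add_atTop_nhds_zero_nat hB2.ne ?_
  refine (frequently_lt_of_liminf_lt (by isBoundedDefault) hB1).mono fun n hn => ?_
  exact (ENNReal.div_le_iff (hV0 n) (hVt n)).1 hn.le

/-! ### Interior points -/

/-- Fourier inversion gives a continuous function `H`, up to a constant the density of the image
measure, vanishing off the closed image. If the image had empty interior, `H` would vanish on a
dense set, hence everywhere. Then `F = 0`, although `F 0` is the total mass of `μ`. -/
theorem interior_image_nonempty_of_integrable {f : ℝ → ℂ} (hf : Continuous f) {K : Set ℝ}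
    (hK : IsCompact K) {μ : Measure ℝ} [IsFiniteMeasure μ] (hμ0 : μ ≠ 0) (hμK : μ Kᶜ = 0)
    (hF : Integrable fun ξ : ℂ => ∫ x, Complex.exp (Complex.I * ((inner ℝ (f x) ξ : ℝ) : ℂ)) ∂μ) :
    (interior (f '' K)).Nonempty := by
  set F : ℂ → ℂ := fun ξ => ∫ x, Complex.exp (Complex.I * ((inner ℝ (f x) ξ : ℝ) : ℂ)) ∂μ
  have hae : ∀ᵐ x ∂μ, x ∈ K := by rwa [ae_iff]
  have hFc : Continuous F := by
    refine continuous_of_dominated (bound := fun _ => 1) (fun ξ => ?_)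
      (fun ξ => Eventually.of_forall fun x => (norm_cexp_I_mul_ofReal _).le)
      (integrable_const _) (Eventually.of_forall fun x => by fun_prop)
    exact (by fun_prop : Continuous fun x =>
      Complex.exp (Complex.I * ((inner ℝ (f x) ξ : ℝ) : ℂ))).aestronglyMeasurable
  set H : ℂ → ℂ := fun z => ∫ ξ, Complex.exp (Complex.I * ((-inner ℝ z ξ : ℝ) : ℂ)) * F ξ
  have hHc : Continuous H := by
    refine continuous_of_dominated (bound := fun ξ => ‖F ξ‖) (fun z => ?_)
      (fun z => Eventually.of_forall fun ξ => ?_) hF.norm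
      (Eventually.of_forall fun ξ => by fun_prop)
    · exact (by fun_prop : Continuous fun ξ =>
        Complex.exp (Complex.I * ((-inner ℝ z ξ : ℝ) : ℂ)) * F ξ).aestronglyMeasurable
    · rw [norm_mul, norm_cexp_I_mul_ofReal, one_mul]
  -- Gaussian regularisation replaces the density by averages that make sense for any measure; `H`
  -- is recovered as b → 0.
  have hinv : ∀ (z : ℂ) (b : ℝ), 0 < b →
      ((Real.pi / b * ∫ x, Real.exp (-(‖f x - z‖ ^ 2 / (4 * b))) ∂μ : ℝ) : ℂ) =
      ∫ ξ : ℂ, Complex.exp (-(b : ℂ) * ‖ξ‖ ^ 2) *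
        (Complex.exp (Complex.I * ((-inner ℝ z ξ : ℝ) : ℂ)) * F ξ) := by
    intro z b hb
    rw [integral_gaussian_eq (hf.measurable.sub_const z) hb]
    refine integral_congr_ae (Eventually.of_forall fun ξ => ?_)
    simp only [F]
    rw [← integral_const_mul, ← integral_const_mul]
    refine integral_congr_ae (Eventually.of_forall fun x => ?_)
    simp only
    rw [← Complex.exp_add, ← Complex.exp_add, inner_sub_left]
    congr 1
    push_cast
    ring
  have hlim1 : ∀ z, Tendsto (fun b : ℝ => ∫ ξ : ℂ, Complex.exp (-(b : ℂ) * ‖ξ‖ ^ 2) *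
        (Complex.exp (Complex.I * ((-inner ℝ z ξ : ℝ) : ℂ)) * F ξ)) (𝓝[>] 0) (𝓝 (H z)) := by
    intro z
    refine tendsto_integral_filter_of_dominated_convergence (fun ξ => ‖F ξ‖)
      (Eventually.of_forall fun b => ?_) ?_ hF.norm (Eventually.of_forall fun ξ => ?_)
    · exact (by fun_prop : Continuous fun ξ : ℂ => Complex.exp (-(b : ℂ) * ‖ξ‖ ^ 2) *
        (Complex.exp (Complex.I * ((-inner ℝ z ξ : ℝ) : ℂ)) * F ξ)).aestronglyMeasurable
    · filter_upwards [self_mem_nhdsWithin] with b hb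
      refine Eventually.of_forall fun ξ => ?_
      rw [norm_mul, norm_mul, norm_cexp_I_mul_ofReal, one_mul]
      refine mul_le_of_le_one_left (norm_nonneg _) ?_
      rw [Complex.norm_exp, Real.exp_le_one_iff]
      norm_cast
      rw [neg_mul]
      exact neg_nonpos.2 (mul_nonneg (le_of_lt hb) (by positivity))
    · have hc : Continuous fun b : ℝ => Complex.exp (-(b : ℂ) * ‖ξ‖ ^ 2) *
        (Complex.exp (Complex.I * ((-inner ℝ z ξ : ℝ) : ℂ)) * F ξ) := by fun_prop
      have := hc.tendsto 0
      simp only [Complex.ofReal_zero, neg_zero, zero_mul, Complex.exp_zero, one_mul] at this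
      exact this.mono_left nhdsWithin_le_nhds
  have hoff : ∀ z ∉ f '' K, H z = 0 := by
    intro z hz
    obtain ⟨δ, hδ, hball⟩ := Metric.isOpen_iff.1 (hK.image hf).isClosed.isOpen_compl z hz
    have hdist : ∀ x ∈ K, δ ≤ ‖f x - z‖ := by
      intro x hx
      by_contra! hcon
      exact hball (a := f x) (by rwa [Metric.mem_ball, dist_eq_norm]) (Set.mem_image_of_mem f hx)
    -- At distance at least δ from the image, the factor 1/b is beaten by exp(-δ² / (4b)).
    have hlim2 : Tendsto (fun b : ℝ => ((Real.pi / b *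
        ∫ x, Real.exp (-(‖f x - z‖ ^ 2 / (4 * b))) ∂μ : ℝ) : ℂ)) (𝓝[>] 0) (𝓝 0) := by
      rw [← Complex.ofReal_zero]
      refine (Complex.continuous_ofReal.tendsto 0).comp ?_
      have hup : Tendsto (fun b : ℝ => Real.pi * (4 / δ ^ 2) * μ.real Set.univ *
          ((δ ^ 2 / 4 * b⁻¹) ^ 1 * Real.exp (-(δ ^ 2 / 4 * b⁻¹)))) (𝓝[>] 0) (𝓝 0) := by
        have h1 := (Real.tendsto_pow_mul_exp_neg_atTop_nhds_zero 1).comp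
          (tendsto_inv_nhdsGT_zero.const_mul_atTop (show (0 : ℝ) < δ ^ 2 / 4 by positivity))
        have h2 := h1.const_mul (Real.pi * (4 / δ ^ 2) * μ.real Set.univ)
        rw [mul_zero] at h2
        exact h2
      refine squeeze_zero' ?_ ?_ hup
      · filter_upwards [self_mem_nhdsWithin] with b hb
        have : 0 < b := hb
        exact mul_nonneg (div_nonneg Real.pi_pos.le this.le)
          (integral_nonneg fun _ => (Real.exp_pos _).le)
      · filter_upwards [self_mem_nhdsWithin] with b hb
        have hb' : 0 < b := hb
        have hI : ∫ x, Real.exp (-(‖f x - z‖ ^ 2 / (4 * b))) ∂μ ≤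
            Real.exp (-(δ ^ 2 / 4 * b⁻¹)) * μ.real Set.univ := by
          refine (le_abs_self _).trans ?_
          rw [← Real.norm_eq_abs]
          refine norm_integral_le_of_norm_le_const ?_
          filter_upwards [hae] with x hx
          rw [Real.norm_of_nonneg (Real.exp_pos _).le, Real.exp_le_exp, neg_le_neg_iff]
          calc δ ^ 2 / 4 * b⁻¹ = δ ^ 2 / (4 * b) := by field_simp
            _ ≤ _ := by gcongr; exact hdist x hx
        calc Real.pi / b * ∫ x, Real.exp (-(‖f x - z‖ ^ 2 / (4 * b))) ∂μ
            ≤ Real.pi / b * (Real.exp (-(δ ^ 2 / 4 * b⁻¹)) * μ.real Set.univ) := by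
              gcongr
          _ = _ := by field_simp
    refine tendsto_nhds_unique (hlim1 z) (hlim2.congr' ?_)
    filter_upwards [self_mem_nhdsWithin] with b hb
    exact hinv z b hb
  by_contra hempty
  rw [Set.not_nonempty_iff_eq_empty, interior_eq_empty_iff_dense_compl] at hempty
  have hH0 : H = 0 := hHc.ext_on hempty continuous_const fun z hz => hoff z hz
  -- The library transform carries a 2π in the exponent, so its value at w is `H` at 2πw.
  have hFou : FourierTransform.fourier F = (0 : ℂ → ℂ) := by
    ext w
    rw [Real.fourier_eq']
    have := congrFun hH0 ((2 * Real.pi : ℝ) • w)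
    simp only [H, Pi.zero_apply] at this
    rw [Pi.zero_apply, ← this]
    refine integral_congr_ae (Eventually.of_forall fun ξ => ?_)
    simp only [smul_eq_mul]
    rw [real_inner_smul_left, real_inner_comm, mul_comm Complex.I, ← neg_mul, ← neg_mul]
  have hF0 := hFc.fourierInv_fourier_eq hF (by rw [hFou]; exact integrable_zero _ _ _)
  have h0 := congrFun hF0 0
  rw [hFou] at h0
  have h1 : F 0 = μ.real Set.univ := by simp [F]
  rw [h1] at h0
  have h2 : FourierTransformInv.fourierInv (0 : ℂ → ℂ) (0 : ℂ) = 0 := by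
    rw [Real.fourierInv_eq']
    simp
  rw [h2] at h0
  have h3 : μ.real Set.univ = 0 := by exact_mod_cast h0.symm
  rw [measureReal_eq_zero_iff, Measure.measure_univ_eq_zero] at h3
  exact hμ0 h3

/-- The mean square of the Fourier transform of a random image measure. -/
theorem lintegral_enorm_charFun_sq_le {Ω : Type*} [MeasurableSpace Ω] {P : Measure Ω}
    [IsProbabilityMeasure P] {G : Ω → ℝ → ℂ} (hG : Measurable fun p : Ω × ℝ => G p.1 p.2)
    {μ : Measure ℝ} [IsFiniteMeasure μ] (ξ : ℂ) :
    ∫⁻ ω, ‖∫ x, Complex.exp (Complex.I * ((inner ℝ (G ω x) ξ : ℝ) : ℂ)) ∂μ‖ₑ ^ (2 : ℝ) ∂P ≤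
      ∫⁻ z, ‖∫ ω, Complex.exp (Complex.I *
        ((inner ℝ (G ω z.1 - G ω z.2) ξ : ℝ) : ℂ)) ∂P‖ₑ ∂(μ.prod μ) := by
  set F : Ω → ℂ := fun ω => ∫ x, Complex.exp (Complex.I * ((inner ℝ (G ω x) ξ : ℝ) : ℂ)) ∂μ
  have hsq : ∀ ω, ((‖F ω‖ ^ 2 : ℝ) : ℂ) = ∫ z, Complex.exp (Complex.I *
      ((inner ℝ (G ω z.1 - G ω z.2) ξ : ℝ) : ℂ)) ∂(μ.prod μ) := by
    intro ω
    have h1 : ∀ z : ℝ × ℝ, Complex.exp (Complex.I * ((inner ℝ (G ω z.1 - G ω z.2) ξ : ℝ) : ℂ)) =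
        Complex.exp (Complex.I * ((inner ℝ (G ω z.1) ξ : ℝ) : ℂ)) *
        starRingEnd ℂ (Complex.exp (Complex.I * ((inner ℝ (G ω z.2) ξ : ℝ) : ℂ))) := by
      intro z
      rw [← Complex.exp_conj, ← Complex.exp_add, map_mul, Complex.conj_I, Complex.conj_ofReal,
        inner_sub_left]
      congr 1
      push_cast
      ring
    simp only [h1]
    rw [integral_prod_mul (fun x => Complex.exp (Complex.I * ((inner ℝ (G ω x) ξ : ℝ) : ℂ)))
      (fun x => starRingEnd ℂ (Complex.exp (Complex.I * ((inner ℝ (G ω x) ξ : ℝ) : ℂ)))),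
      integral_conj, Complex.mul_conj, Complex.normSq_eq_norm_sq]
  have hm : Measurable fun q : Ω × (ℝ × ℝ) => Complex.exp (Complex.I *
      ((inner ℝ (G q.1 q.2.1 - G q.1 q.2.2) ξ : ℝ) : ℂ)) := by
    have e1 : Measurable fun q : Ω × (ℝ × ℝ) => G q.1 q.2.1 :=
      hG.comp (measurable_fst.prodMk measurable_snd.fst)
    have e2 : Measurable fun q : Ω × (ℝ × ℝ) => G q.1 q.2.2 :=
      hG.comp (measurable_fst.prodMk measurable_snd.snd)
    have e3 : Measurable fun q : Ω × (ℝ × ℝ) => (inner ℝ (G q.1 q.2.1 - G q.1 q.2.2) ξ : ℝ) :=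
      (e1.sub e2).inner measurable_const
    fun_prop
  have hint : Integrable (Function.uncurry fun (ω : Ω) (z : ℝ × ℝ) => Complex.exp (Complex.I *
      ((inner ℝ (G ω z.1 - G ω z.2) ξ : ℝ) : ℂ))) (P.prod (μ.prod μ)) :=
    Integrable.of_bound hm.aestronglyMeasurable 1
      (Eventually.of_forall fun q => (norm_cexp_I_mul_ofReal _).le)
  have hint2 : Integrable (fun ω => ((‖F ω‖ ^ 2 : ℝ) : ℂ)) P := by
    simp only [hsq]
    exact hint.integral_prod_left
  have hint3 : Integrable (fun ω => ‖F ω‖ ^ 2) P := by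
    exact hint2.re
  have h1 : ∫⁻ ω, ‖F ω‖ₑ ^ (2 : ℝ) ∂P = ENNReal.ofReal (∫ ω, ‖F ω‖ ^ 2 ∂P) := by
    rw [ofReal_integral_eq_lintegral_ofReal hint3 (Eventually.of_forall fun _ => by positivity)]
    refine lintegral_congr fun ω => ?_
    rw [ENNReal.rpow_two, ENNReal.ofReal_pow (norm_nonneg _), ofReal_norm]
  have h2 : ENNReal.ofReal (∫ ω, ‖F ω‖ ^ 2 ∂P) = ‖∫ ω, ((‖F ω‖ ^ 2 : ℝ) : ℂ) ∂P‖ₑ := by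
    rw [integral_complex_ofReal, ← ofReal_norm, Complex.norm_real, Real.norm_of_nonneg
      (integral_nonneg fun _ => by positivity)]
  rw [h1, h2]
  simp only [hsq]
  rw [integral_integral_swap hint]
  exact enorm_integral_le_lintegral_enorm _

/-- The mean square of the Fourier transform is at most a multiple of (1 + ‖ξ‖)^(-γ) times the
energy. By Cauchy–Schwarz the mean modulus has order γ/2, which exceeds the dimension 2 of the plane
exactly when γ > 4; so the transform is almost surely integrable. -/
theorem ae_interior_image_nonempty {Ω : Type*} [MeasurableSpace Ω] {P : Measure Ω}
    [IsProbabilityMeasure P] {G : Ω → ℝ → ℂ} (hG : Measurable fun p : Ω × ℝ => G p.1 p.2)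
    (hGc : ∀ ω, Continuous (G ω)) {K : Set ℝ} (hK : IsCompact K)
    {μ : Measure ℝ} [IsFiniteMeasure μ] (hμ0 : μ ≠ 0) (hμK : μ Kᶜ = 0)
    {p γ C : ℝ} (hγ : 4 < γ)
    (hφ : ∀ x ∈ K, ∀ y ∈ K, ∀ ξ : ℂ, ‖∫ ω, Complex.exp (Complex.I *
        ((inner ℝ (G ω x - G ω y) ξ : ℝ) : ℂ)) ∂P‖ₑ ≤
        ENNReal.ofReal (C * (1 + ‖ξ‖) ^ (-γ)) * edist x y ^ (-p))
    (henergy : ∫⁻ x, ∫⁻ y, edist x y ^ (-p) ∂μ ∂μ < ⊤) :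
    ∀ᵐ ω ∂P, (interior (G ω '' K)).Nonempty := by
  have hae : ∀ᵐ x ∂μ, x ∈ K := by rwa [ae_iff]
  set E := ∫⁻ x, ∫⁻ y, edist x y ^ (-p) ∂μ ∂μ
  set F : Ω × ℂ → ℂ := fun q =>
    ∫ x, Complex.exp (Complex.I * ((inner ℝ (G q.1 x) q.2 : ℝ) : ℂ)) ∂μ
  have hFm : StronglyMeasurable F := by
    refine StronglyMeasurable.integral_prod_right (f := fun (q : Ω × ℂ) (x : ℝ) =>
      Complex.exp (Complex.I * ((inner ℝ (G q.1 x) q.2 : ℝ) : ℂ))) ?_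
    have e1 : Measurable fun q : (Ω × ℂ) × ℝ => G q.1.1 q.2 :=
      hG.comp (measurable_fst.fst.prodMk measurable_snd)
    have e3 : Measurable fun q : (Ω × ℂ) × ℝ => (inner ℝ (G q.1.1 q.2) q.1.2 : ℝ) :=
      e1.inner measurable_fst.snd
    refine Measurable.stronglyMeasurable ?_
    unfold Function.uncurry
    fun_prop
  have hsq : ∀ ξ, ∫⁻ ω, ‖F (ω, ξ)‖ₑ ^ (2 : ℝ) ∂P ≤ ENNReal.ofReal (C * (1 + ‖ξ‖) ^ (-γ)) * E := by
    intro ξ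
    refine (lintegral_enorm_charFun_sq_le hG ξ).trans ?_
    have hpm : Measurable fun z : ℝ × ℝ => edist z.1 z.2 ^ (-p) :=
      (measurable_fst.edist measurable_snd).pow_const _
    simp only [E]
    rw [← lintegral_prod (fun z : ℝ × ℝ => edist z.1 z.2 ^ (-p)) hpm.aemeasurable,
      ← lintegral_const_mul _ hpm]
    refine lintegral_mono_ae ?_
    have h1 : ∀ᵐ z ∂(μ.prod μ), z.1 ∈ K := Measure.quasiMeasurePreserving_fst.ae hae
    have h2 : ∀ᵐ z ∂(μ.prod μ), z.2 ∈ K := Measure.quasiMeasurePreserving_snd.ae hae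
    filter_upwards [h1, h2] with z hz1 hz2
    exact hφ z.1 hz1 z.2 hz2 ξ
  have hsec : ∀ ξ, Measurable fun ω => ‖F (ω, ξ)‖ₑ := fun ξ =>
    (hFm.measurable.comp measurable_prodMk_right).enorm
  have hone : ∀ ξ, ∫⁻ ω, ‖F (ω, ξ)‖ₑ ∂P ≤
      ENNReal.ofReal ((1 + ‖ξ‖) ^ (-(γ / 2))) * (ENNReal.ofReal C * E) ^ (1 / 2 : ℝ) := by
    intro ξ
    have hCS := ENNReal.lintegral_mul_le_Lp_mul_Lq P Real.HolderConjugate.two_two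
      (hsec ξ).aemeasurable (measurable_one : Measurable (1 : Ω → ℝ≥0∞)).aemeasurable
    simp only [mul_one, Pi.one_apply, ENNReal.one_rpow, lintegral_const, measure_univ] at hCS
    refine hCS.trans ((ENNReal.rpow_le_rpow (hsq ξ) (by norm_num)).trans (le_of_eq ?_))
    rw [mul_comm C, ENNReal.ofReal_mul (by positivity), mul_assoc,
      ENNReal.mul_rpow_of_nonneg _ _ (by norm_num),
      ENNReal.ofReal_rpow_of_nonneg (by positivity) (by norm_num),
      ← Real.rpow_mul (by positivity)]
    congr 3
    ring
  have htot : ∫⁻ ω, (∫⁻ ξ : ℂ, ‖F (ω, ξ)‖ₑ) ∂P < ⊤ := by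
    rw [lintegral_lintegral_swap hFm.measurable.enorm.aemeasurable]
    refine (lintegral_mono hone).trans_lt ?_
    rw [lintegral_mul_const _ (by fun_prop)]
    refine ENNReal.mul_lt_top ?_ ?_
    · have : Integrable (fun ξ : ℂ => (1 + ‖ξ‖) ^ (-(γ / 2))) :=
        integrable_one_add_norm (by rw [Complex.finrank_real_complex]; push_cast; linarith)
      exact this.lintegral_lt_top
    · exact ENNReal.rpow_lt_top_of_nonneg (by norm_num)
        (ENNReal.mul_ne_top ENNReal.ofReal_ne_top henergy.ne)
  filter_upwards [ae_lt_top hFm.measurable.enorm.lintegral_prod_right' htot.ne] with ω hω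
  refine interior_image_nonempty_of_integrable (hGc ω) hK hμ0 hμK ⟨?_, hω⟩
  exact (hFm.comp_measurable measurable_prodMk_left).aestronglyMeasurable

/-! ### Upper bounds from coverings -/

/-- A disc of radius `R` is covered by at most `25 (R / δ) ^ 2` discs of radius `δ`. -/
theorem exists_finset_cover_closedBall (z : ℂ) {R δ : ℝ} (hδ : 0 < δ) (hR : δ ≤ R) :
    ∃ F : Finset ℂ, (F.card : ℝ) ≤ 25 * (R / δ) ^ 2 ∧
      Metric.closedBall z R ⊆ ⋃ c ∈ F, Metric.closedBall c δ := by
  classical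
  have h1 : 1 ≤ R / δ := by rwa [le_div_iff₀ hδ, one_mul]
  set N : ℕ := ⌈R / δ⌉₊
  have hN1 : R / δ ≤ N := Nat.le_ceil _
  have hN2 : (N : ℝ) < R / δ + 1 := Nat.ceil_lt_add_one (by positivity)
  set I : Finset ℤ := Finset.Icc (-(N : ℤ)) N
  have hI : (I.card : ℝ) ≤ 5 * (R / δ) := by
    have : I.card = 2 * N + 1 := by
      simp only [I, Int.card_Icc]
      omega
    rw [this]
    push_cast
    linarith
  -- The centres form a square grid of mesh δ: rounding moves each coordinate by at most δ/2, hence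
  -- the point by at most δ.
  refine ⟨(I ×ˢ I).image fun p => z + δ * ((p.1 : ℂ) + (p.2 : ℂ) * Complex.I), ?_, ?_⟩
  · calc (((I ×ˢ I).image fun p : ℤ × ℤ => z + δ * ((p.1 : ℂ) + (p.2 : ℂ) * Complex.I)).card : ℝ)
        ≤ ((I ×ˢ I).card : ℝ) := by exact_mod_cast Finset.card_image_le
      _ = (I.card : ℝ) * I.card := by rw [Finset.card_product]; push_cast; ring
      _ ≤ (5 * (R / δ)) * (5 * (R / δ)) := by gcongr
      _ = _ := by ring
  · intro w hw
    rw [Metric.mem_closedBall, dist_eq_norm] at hw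
    have hmem : ∀ a : ℝ, |a| ≤ R → round (a / δ) ∈ I := by
      intro a ha
      have h2 : |a / δ| ≤ N := by
        rw [abs_div, abs_of_pos hδ]
        exact (by gcongr : |a| / δ ≤ R / δ).trans hN1
      have h3 := abs_sub_round (a / δ)
      rw [abs_le] at h2 h3
      rw [Finset.mem_Icc]
      constructor
      · have : (-(N : ℤ) : ℝ) - 1 < round (a / δ) := by push_cast; linarith
        have : -(N : ℤ) - 1 < round (a / δ) := by exact_mod_cast this
        omega
      · have : (round (a / δ) : ℝ) < N + 1 := by linarith
        have : round (a / δ) < (N : ℤ) + 1 := by exact_mod_cast this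
        omega
    have herr : ∀ a : ℝ, |a - δ * round (a / δ)| ≤ δ / 2 := by
      intro a
      have h3 := abs_sub_round (a / δ)
      have : a - δ * round (a / δ) = δ * (a / δ - round (a / δ)) := by field_simp
      rw [this, abs_mul, abs_of_pos hδ]
      nlinarith
    have hre := hmem (w - z).re ((Complex.abs_re_le_norm _).trans hw)
    have him := hmem (w - z).im ((Complex.abs_im_le_norm _).trans hw)
    refine Set.mem_iUnion₂.2 ⟨_, Finset.mem_image.2 ⟨(round ((w - z).re / δ),
      round ((w - z).im / δ)), Finset.mem_product.2 ⟨hre, him⟩, rfl⟩, ?_⟩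
    rw [Metric.mem_closedBall, dist_eq_norm]
    refine (Complex.norm_le_abs_re_add_abs_im _).trans ?_
    have e1 := herr (w - z).re
    have e2 := herr (w - z).im
    simp only [Complex.sub_re, Complex.sub_im, Complex.add_re, Complex.add_im, Complex.mul_re,
      Complex.mul_im, Complex.ofReal_re, Complex.ofReal_im, Complex.intCast_re, Complex.intCast_im,
      Complex.I_re, Complex.I_im] at e1 e2 ⊢
    ring_nf at e1 e2 ⊢
    linarith

/-- `Φ` maps every set of diameter at most `δ ≤ 1` into at most `C δ ^ (-k)` balls of radius
`C δ ^ m`. -/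
def CoverBound {X : Type*} [MetricSpace X] (Φ : ℝ → X) (C k m : ℝ) : Prop :=
  ∀ (U : Set ℝ) (δ : ℝ), 0 < δ → δ ≤ 1 → (∀ x ∈ U, ∀ y ∈ U, |x - y| ≤ δ) →
    ∃ F : Finset X, (F.card : ℝ) ≤ C * δ ^ (-k) ∧ Φ '' U ⊆ ⋃ c ∈ F, Metric.closedBall c (C * δ ^ m)

theorem coverBound_of_dist_le {X : Type*} [MetricSpace X] {Φ : ℝ → X} {C b : ℝ} (hb : 0 < b)
    (hC : 1 ≤ C) (h : ∀ x y, |x - y| ≤ 1 → dist (Φ x) (Φ y) ≤ C * |x - y| ^ b) :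
    CoverBound Φ C 0 b := by
  intro U δ hδ hδ1 hU
  rcases U.eq_empty_or_nonempty with rfl | ⟨x, hx⟩
  · exact ⟨∅, by simp; linarith, by simp⟩
  · refine ⟨{Φ x}, by simpa using hC, ?_⟩
    rintro _ ⟨y, hy, rfl⟩
    simp only [Finset.mem_singleton, Set.iUnion_iUnion_eq_left, Metric.mem_closedBall]
    have hd := hU y hy x hx
    refine (h y x (hd.trans hδ1)).trans ?_
    gcongr

theorem dist_toLp_le (x y : ℝ) (z w : ℂ) :
    dist (WithLp.toLp 2 (x, z)) (WithLp.toLp 2 (y, w)) ≤ |x - y| + dist z w := by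
  rw [WithLp.prod_dist_eq_of_L2, ← Real.dist_eq]
  refine Real.sqrt_le_iff.2 ⟨by positivity, ?_⟩
  change dist x y ^ 2 + dist z w ^ 2 ≤ (dist x y + dist z w) ^ 2
  nlinarith [dist_nonneg (x := x) (y := y), dist_nonneg (x := z) (y := w)]

/-- Over a set of diameter δ the values stay in a disc of radius Cδ^b. Cutting that disc into discs
of radius δ takes of order δ^(2b - 2) pieces, whence the exponent 2 - 2b. -/
theorem coverBound_graph_of_dist_le {f : ℝ → ℂ} {C b : ℝ} (hb : 0 < b) (hb1 : b ≤ 1)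
    (hC : 1 ≤ C) (h : ∀ x y, dist (f x) (f y) ≤ C * |x - y| ^ b) :
    CoverBound (fun x => WithLp.toLp 2 (x, f x)) (25 * C ^ 2) (2 - 2 * b) 1 := by
  classical
  intro U δ hδ hδ1 hU
  rcases U.eq_empty_or_nonempty with rfl | ⟨x, hx⟩
  · exact ⟨∅, by simp; positivity, by simp⟩
  have hR : δ ≤ C * δ ^ b := by
    calc δ = 1 * δ ^ (1 : ℝ) := by simp
      _ ≤ C * δ ^ b := by
        gcongr ?_ * ?_
        exact Real.rpow_le_rpow_of_exponent_ge hδ hδ1 hb1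
  obtain ⟨F, hF1, hF2⟩ := exists_finset_cover_closedBall (f x) hδ hR
  refine ⟨F.image fun c => WithLp.toLp 2 (x, c), ?_, ?_⟩
  · calc ((F.image fun c => WithLp.toLp 2 (x, c)).card : ℝ) ≤ F.card := by
          exact_mod_cast Finset.card_image_le
      _ ≤ 25 * (C * δ ^ b / δ) ^ 2 := hF1
      _ = 25 * C ^ 2 * δ ^ (-(2 - 2 * b)) := by
        rw [show -(2 - 2 * b) = (b - 1) * (2 : ℕ) by push_cast; ring, Real.rpow_mul hδ.le,
          Real.rpow_natCast, Real.rpow_sub_one hδ.ne']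
        ring
  · rintro _ ⟨y, hy, rfl⟩
    have hd := hU y hy x hx
    have hfy : f y ∈ Metric.closedBall (f x) (C * δ ^ b) := by
      rw [Metric.mem_closedBall]
      exact (h y x).trans (by gcongr)
    obtain ⟨c, hc, hyc⟩ := Set.mem_iUnion₂.1 (hF2 hfy)
    refine Set.mem_iUnion₂.2 ⟨_, Finset.mem_image_of_mem _ hc, ?_⟩
    rw [Metric.mem_closedBall, Real.rpow_one]
    refine (dist_toLp_le _ _ _ _).trans ?_
    rw [Metric.mem_closedBall] at hyc
    nlinarith [one_le_pow₀ hC (n := 2)]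

/-- Null sets of a Hausdorff measure have efficient covers by sets of positive scales. -/
theorem exists_cover_of_hausdorffMeasure_eq_zero {t : ℝ} (ht : 0 < t) {A : Set ℝ}
    (hA : μH[t] A = 0) {ε : ℝ} (hε : 0 < ε) : ∃ (U : ℕ → Set ℝ) (δ : ℕ → ℝ), A ⊆ ⋃ i, U i ∧
      (∀ i, 0 < δ i) ∧ (∀ i, δ i ≤ ε) ∧ (∀ i, ∀ x ∈ U i, ∀ y ∈ U i, |x - y| ≤ δ i) ∧
      ∑' i, ENNReal.ofReal (δ i ^ t) ≤ ENNReal.ofReal ε := by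
  have hε2 : (0 : ℝ≥0∞) < ENNReal.ofReal (ε / 2) := ENNReal.ofReal_pos.2 (by linarith)
  rw [Measure.hausdorffMeasure_apply] at hA
  have hlt := (le_of_eq hA).trans_lt hε2
  have h1 := (le_iSup₂ (f := fun (r : ℝ≥0∞) (_ : 0 < r) =>
      ⨅ (t' : ℕ → Set ℝ) (_ : A ⊆ ⋃ n, t' n) (_ : ∀ n, Metric.ediam (t' n) ≤ r),
        ∑' n, ⨆ _ : (t' n).Nonempty, Metric.ediam (t' n) ^ t) (ENNReal.ofReal ε)
        (ENNReal.ofReal_pos.2 hε)).trans_lt hlt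
  simp only [iInf_lt_iff] at h1
  obtain ⟨U, hAU, hdiam, hsum⟩ := h1
  obtain ⟨e, he, hesum⟩ := ENNReal.exists_pos_sum_of_countable hε2.ne' ℕ
  -- Sets of diameter zero need a positive scale; replacing the diameter by its maximum with `η i`
  -- adds at most `e i` to the sum.
  set η : ℕ → ℝ := fun i => min ε ((e i : ℝ) ^ t⁻¹)
  have hη : ∀ i, 0 < η i := fun i => lt_min hε (Real.rpow_pos_of_pos (he i) _)
  have hηt : ∀ i, ENNReal.ofReal (η i ^ t) ≤ e i := by
    intro i
    rw [← ENNReal.ofReal_coe_nnreal]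
    refine ENNReal.ofReal_le_ofReal ?_
    calc η i ^ t ≤ ((e i : ℝ) ^ t⁻¹) ^ t := by
          have := (hη i).le
          gcongr
          exact min_le_right _ _
      _ = e i := by rw [← Real.rpow_mul (e i).coe_nonneg, inv_mul_cancel₀ ht.ne', Real.rpow_one]
  refine ⟨U, fun i => max (Metric.diam (U i)) (η i), hAU, fun i => lt_max_of_lt_right (hη i),
    fun i => max_le ?_ (min_le_left _ _), fun i x hx y hy => ?_, ?_⟩
  · exact ENNReal.toReal_le_of_le_ofReal hε.le (hdiam i)
  · rw [← Real.dist_eq]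
    refine (Metric.dist_le_diam_of_mem' ?_ hx hy).trans (le_max_left _ _)
    exact ne_top_of_le_ne_top ENNReal.ofReal_ne_top (hdiam i)
  · calc ∑' i, ENNReal.ofReal (max (Metric.diam (U i)) (η i) ^ t)
        ≤ ∑' i, ((⨆ _ : (U i).Nonempty, Metric.ediam (U i) ^ t) + e i) := by
          refine ENNReal.tsum_le_tsum fun i => ?_
          rcases le_total (Metric.diam (U i)) (η i) with h | h
          · rw [max_eq_right h]
            exact (hηt i).trans le_add_self
          · rw [max_eq_left h]
            refine le_add_right ?_
            have hne : (U i).Nonempty := by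
              by_contra hemp
              rw [Set.not_nonempty_iff_eq_empty] at hemp
              rw [hemp, Metric.diam_empty] at h
              exact (hη i).not_ge h
            rw [iSup_pos hne, ← ENNReal.ofReal_rpow_of_nonneg Metric.diam_nonneg ht.le, Metric.diam,
              ENNReal.ofReal_toReal (ne_top_of_le_ne_top ENNReal.ofReal_ne_top (hdiam i))]
      _ ≤ ENNReal.ofReal (ε / 2) + ENNReal.ofReal (ε / 2) := by
          rw [ENNReal.tsum_add]
          exact add_le_add hsum.le hesum.le
      _ = ENNReal.ofReal ε := by
          rw [← ENNReal.ofReal_add (by linarith) (by linarith), add_halves]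

/-- A covering set of scale δ is replaced by Cδ^(-k) balls of radius Cδ^m. Their cost in order D is
a constant times δ^(mD - k), which is δ^t exactly for D = (t + k)/m. -/
theorem CoverBound.dimH_image_le {X : Type*} [MetricSpace X] {Φ : ℝ → X} {C k m : ℝ}
    (h : CoverBound Φ C k m) (hC : 0 < C) (hk : 0 ≤ k) (hm : 0 < m) {A : Set ℝ} {t : ℝ≥0}
    (ht : dimH A < t) : dimH (Φ '' A) ≤ ENNReal.ofReal ((t + k) / m) := by
  borelize X
  have ht0 : 0 < (t : ℝ) := by exact_mod_cast (zero_le.trans_lt ht)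
  have hA := hausdorffMeasure_of_dimH_lt ht
  set D : ℝ := (t + k) / m
  have hD : 0 ≤ D := by positivity
  set ε : ℕ → ℝ := fun n => 1 / ((n : ℝ) + 1)
  have hε : ∀ n, 0 < ε n := fun n => by positivity
  have hε1 : ∀ n, ε n ≤ 1 := fun n => by
    rw [div_le_one (by positivity)]
    linarith [(Nat.cast_nonneg n : (0 : ℝ) ≤ n)]
  have hεlim : Tendsto ε atTop (𝓝 0) := tendsto_one_div_add_atTop_nhds_zero_nat
  choose U δ hAU hδ0 hδε hUδ hsum using fun n =>
    exists_cover_of_hausdorffMeasure_eq_zero ht0 hA (hε n)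
  choose F hF1 hF2 using fun n i =>
    h (U n i) (δ n i) (hδ0 n i) ((hδε n i).trans (hε1 n)) (hUδ n i)
  have hdiam : ∀ (n i : ℕ) (c : X), Metric.ediam (Metric.closedBall c (C * δ n i ^ m)) ≤
      ENNReal.ofReal (2 * C * δ n i ^ m) := by
    intro n i c
    refine Metric.ediam_le fun x hx y hy => ?_
    rw [edist_dist]
    refine ENNReal.ofReal_le_ofReal ((dist_triangle_right x y c).trans ?_)
    rw [Metric.mem_closedBall] at hx hy
    linarith
  have hH := Measure.hausdorffMeasure_le_liminf_tsum (ι := fun n => Σ i : ℕ, F n i) D (Φ '' A)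
    (l := atTop) (fun n => ENNReal.ofReal (2 * C * ε n ^ m)) ?_
    (fun n p => Metric.closedBall (p.2 : X) (C * δ n p.1 ^ m))
    (Eventually.of_forall fun n p => (hdiam n p.1 _).trans (ENNReal.ofReal_le_ofReal ?_))
    (Eventually.of_forall fun n => ?_)
  · have hlim0 : Tendsto (fun n => ENNReal.ofReal (C * (2 * C) ^ D) * ENNReal.ofReal (ε n)) atTop
        (𝓝 (ENNReal.ofReal (C * (2 * C) ^ D) * ENNReal.ofReal 0)) :=
      ENNReal.Tendsto.const_mul (ENNReal.tendsto_ofReal hεlim) (Or.inr ENNReal.ofReal_ne_top)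
    rw [ENNReal.ofReal_zero, mul_zero] at hlim0
    have hz : μH[D] (Φ '' A) = 0 := by
      refine le_antisymm (hH.trans ?_) zero_le
      rw [← hlim0.liminf_eq]
      refine liminf_le_liminf (Eventually.of_forall fun n => ?_)
      rw [ENNReal.tsum_sigma']
      calc ∑' i, ∑' c : F n i, Metric.ediam (Metric.closedBall (c : X) (C * δ n i ^ m)) ^ D
          ≤ ∑' i, ENNReal.ofReal (C * (2 * C) ^ D) * ENNReal.ofReal (δ n i ^ (t : ℝ)) := by
            refine ENNReal.tsum_le_tsum fun i => ?_
            have hδ := hδ0 n i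
            rw [tsum_fintype]
            calc ∑ c : F n i, Metric.ediam (Metric.closedBall (c : X) (C * δ n i ^ m)) ^ D
                ≤ ∑ _ : F n i, ENNReal.ofReal (2 * C * δ n i ^ m) ^ D :=
                  Finset.sum_le_sum fun c _ => ENNReal.rpow_le_rpow (hdiam n i c) hD
              _ = ENNReal.ofReal ((F n i).card * (2 * C * δ n i ^ m) ^ D) := by
                  rw [Finset.sum_const, nsmul_eq_mul,
                    ENNReal.ofReal_mul (p := ((F n i).card : ℝ)) (Nat.cast_nonneg _),
                    ENNReal.ofReal_natCast, ENNReal.ofReal_rpow_of_nonneg (by positivity) hD]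
                  simp
              _ ≤ ENNReal.ofReal (C * δ n i ^ (-k) * (2 * C * δ n i ^ m) ^ D) := by
                  refine ENNReal.ofReal_le_ofReal ?_
                  gcongr
                  exact hF1 n i
              _ = _ := by
                  rw [← ENNReal.ofReal_mul (by positivity), Real.mul_rpow (by positivity)
                    (by positivity), ← Real.rpow_mul hδ.le, show m * D = t + k by
                      simp only [D]; field_simp, Real.rpow_add hδ, Real.rpow_neg hδ.le]
                  congr 1
                  have : δ n i ^ k ≠ 0 := (Real.rpow_pos_of_pos hδ k).ne'
                  field_simp
        _ ≤ _ := by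
            rw [ENNReal.tsum_mul_left]
            gcongr
            exact hsum n
    have hz' : μH[(D.toNNReal : ℝ)] (Φ '' A) = 0 := by rwa [Real.coe_toNNReal _ hD]
    exact dimH_le_of_hausdorffMeasure_ne_top (d := D.toNNReal) (by rw [hz']; simp)
  · rw [← ENNReal.ofReal_zero]
    refine ENNReal.tendsto_ofReal ?_
    have := (hεlim.rpow_const (p := m) (Or.inr hm.le)).const_mul (2 * C)
    rwa [Real.zero_rpow hm.ne', mul_zero] at this
  · have := hδ0 n p.1
    gcongr
    exact hδε n p.1
  · rintro _ ⟨x, hx, rfl⟩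
    obtain ⟨i, hi⟩ := Set.mem_iUnion.1 (hAU n hx)
    obtain ⟨c, hc, hxc⟩ := Set.mem_iUnion₂.1 (hF2 n i (Set.mem_image_of_mem Φ hi))
    exact Set.mem_iUnion.2 ⟨⟨i, ⟨c, hc⟩⟩, hxc⟩

/-! ### Ball counts and box-counting dimension -/

/-- The least number of closed balls of radius `ε` covering `s`, as a natural number. -/
noncomputable def ballCount {X : Type*} [PseudoMetricSpace X] (s : Set X) (ε : ℝ≥0) : ℕ :=
  (Metric.externalCoveringNumber ε s).toNat

theorem ballCount_le_card {X : Type*} [PseudoMetricSpace X] {s : Set X} {ε : ℝ≥0} {F : Finset X}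
    (h : s ⊆ ⋃ c ∈ F, Metric.closedBall c ε) : ballCount s ε ≤ F.card := by
  have h1 : Metric.IsCover ε s (F : Set X) := Metric.isCover_iff_subset_iUnion_closedBall.2 h
  have h2 := h1.externalCoveringNumber_le_encard
  rw [Set.encard_coe_eq_coe_finsetCard] at h2
  exact ENat.toNat_le_of_le_natCast h2

/-- Total boundedness excludes an infinite covering number, for which `toNat` would give the
meaningless value 0. -/
theorem exists_card_eq_ballCount {X : Type*} [PseudoMetricSpace X] {s : Set X}
    (hs : TotallyBounded s) {ε : ℝ≥0} (hε : 0 < ε) :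
    ∃ F : Finset X, F.card = ballCount s ε ∧ s ⊆ ⋃ c ∈ F, Metric.closedBall c ε := by
  obtain ⟨N, -, hN, hsN⟩ := Metric.exists_finite_isCover_of_totallyBounded hε.ne' hs
  have hfin : Metric.externalCoveringNumber ε s ≠ ⊤ :=
    (hsN.externalCoveringNumber_le_encard.trans_lt hN.encard_lt_top).ne
  have hne : Nonempty {C : Set X // Metric.IsCover ε s C} := ⟨⟨N, hsN⟩⟩
  obtain ⟨⟨C, hC⟩, hCe⟩ := ENat.exists_eq_iInf
    (fun C : {C : Set X // Metric.IsCover ε s C} => (C : Set X).encard)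
  have hCe' : C.encard = Metric.externalCoveringNumber ε s := by
    rw [Metric.externalCoveringNumber, iInf_subtype']
    exact hCe
  have hCf : C.Finite := Set.encard_ne_top_iff.1 (hCe' ▸ hfin)
  refine ⟨hCf.toFinset, ?_, ?_⟩
  · rw [ballCount, ← hCe', hCf.encard_eq_coe_toFinset_card, ENat.toNat_natCast]
  · simpa using Metric.isCover_iff_subset_iUnion_closedBall.1 hC

theorem totallyBounded_of_exists_finset {X : Type*} [PseudoMetricSpace X] {s : Set X}
    (h : ∀ ε : ℝ, 0 < ε → ε ≤ 1 → ∃ F : Finset X, s ⊆ ⋃ c ∈ F, Metric.closedBall c ε) :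
    TotallyBounded s := by
  refine Metric.totallyBounded_iff.2 fun ε hε => ?_
  obtain ⟨F, hF⟩ := h (min (ε / 2) 1) (by positivity) (min_le_right _ _)
  refine ⟨F, F.finite_toSet, hF.trans (Set.iUnion₂_mono fun c _ => ?_)⟩
  exact Metric.closedBall_subset_ball ((min_le_left _ _).trans_lt (by linarith))

theorem tendsto_coe_nnreal_nhdsGT_zero :
    Tendsto (fun ε : ℝ≥0 => (ε : ℝ)) (𝓝[>] 0) (𝓝[>] 0) := by
  refine tendsto_nhdsWithin_iff.2 ⟨?_, ?_⟩
  · exact (NNReal.continuous_coe.tendsto' 0 0 rfl).mono_left nhdsWithin_le_nhds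
  · filter_upwards [self_mem_nhdsWithin] with ε hε
    exact NNReal.coe_pos.2 hε

theorem tendsto_toNNReal_nhdsGT_zero :
    Tendsto Real.toNNReal (𝓝[>] 0) (𝓝[>] 0) := by
  refine tendsto_nhdsWithin_iff.2 ⟨?_, ?_⟩
  · exact (continuous_real_toNNReal.tendsto' 0 0 (by simp)).mono_left nhdsWithin_le_nhds
  · filter_upwards [self_mem_nhdsWithin] with ε hε
    exact Real.toNNReal_pos.2 hε

/-- Multiplicative constants are absorbed by an arbitrarily small increase of the exponent. -/
theorem eventually_const_mul_rpow_neg_le (K : ℝ) {a b : ℝ} (hab : a < b) :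
    ∀ᶠ ε : ℝ in 𝓝[>] 0, K * ε ^ (-a) ≤ ε ^ (-b) := by
  have h1 : Tendsto (fun ε : ℝ => K * ε ^ (b - a)) (𝓝[>] 0) (𝓝 0) := by
    have : Tendsto (fun ε : ℝ => K * ε ^ (b - a)) (𝓝 0) (𝓝 (K * 0 ^ (b - a))) :=
      ((Real.continuousAt_rpow_const 0 (b - a) (Or.inr (by linarith))).tendsto).const_mul K
    rw [Real.zero_rpow (by linarith), mul_zero] at this
    exact this.mono_left nhdsWithin_le_nhds
  filter_upwards [h1.eventually (ge_mem_nhds one_pos), self_mem_nhdsWithin] with ε h hε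
  have hε : 0 < ε := hε
  calc K * ε ^ (-a) = K * ε ^ (b - a) * ε ^ (-b) := by
        rw [mul_assoc, ← Real.rpow_add hε]; ring_nf
    _ ≤ 1 * ε ^ (-b) := by gcongr
    _ = _ := one_mul _

theorem hasBoxDim_of_ballCount {X : Type*} [PseudoMetricSpace X] {s : Set X} {d : ℝ≥0∞}
    (hs : TotallyBounded s)
    (hl : ∀ v : ℝ≥0, (v : ℝ≥0∞) < d → ∀ᶠ ε : ℝ≥0 in 𝓝[>] 0, (ε : ℝ) ^ (-(v : ℝ)) ≤ ballCount s ε)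
    (hu : ∀ v : ℝ≥0, d < v → ∀ᶠ ε : ℝ≥0 in 𝓝[>] 0, (ballCount s ε : ℝ) ≤ (ε : ℝ) ^ (-(v : ℝ))) :
    HasBoxDim s d := by
  have hε1 : ∀ᶠ ε : ℝ≥0 in 𝓝[>] 0, ε < 1 := nhdsWithin_le_nhds (gt_mem_nhds one_pos)
  refine ⟨hs, tendsto_order.2 ⟨fun a ha => ?_, fun a ha => ?_⟩⟩
  · obtain ⟨v, hav, hv⟩ := ENNReal.lt_iff_exists_nnreal_btwn.1 ha
    filter_upwards [hl v hv, hε1, self_mem_nhdsWithin] with ε h h1 h0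
    have h0 : (0 : ℝ) < ε := NNReal.coe_pos.2 h0
    have h1 : (ε : ℝ) < 1 := by exact_mod_cast h1
    have hlog : 0 < Real.log (1 / (ε : ℝ)) := Real.log_pos ((one_lt_div h0).2 h1)
    refine hav.trans_le ?_
    rw [← ENNReal.ofReal_coe_nnreal]
    refine ENNReal.ofReal_le_ofReal ((le_div_iff₀ hlog).2 ?_)
    have h2 := Real.log_le_log (by positivity) h
    rw [Real.log_rpow h0] at h2
    rw [one_div, Real.log_inv]
    change (v : ℝ) * -Real.log ε ≤ Real.log (ballCount s ε : ℝ)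
    linarith
  · obtain ⟨v, hv, hva⟩ := ENNReal.lt_iff_exists_nnreal_btwn.1 ha
    filter_upwards [hu v hv, hε1, self_mem_nhdsWithin] with ε h h1 h0
    have h0 : (0 : ℝ) < ε := NNReal.coe_pos.2 h0
    have h1 : (ε : ℝ) < 1 := by exact_mod_cast h1
    have hlog : 0 < Real.log (1 / (ε : ℝ)) := Real.log_pos ((one_lt_div h0).2 h1)
    refine lt_of_le_of_lt ?_ hva
    rw [← ENNReal.ofReal_coe_nnreal]
    refine ENNReal.ofReal_le_ofReal ((div_le_iff₀ hlog).2 ?_)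
    change Real.log (ballCount s ε : ℝ) ≤ _
    -- A count of zero must be treated apart: `Real.log 0 = 0`, and the bound is then trivial.
    rcases Nat.eq_zero_or_pos (ballCount s ε) with hz | hz
    · rw [hz]; simp only [Nat.cast_zero, Real.log_zero]; positivity
    have h2 := Real.log_le_log (by exact_mod_cast hz) h
    rw [Real.log_rpow h0] at h2
    rw [one_div, Real.log_inv]
    linarith

theorem HasBoxDim.eventually_ballCount_le {X : Type*} [PseudoMetricSpace X] {s : Set X} {d : ℝ≥0∞}
    (h : HasBoxDim s d) {v : ℝ≥0} (hv : d < v) :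
    ∀ᶠ ε : ℝ≥0 in 𝓝[>] 0, (ballCount s ε : ℝ) ≤ (ε : ℝ) ^ (-(v : ℝ)) := by
  have hε1 : ∀ᶠ ε : ℝ≥0 in 𝓝[>] 0, ε < 1 := nhdsWithin_le_nhds (gt_mem_nhds one_pos)
  filter_upwards [h.2.eventually (gt_mem_nhds hv), hε1, self_mem_nhdsWithin] with ε h h1 h0
  have h0 : (0 : ℝ) < ε := NNReal.coe_pos.2 h0
  have h1 : (ε : ℝ) < 1 := by exact_mod_cast h1
  have hlog : 0 < Real.log (1 / (ε : ℝ)) := Real.log_pos ((one_lt_div h0).2 h1)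
  rcases Nat.eq_zero_or_pos (ballCount s ε) with hz | hz
  · rw [hz]; simp only [Nat.cast_zero]; positivity
  have hv0 : (0 : ℝ) < v := by exact_mod_cast (zero_le.trans_lt hv)
  rw [← ENNReal.ofReal_coe_nnreal, ENNReal.ofReal_lt_ofReal_iff hv0, div_lt_iff₀ hlog] at h
  change Real.log (ballCount s ε : ℝ) < _ at h
  rw [← Real.log_le_log_iff (by exact_mod_cast hz) (by positivity), Real.log_rpow h0]
  rw [one_div, Real.log_inv] at h
  linarith

/-- If fewer than ε^(-v) balls sufficed for arbitrarily small ε, these covers would give Hausdorff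
measure zero for an order u strictly between v and the dimension. -/
theorem eventually_rpow_le_ballCount {X : Type*} [MetricSpace X] {s : Set X}
    (hs : TotallyBounded s) {v : ℝ≥0} (hv : (v : ℝ≥0∞) < dimH s) :
    ∀ᶠ ε : ℝ≥0 in 𝓝[>] 0, (ε : ℝ) ^ (-(v : ℝ)) ≤ ballCount s ε := by
  borelize X
  by_contra hcon
  obtain ⟨u, hvu, hu⟩ := ENNReal.lt_iff_exists_nnreal_btwn.1 hv
  have hvu : (v : ℝ) < u := by exact_mod_cast hvu
  obtain ⟨ε, hε, hεs⟩ := exists_seq_forall_of_frequently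
    ((not_eventually.1 hcon).and_eventually self_mem_nhdsWithin)
  have hε0 : ∀ n, 0 < ε n := fun n => (hεs n).2
  have hεR : Tendsto (fun n => (ε n : ℝ)) atTop (𝓝 0) :=
    (tendsto_coe_nnreal_nhdsGT_zero.comp hε).mono_right nhdsWithin_le_nhds
  choose F hF hFs using fun n => exists_card_eq_ballCount hs (hε0 n)
  have hdiam : ∀ n (c : X), Metric.ediam (Metric.closedBall c (ε n)) ≤ ENNReal.ofReal (2 * ε n) := by
    intro n c
    refine Metric.ediam_le fun x hx y hy => ?_
    rw [edist_dist]
    refine ENNReal.ofReal_le_ofReal ((dist_triangle_right x y c).trans ?_)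
    rw [Metric.mem_closedBall] at hx hy
    linarith
  have hH := Measure.hausdorffMeasure_le_liminf_sum (ι := fun n => F n) (u : ℝ) s (l := atTop)
    (fun n => ENNReal.ofReal (2 * ε n)) ?_
    (fun n c => Metric.closedBall (c : X) (ε n))
    (Eventually.of_forall fun n c => hdiam n c) (Eventually.of_forall fun n => ?_)
  · have hlim0 : Tendsto (fun n => ENNReal.ofReal (2 ^ (u : ℝ) * (ε n : ℝ) ^ ((u : ℝ) - v))) atTop
        (𝓝 0) := by
      rw [← ENNReal.ofReal_zero]
      refine ENNReal.tendsto_ofReal ?_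
      have := (hεR.rpow_const (p := (u : ℝ) - v) (Or.inr (by linarith))).const_mul (2 ^ (u : ℝ))
      rwa [Real.zero_rpow (by linarith), mul_zero] at this
    have hz : μH[(u : ℝ)] s = 0 := by
      refine le_antisymm (hH.trans ?_) zero_le
      rw [← hlim0.liminf_eq]
      refine liminf_le_liminf (Eventually.of_forall fun n => ?_)
      have h0 : (0 : ℝ) < ε n := NNReal.coe_pos.2 (hε0 n)
      calc ∑ c : F n, Metric.ediam (Metric.closedBall (c : X) (ε n)) ^ (u : ℝ)
          ≤ ∑ _ : F n, ENNReal.ofReal (2 * ε n) ^ (u : ℝ) :=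
            Finset.sum_le_sum fun c _ => ENNReal.rpow_le_rpow (hdiam n c) u.2
        _ = ENNReal.ofReal ((F n).card * (2 * ε n) ^ (u : ℝ)) := by
            rw [Finset.sum_const, nsmul_eq_mul,
              ENNReal.ofReal_mul (p := ((F n).card : ℝ)) (Nat.cast_nonneg _),
              ENNReal.ofReal_natCast, ENNReal.ofReal_rpow_of_nonneg (p := (u : ℝ)) (by positivity) u.2]
            simp
        _ ≤ ENNReal.ofReal ((ε n : ℝ) ^ (-(v : ℝ)) * (2 * ε n) ^ (u : ℝ)) := by
            refine ENNReal.ofReal_le_ofReal ?_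
            gcongr
            rw [hF]
            exact (not_le.1 (hεs n).1).le
        _ = _ := by
            rw [Real.mul_rpow (by positivity) (by positivity), mul_left_comm, ← Real.rpow_add h0]
            ring_nf
    have := hausdorffMeasure_of_lt_dimH hu
    simp [hz] at this
  · rw [← ENNReal.ofReal_zero]
    refine ENNReal.tendsto_ofReal ?_
    simpa using hεR.const_mul 2
  · intro x hx
    obtain ⟨c, hc, hxc⟩ := Set.mem_iUnion₂.1 (hFs n hx)
    exact Set.mem_iUnion.2 ⟨⟨c, hc⟩, hxc⟩

theorem CoverBound.exists_finset_image {X : Type*} [MetricSpace X] {Φ : ℝ → X} {C k m : ℝ}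
    (h : CoverBound Φ C k m) {A : Set ℝ} (hA : TotallyBounded A) {δ : ℝ≥0} (hδ : 0 < δ)
    (hδ1 : 2 * δ ≤ 1) :
    ∃ F : Finset X, (F.card : ℝ) ≤ ballCount A δ * (C * (2 * δ : ℝ) ^ (-k)) ∧
      Φ '' A ⊆ ⋃ c ∈ F, Metric.closedBall c (C * (2 * δ : ℝ) ^ m) := by
  classical
  obtain ⟨G, hG, hAG⟩ := exists_card_eq_ballCount hA hδ
  have hδ' : (0 : ℝ) < δ := NNReal.coe_pos.2 hδ
  choose F hF hFs using fun c : ℝ => h (Metric.closedBall c δ) (2 * δ) (by positivity)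
    (by exact_mod_cast hδ1) (fun x hx y hy => by
      rw [← Real.dist_eq]
      refine (dist_triangle_right x y c).trans ?_
      rw [Metric.mem_closedBall] at hx hy
      linarith)
  refine ⟨G.biUnion F, ?_, ?_⟩
  · calc ((G.biUnion F).card : ℝ) ≤ ∑ c ∈ G, ((F c).card : ℝ) := by
          exact_mod_cast Finset.card_biUnion_le
      _ ≤ ∑ _ ∈ G, C * (2 * δ : ℝ) ^ (-k) := Finset.sum_le_sum fun c _ => hF c
      _ = _ := by rw [Finset.sum_const, nsmul_eq_mul, hG]
  · rintro _ ⟨x, hx, rfl⟩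
    obtain ⟨c, hc, hxc⟩ := Set.mem_iUnion₂.1 (hAG hx)
    obtain ⟨e, he, hxe⟩ := Set.mem_iUnion₂.1 (hFs c (Set.mem_image_of_mem Φ hxc))
    exact Set.mem_iUnion₂.2 ⟨e, Finset.mem_biUnion.2 ⟨c, hc, he⟩, hxe⟩

theorem eventually_mul_rpow_le {C m η : ℝ} (hm : 0 < m) (hη : 0 < η) :
    ∃ δ : ℝ≥0, 0 < δ ∧ 2 * δ ≤ 1 ∧ C * (2 * δ : ℝ) ^ m ≤ η := by
  have h : Tendsto (fun δ : ℝ≥0 => C * (2 * δ : ℝ) ^ m) (𝓝[>] 0) (𝓝 0) := by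
    have h1 : Tendsto (fun δ : ℝ≥0 => (2 * δ : ℝ)) (𝓝[>] 0) (𝓝 0) := by
      simpa using (tendsto_coe_nnreal_nhdsGT_zero.mono_right nhdsWithin_le_nhds).const_mul 2
    have := (h1.rpow_const (p := m) (Or.inr hm.le)).const_mul C
    rwa [Real.zero_rpow hm.ne', mul_zero] at this
  have h2 : ∀ᶠ δ : ℝ≥0 in 𝓝[>] 0, δ < 1 / 2 := nhdsWithin_le_nhds (gt_mem_nhds (by norm_num))
  obtain ⟨δ, h3, h4, h5⟩ :=
    ((h.eventually (ge_mem_nhds hη)).and (h2.and self_mem_nhdsWithin)).exists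
  refine ⟨δ, h5, ?_, h3⟩
  have : (δ : ℝ) < 1 / 2 := by exact_mod_cast h4
  have : (2 * δ : ℝ) ≤ 1 := by linarith
  exact_mod_cast this

theorem CoverBound.totallyBounded_image {X : Type*} [MetricSpace X] {Φ : ℝ → X} {C k m : ℝ}
    (h : CoverBound Φ C k m) (hm : 0 < m) {A : Set ℝ} (hA : TotallyBounded A) :
    TotallyBounded (Φ '' A) := by
  refine totallyBounded_of_exists_finset fun η hη _ => ?_
  obtain ⟨δ, h0, h1, h2⟩ := eventually_mul_rpow_le (C := C) hm hη
  obtain ⟨F, -, hF⟩ := h.exists_finset_image hA h0 h1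
  exact ⟨F, hF.trans (Set.iUnion₂_mono fun c _ => Metric.closedBall_subset_closedBall h2)⟩

/-- The box-counting version of the Hausdorff estimate: all sets of the cover have one common scale,
so only the count of `A` at that scale enters. -/
theorem CoverBound.eventually_ballCount_le {X : Type*} [MetricSpace X] {Φ : ℝ → X} {C k m : ℝ}
    (h : CoverBound Φ C k m) (hC : 0 < C) (hm : 0 < m) {A : Set ℝ}
    (hA : TotallyBounded A) {t : ℝ≥0}
    (hAt : ∀ᶠ ε : ℝ≥0 in 𝓝[>] 0, (ballCount A ε : ℝ) ≤ (ε : ℝ) ^ (-(t : ℝ)))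
    {v : ℝ} (hv : (t + k) / m < v) :
    ∀ᶠ ε : ℝ≥0 in 𝓝[>] 0, (ballCount (Φ '' A) ε : ℝ) ≤ (ε : ℝ) ^ (-v) := by
  -- The scale δ is chosen so that C(2δ)^m = ε; balls of radius δ have diameter at most 2δ.
  have hδ : Tendsto (fun ε : ℝ => (ε / C) ^ m⁻¹ / 2) (𝓝[>] 0) (𝓝[>] 0) := by
    refine tendsto_nhdsWithin_iff.2 ⟨?_, ?_⟩
    · have h1 : Tendsto (fun ε : ℝ => ε / C) (𝓝 0) (𝓝 0) := by
        simpa using (tendsto_id (x := 𝓝 (0 : ℝ))).div_const C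
      have := (h1.rpow_const (p := m⁻¹) (Or.inr (by positivity))).div_const 2
      rw [Real.zero_rpow (by positivity), zero_div] at this
      exact this.mono_left nhdsWithin_le_nhds
    · filter_upwards [self_mem_nhdsWithin] with ε hε
      have hε : 0 < ε := hε
      exact Set.mem_Ioi.2 (by positivity)
  have hδ' := (tendsto_toNNReal_nhdsGT_zero.comp hδ).comp tendsto_coe_nnreal_nhdsGT_zero
  have hδ1 : ∀ᶠ δ : ℝ≥0 in 𝓝[>] 0, 2 * δ ≤ 1 := by
    have h2 : ∀ᶠ δ : ℝ≥0 in 𝓝[>] 0, δ < 1 / 2 := nhdsWithin_le_nhds (gt_mem_nhds (by norm_num))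
    filter_upwards [h2] with δ h
    have : (δ : ℝ) < 1 / 2 := by exact_mod_cast h
    have : (2 * δ : ℝ) ≤ 1 := by linarith
    exact_mod_cast this
  filter_upwards [hδ'.eventually hAt, hδ'.eventually hδ1, self_mem_nhdsWithin,
    tendsto_coe_nnreal_nhdsGT_zero.eventually
      (eventually_const_mul_rpow_neg_le (2 ^ (t : ℝ) * C * C ^ ((t + k) / m)) hv)]
    with ε h1 h2 h0 h3
  have h0 : (0 : ℝ) < ε := NNReal.coe_pos.2 h0
  set δ : ℝ≥0 := Real.toNNReal (((ε : ℝ) / C) ^ m⁻¹ / 2) with hδdef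
  have hδR : (2 * δ : ℝ) = ((ε : ℝ) / C) ^ m⁻¹ := by
    rw [hδdef, Real.coe_toNNReal _ (by positivity)]; ring
  have hδ0 : (0 : ℝ) < δ := by
    have : 0 < (2 * δ : ℝ) := by rw [hδR]; positivity
    linarith
  have h1 : (ballCount A δ : ℝ) ≤ (δ : ℝ) ^ (-(t : ℝ)) := h1
  obtain ⟨F, hF, hFs⟩ := h.exists_finset_image hA (NNReal.coe_pos.1 hδ0) h2
  have hrad : C * (2 * δ : ℝ) ^ m = ε := by
    rw [hδR, ← Real.rpow_mul (by positivity), inv_mul_cancel₀ hm.ne', Real.rpow_one]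
    field_simp
  rw [hrad] at hFs
  calc (ballCount (Φ '' A) ε : ℝ) ≤ F.card := by exact_mod_cast ballCount_le_card hFs
    _ ≤ (δ : ℝ) ^ (-(t : ℝ)) * (C * (2 * δ : ℝ) ^ (-k)) :=
        hF.trans (mul_le_mul_of_nonneg_right h1 (by positivity))
    _ = 2 ^ (t : ℝ) * C * (2 * δ : ℝ) ^ (-(t + k)) := by
        have : (δ : ℝ) ^ (-(t : ℝ)) = 2 ^ (t : ℝ) * (2 * δ : ℝ) ^ (-(t : ℝ)) := by
          rw [Real.mul_rpow (by norm_num) hδ0.le, ← mul_assoc, ← Real.rpow_add (by norm_num)]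
          simp
        rw [this, neg_add, Real.rpow_add (by positivity)]
        ring
    _ = 2 ^ (t : ℝ) * C * C ^ ((t + k) / m) * (ε : ℝ) ^ (-((t + k) / m)) := by
        rw [hδR, ← Real.rpow_mul (by positivity), Real.div_rpow h0.le hC.le,
          show m⁻¹ * (-(t + k)) = -((t + k) / m) by field_simp, Real.rpow_neg hC.le]
        have : C ^ ((t + k) / m) ≠ 0 := (Real.rpow_pos_of_pos hC _).ne'
        field_simp
    _ ≤ _ := h3

theorem eventually_ballCount_le_of_isBounded {s : Set ℂ} (hs : Bornology.IsBounded s)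
    {v : ℝ} (hv : 2 < v) :
    ∀ᶠ ε : ℝ≥0 in 𝓝[>] 0, (ballCount s ε : ℝ) ≤ (ε : ℝ) ^ (-v) := by
  obtain ⟨R, hR⟩ := hs.subset_closedBall 0
  have h2 : ∀ᶠ ε : ℝ≥0 in 𝓝[>] 0, ε < 1 := nhdsWithin_le_nhds (gt_mem_nhds (by norm_num))
  filter_upwards [h2, self_mem_nhdsWithin, tendsto_coe_nnreal_nhdsGT_zero.eventually
      (eventually_const_mul_rpow_neg_le (25 * (max R 1) ^ 2) hv)] with ε h1 h0 h3
  have h0 : (0 : ℝ) < ε := NNReal.coe_pos.2 h0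
  have h1 : (ε : ℝ) < 1 := by exact_mod_cast h1
  obtain ⟨F, hF, hFs⟩ := exists_finset_cover_closedBall 0 h0 (h1.le.trans (le_max_right R 1))
  have hsF := (hR.trans (Metric.closedBall_subset_closedBall (le_max_left R 1))).trans hFs
  calc (ballCount s ε : ℝ) ≤ F.card := by exact_mod_cast ballCount_le_card hsF
    _ ≤ 25 * (max R 1 / ε) ^ 2 := hF
    _ = 25 * (max R 1) ^ 2 * (ε : ℝ) ^ (-(2 : ℝ)) := by
        rw [Real.rpow_neg h0.le, Real.rpow_two]; field_simp
    _ ≤ _ := h3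

/-! ### Choice of exponents for the upper bounds -/

/-- Images under `Φ` of sets of dimension `d` have dimension less than `v` because of a uniform
covering estimate. -/
def HasDimBound {X : Type*} [MetricSpace X] (Φ : ℝ → X) (d v : ℝ) : Prop :=
  ∃ t : ℝ≥0, d < t ∧ ∃ C k m : ℝ, 0 < C ∧ 0 ≤ k ∧ 0 < m ∧ (t + k) / m < v ∧ CoverBound Φ C k m

theorem HasDimBound.dimH_image_le {X : Type*} [MetricSpace X] {Φ : ℝ → X} {d v : ℝ}
    (h : HasDimBound Φ d v) (hd : 0 ≤ d) {A : Set ℝ} (hA : dimH A ≤ ENNReal.ofReal d) :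
    dimH (Φ '' A) ≤ ENNReal.ofReal v := by
  obtain ⟨t, hdt, C, k, m, hC, hk, hm, hv, hΦ⟩ := h
  refine (hΦ.dimH_image_le hC hk hm (hA.trans_lt ?_)).trans (ENNReal.ofReal_le_ofReal hv.le)
  rw [← ENNReal.ofReal_coe_nnreal, ENNReal.ofReal_lt_ofReal_iff (hd.trans_lt hdt)]
  exact hdt

theorem HasDimBound.totallyBounded_image {X : Type*} [MetricSpace X] {Φ : ℝ → X} {d v : ℝ}
    (h : HasDimBound Φ d v) {A : Set ℝ} (hA : TotallyBounded A) : TotallyBounded (Φ '' A) := by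
  obtain ⟨t, hdt, C, k, m, hC, hk, hm, hv, hΦ⟩ := h
  exact hΦ.totallyBounded_image hm hA

theorem HasDimBound.eventually_ballCount_le {X : Type*} [MetricSpace X] {Φ : ℝ → X} {d v : ℝ}
    (h : HasDimBound Φ d v) (hd : 0 ≤ d) {A : Set ℝ} (hA : HasBoxDim A (ENNReal.ofReal d)) :
    ∀ᶠ ε : ℝ≥0 in 𝓝[>] 0, (ballCount (Φ '' A) ε : ℝ) ≤ (ε : ℝ) ^ (-v) := by
  obtain ⟨t, hdt, C, k, m, hC, hk, hm, hv, hΦ⟩ := h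
  refine hΦ.eventually_ballCount_le hC hm hA.1 (hA.eventually_ballCount_le ?_) hv
  rw [← ENNReal.ofReal_coe_nnreal, ENNReal.ofReal_lt_ofReal_iff (hd.trans_lt hdt)]
  exact hdt

theorem exists_dist_weierstrass_le {β lam : ℝ} (hlam : 1 < lam) (hβ' : β ≤ 1) {b : ℝ} (hb : 0 < b)
    (hbβ : b < β) : ∃ C : ℝ, 1 ≤ C ∧ ∀ (θ : ℕ → ℝ) (x y : ℝ),
      dist (weierstrass β lam θ x) (weierstrass β lam θ y) ≤ C * |x - y| ^ b := by
  obtain ⟨C, -, h⟩ := exists_norm_weierstrass_sub_le hlam hβ' hb hbβ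
  refine ⟨max C 1, le_max_right _ _, fun θ x y => ?_⟩
  rw [dist_eq_norm]
  refine (h θ x y).trans ?_
  gcongr
  exact le_max_left _ _

/-- Two strict losses are needed at once: a Hölder order below β and a dimension parameter above d.
Coupling them as b and d + (β - b) leaves one variable tending to β. -/
theorem exists_exponent_lt {β d v : ℝ} (hβ : 0 < β) {f : ℝ → ℝ → ℝ}
    (hf : ContinuousAt (fun b => f b (d + (β - b))) β) (hv : f β d < v) :
    ∃ b, 0 < b ∧ b < β ∧ f b (d + (β - b)) < v := by
  have h1 : ∀ᶠ b in 𝓝[<] β, f b (d + (β - b)) < v :=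
    nhdsWithin_le_nhds (hf.eventually (gt_mem_nhds (by simpa using hv)))
  have h2 : ∀ᶠ b in 𝓝[<] β, 0 < b := nhdsWithin_le_nhds (lt_mem_nhds hβ)
  obtain ⟨b, h3, h4, h5⟩ := (h1.and (h2.and self_mem_nhdsWithin)).exists
  exact ⟨b, h4, h5, h3⟩

theorem hasDimBound_of_forall_dist_le {X : Type*} [MetricSpace X] {Φ : ℝ → X} {β d v : ℝ}
    (hβ : 0 < β) (hd : 0 ≤ d) (hv : d / β < v)
    (h : ∀ b, 0 < b → b < β → ∃ C, 1 ≤ C ∧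
      ∀ x y, |x - y| ≤ 1 → dist (Φ x) (Φ y) ≤ C * |x - y| ^ b) : HasDimBound Φ d v := by
  obtain ⟨b, hb, hbβ, hbv⟩ := exists_exponent_lt (f := fun b t => t / b) hβ
    (by fun_prop (disch := exact hβ.ne')) hv
  obtain ⟨C, hC, hΦ⟩ := h b hb hbβ
  have ht : ((d + (β - b)).toNNReal : ℝ) = d + (β - b) := Real.coe_toNNReal _ (by linarith)
  refine ⟨(d + (β - b)).toNNReal, by linarith, C, 0, b, by linarith, le_rfl, hb, ?_,
    coverBound_of_dist_le hb hC hΦ⟩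
  rwa [ht, add_zero]

theorem hasDimBound_weierstrass {β lam : ℝ} (hβ : 0 < β) (hβ' : β ≤ 1) (hlam : 1 < lam)
    {d v : ℝ} (hd : 0 ≤ d) (hv : d / β < v) (θ : ℕ → ℝ) :
    HasDimBound (weierstrass β lam θ) d v := by
  refine hasDimBound_of_forall_dist_le hβ hd hv fun b hb hbβ => ?_
  obtain ⟨C, hC, h⟩ := exists_dist_weierstrass_le hlam hβ' hb hbβ
  exact ⟨C, hC, fun x y _ => h θ x y⟩

/-- Each side of the minimum has its own covering: one large ball per piece gives d/β, since the
graph map is itself Hölder at small distances, and many balls of the base scale give d + 2 - 2β. -/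
theorem hasDimBound_graph {β lam : ℝ} (hβ : 0 < β) (hβ' : β ≤ 1) (hlam : 1 < lam)
    {d v : ℝ} (hd : 0 ≤ d) (hv : min (d / β) (d + 2 - 2 * β) < v) (θ : ℕ → ℝ) :
    HasDimBound (fun x : ℝ => WithLp.toLp 2 (x, weierstrass β lam θ x)) d v := by
  rcases min_lt_iff.1 hv with hv | hv
  · refine hasDimBound_of_forall_dist_le hβ hd hv fun b hb hbβ => ?_
    obtain ⟨C, hC, h⟩ := exists_dist_weierstrass_le hlam hβ' hb hbβ
    refine ⟨1 + C, by linarith, fun x y hxy => (dist_toLp_le _ _ _ _).trans ?_⟩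
    rw [add_mul, one_mul]
    refine add_le_add ?_ (h θ x y)
    exact Real.self_le_rpow_of_le_one (abs_nonneg _) hxy (by linarith)
  · obtain ⟨b, hb, hbβ, hbv⟩ := exists_exponent_lt (f := fun b t => t + 2 - 2 * b) hβ
      (by fun_prop) hv
    obtain ⟨C, hC, h⟩ := exists_dist_weierstrass_le hlam hβ' hb hbβ
    have ht : ((d + (β - b)).toNNReal : ℝ) = d + (β - b) := Real.coe_toNNReal _ (by linarith)
    refine ⟨(d + (β - b)).toNNReal, by linarith, 25 * C ^ 2, 2 - 2 * b, 1, by positivity,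
      by linarith, one_pos, by linarith, coverBound_graph_of_dist_le hb (by linarith) hC (h θ)⟩

/-- The exceptional event may depend on s; rational values of s suffice, so a countable union of
null events remains. -/
theorem ae_le_of_forall_nnreal_lt {Ω : Type*} [MeasurableSpace Ω] {P : Measure Ω} {D : ℝ≥0∞}
    {f : Ω → ℝ≥0∞} (h : ∀ s : ℝ≥0, 0 < s → (s : ℝ≥0∞) < D → ∀ᵐ ω ∂P, (s : ℝ≥0∞) ≤ f ω) :
    ∀ᵐ ω ∂P, D ≤ f ω := by
  have h1 : ∀ q : ℚ, ∀ᵐ ω ∂P, (Real.toNNReal q : ℝ≥0∞) < D → (Real.toNNReal q : ℝ≥0∞) ≤ f ω := by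
    intro q
    by_cases hq : (Real.toNNReal q : ℝ≥0∞) < D
    · rcases (zero_le (a := Real.toNNReal q)).eq_or_lt with h0 | h0
      · exact Eventually.of_forall fun ω _ => by simp [← h0]
      · filter_upwards [h _ h0 hq] with ω hω _ using hω
    · exact Eventually.of_forall fun ω hω => absurd hω hq
  filter_upwards [ae_all_iff.2 h1] with ω hω
  refine le_of_forall_lt fun a ha => ?_
  obtain ⟨q, -, haq, hq⟩ := ENNReal.lt_iff_exists_rat_btwn.1 ha
  exact haq.trans_le (hω q hq)

theorem le_ofReal_of_forall_lt {a : ℝ≥0∞} {e : ℝ} (h : ∀ v, e < v → a ≤ ENNReal.ofReal v) :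
    a ≤ ENNReal.ofReal e := by
  have h1 : Tendsto (fun v : ℝ => ENNReal.ofReal v) (𝓝[>] e) (𝓝 (ENNReal.ofReal e)) :=
    (ENNReal.continuous_ofReal.tendsto e).mono_left nhdsWithin_le_nhds
  refine ge_of_tendsto h1 ?_
  filter_upwards [self_mem_nhdsWithin] with v hv using h v hv

theorem dimH_complex_le_two (s : Set ℂ) : dimH s ≤ 2 := by
  refine (dimH_mono (Set.subset_univ s)).trans_eq ?_
  rw [Real.dimH_univ_eq_finrank, Complex.finrank_real_complex]
  rfl

theorem dimH_real_le_one (s : Set ℝ) : dimH s ≤ 1 :=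
  (dimH_mono (Set.subset_univ s)).trans_eq Real.dimH_univ

/-- The lower counts are automatic from the Hausdorff dimension, so only upper counts are left to
check. -/
theorem hasBoxDim_of_dimH_eq {X : Type*} [MetricSpace X] {s : Set X} {e : ℝ}
    (hs : TotallyBounded s) (hdim : dimH s = ENNReal.ofReal e)
    (hu : ∀ v : ℝ, e < v → ∀ᶠ ε : ℝ≥0 in 𝓝[>] 0, (ballCount s ε : ℝ) ≤ (ε : ℝ) ^ (-v)) :
    HasBoxDim s (ENNReal.ofReal e) := by
  refine hasBoxDim_of_ballCount hs
    (fun v hv => eventually_rpow_le_ballCount hs (hv.trans_eq hdim.symm)) fun v hv => hu v ?_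
  by_contra hcon
  rw [← ENNReal.ofReal_coe_nnreal] at hv
  exact hv.not_ge (ENNReal.ofReal_le_ofReal (not_lt.1 hcon))

theorem ENNReal.le_rpow_of_le_one {a b : ℝ≥0∞} {q : ℝ} (ha : a ≤ 1) (hab : a ≤ b) (hq : 0 ≤ q)
    (hq1 : q ≤ 1) : a ≤ b ^ q :=
  calc a = a ^ (1 : ℝ) := (ENNReal.rpow_one a).symm
    _ ≤ a ^ q := ENNReal.rpow_le_rpow_of_exponent_ge ha hq1
    _ ≤ b ^ q := ENNReal.rpow_le_rpow hab hq

/-- Below the Hausdorff dimension, some compact subset of small diameter carries a measure of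
finite energy. -/
theorem exists_energy_lt_top {A : Set ℝ} (hA : MeasurableSet A) {p : ℝ} (hp : 0 ≤ p)
    (hpA : ENNReal.ofReal p < dimH A) {δ : ℝ} (hδ : 0 < δ) :
    ∃ K ⊆ A, IsCompact K ∧ (∀ x ∈ K, ∀ y ∈ K, |x - y| ≤ δ) ∧ ∃ μ : Measure ℝ,
      IsFiniteMeasure μ ∧ μ ≠ 0 ∧ μ Kᶜ = 0 ∧ ∫⁻ x, ∫⁻ y, edist x y ^ (-p) ∂μ ∂μ < ⊤ := by
  obtain ⟨α, hpα, hα⟩ := ENNReal.lt_iff_exists_nnreal_btwn.1 hpA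
  have hα0 : 0 < α := by exact_mod_cast (zero_le.trans_lt hpα)
  have hpα' : p < α := by
    rw [← ENNReal.ofReal_coe_nnreal] at hpα
    exact (ENNReal.ofReal_lt_ofReal_iff (by exact_mod_cast hα0)).1 hpα
  obtain ⟨K, hKA, hK, hd, μ, hμ, hμ0, hμK, hF⟩ :=
    exists_frostman hα0 hA hα (δ := min δ 1) (by positivity)
  exact ⟨K, hKA, hK, fun x hx y hy => (hd x hx y hy).trans (min_le_left _ _), μ, hμ, hμ0, hμK,
    energy_lt_top hp hpα' hμK (fun x hx y hy => (hd x hx y hy).trans (min_le_right _ _)) hF⟩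

/-! ### Almost sure dimension, area and interior -/

section RandomPhase

variable {β lam : ℝ} {Ω : Type*} [MeasurableSpace Ω] {P : Measure Ω} [IsProbabilityMeasure P]
  {θ : ℕ → Ω → ℝ} {A : Set ℝ}

theorem measurable_dist_weierstrass (hβ : 0 < β) (hlam : 1 < lam) (hθ : ∀ n, Measurable (θ n)) :
    Measurable fun p : Ω × (ℝ × ℝ) => dist (weierstrass β lam (fun n => θ n p.1) p.2.1)
      (weierstrass β lam (fun n => θ n p.1) p.2.2) := by
  have h := measurable_weierstrass hβ hlam hθ
  have h1 : Measurable fun p : Ω × (ℝ × ℝ) => (p.1, p.2.1) := by fun_prop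
  have h2 : Measurable fun p : Ω × (ℝ × ℝ) => (p.1, p.2.2) := by fun_prop
  exact (h.comp h1).dist (h.comp h2)

theorem continuous_weierstrass_right (hβ : 0 < β) (hlam : 1 < lam) (t : ℕ → ℝ) :
    Continuous (weierstrass β lam t) :=
  (continuous_weierstrass hβ hlam).comp (Continuous.prodMk_right t)

/-- For s < q < 2 a probability is at most its bound C r² |x - y|^(-2β) raised to q/2 ≤ 1, that is
C^(q/2) r^q |x - y|^(-βq). The energy needed is of order βq, which may be kept below the dimension
of `A`. -/
theorem ae_le_dimH_weierstrass_image (hβ : 0 < β) (hlam : 1 < lam) (hθ : IsRandomPhase P θ)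
    (hA : MeasurableSet A) {s : ℝ≥0} (hs : 0 < s) (hs2 : (s : ℝ) < 2)
    (hsA : ENNReal.ofReal (β * s) < dimH A) :
    ∀ᵐ ω ∂P, (s : ℝ≥0∞) ≤ dimH (weierstrass β lam (fun n => θ n ω) '' A) := by
  have h1 : ∀ᶠ q : ℝ in 𝓝[>] (s : ℝ), ENNReal.ofReal (β * q) < dimH A := by
    refine nhdsWithin_le_nhds (Tendsto.eventually ?_ (gt_mem_nhds hsA))
    exact (ENNReal.continuous_ofReal.comp (continuous_const.mul continuous_id)).tendsto _
  have h2 : ∀ᶠ q : ℝ in 𝓝[>] (s : ℝ), q < 2 := nhdsWithin_le_nhds (gt_mem_nhds hs2)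
  obtain ⟨q, hqA, hq2, hsq⟩ := (h1.and (h2.and self_mem_nhdsWithin)).exists
  have hsq : (s : ℝ) < q := hsq
  have hq0 : 0 < q := s.2.trans_lt hsq
  obtain ⟨C, hC, t₀, ht₀, hP⟩ := exists_measure_increment_le hβ hlam
  obtain ⟨K, hKA, hK, hd, μ, hμ, hμ0, hμK, hE⟩ :=
    exists_energy_lt_top hA (by positivity : 0 ≤ β * q) hqA ht₀
  have h := ae_le_dimH_image (P := P) (G := fun ω => weierstrass β lam (fun n => θ n ω))
    (measurable_dist_weierstrass hβ hlam hθ.measurable) hμ0 hμK (C := C ^ (q / 2)) hs hsq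
    (fun x hx y hy r hr _ => ?_) hE
  · filter_upwards [h] with ω hω using hω.trans (dimH_mono (Set.image_mono hKA))
  · refine (ENNReal.le_rpow_of_le_one prob_le_one (hP hθ x y (hd x hx y hy) r hr)
      (by positivity : 0 ≤ q / 2) (by linarith)).trans_eq ?_
    rw [ENNReal.mul_rpow_of_nonneg _ _ (by positivity), ← ENNReal.rpow_mul,
      ENNReal.ofReal_rpow_of_nonneg (by positivity) (by positivity),
      Real.mul_rpow hC.le (by positivity), ← Real.rpow_natCast, ← Real.rpow_mul hr.le]
    congr 4 <;> (push_cast; ring)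

theorem dimH_image_le_dimH_graphOver (f : ℝ → ℂ) (A : Set ℝ) :
    dimH (f '' A) ≤ dimH (graphOver f A) := by
  have h : LipschitzWith 1 (fun p : WithLp 2 (ℝ × ℂ) => p.snd) :=
    LipschitzWith.of_dist_le_mul fun x y => by simpa using WithLp.dist_snd_le x y
  have := h.dimH_image_le (graphOver f A)
  rwa [graphOver, Set.image_image] at this

/-- Beyond exponent 2 the extra decay comes from the first coordinate: graph points within r have |x
- y| ≤ r, so a factor |x - y|^(q - 2) can be traded for r^(q - 2), at the price of an energy of
order q + 2β - 2. -/
theorem ae_le_dimH_graphOver (hβ : 0 < β) (hlam : 1 < lam) (hθ : IsRandomPhase P θ)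
    (hA : MeasurableSet A) {s : ℝ≥0} (hs : 0 < s)
    (hβA : ENNReal.ofReal (2 * β) < dimH A)
    (hsA : ENNReal.ofReal (s + 2 * β - 2) < dimH A) :
    ∀ᵐ ω ∂P, (s : ℝ≥0∞) ≤ dimH (graphOver (weierstrass β lam (fun n => θ n ω)) A) := by
  -- Both q > s and q > 2 are required; at q = 2 the energy order is 2β, which is why 2β below the
  -- dimension is assumed.
  obtain ⟨q, hsq, hq2, hqA⟩ : ∃ q : ℝ, s < q ∧ 2 < q ∧ ENNReal.ofReal (q + 2 * β - 2) < dimH A := by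
    have hm : ENNReal.ofReal (max (s : ℝ) 2 + 2 * β - 2) < dimH A := by
      rcases max_cases (s : ℝ) 2 with ⟨h, -⟩ | ⟨h, -⟩ <;> rw [h]
      · exact hsA
      · simpa using hβA
    have h1 : ∀ᶠ q : ℝ in 𝓝[>] (max (s : ℝ) 2), ENNReal.ofReal (q + 2 * β - 2) < dimH A := by
      refine nhdsWithin_le_nhds (Tendsto.eventually ?_ (gt_mem_nhds hm))
      exact (ENNReal.continuous_ofReal.comp
        ((continuous_id.add continuous_const).sub continuous_const)).tendsto _
    obtain ⟨q, hqA, hq⟩ := (h1.and self_mem_nhdsWithin).exists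
    exact ⟨q, (le_max_left _ _).trans_lt hq, (le_max_right _ _).trans_lt hq, hqA⟩
  obtain ⟨C, hC, t₀, ht₀, hP⟩ := exists_measure_increment_le hβ hlam
  obtain ⟨K, hKA, hK, hd, μ, hμ, hμ0, hμK, hE⟩ :=
    exists_energy_lt_top hA (by linarith : 0 ≤ q + 2 * β - 2) hqA ht₀
  have hm : Measurable fun p : Ω × (ℝ × ℝ) =>
      dist (WithLp.toLp 2 (p.2.1, weierstrass β lam (fun n => θ n p.1) p.2.1))
        (WithLp.toLp 2 (p.2.2, weierstrass β lam (fun n => θ n p.1) p.2.2)) := by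
    simp only [WithLp.prod_dist_eq_of_L2]
    have h1 := measurable_dist_weierstrass hβ hlam hθ.measurable
    have h2 : Measurable fun p : Ω × (ℝ × ℝ) => dist p.2.1 p.2.2 :=
      (measurable_fst.comp measurable_snd).dist (measurable_snd.comp measurable_snd)
    exact ((h2.pow_const 2).add (h1.pow_const 2)).sqrt
  have h := ae_le_dimH_image (P := P)
    (G := fun ω x => WithLp.toLp 2 (x, weierstrass β lam (fun n => θ n ω) x))
    hm hμ0 hμK (C := C) hs hsq (fun x hx y hy r hr _ => ?_) hE
  · filter_upwards [h] with ω hω using hω.trans (dimH_mono (Set.image_mono hKA))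
  · rcases eq_or_ne x y with rfl | hxy
    · rw [edist_self, ENNReal.zero_rpow_of_neg (by linarith),
        ENNReal.mul_top (ENNReal.ofReal_pos.2 (by positivity)).ne']
      exact le_top
    have hxy0 : 0 < |x - y| := abs_pos.2 (sub_ne_zero.2 hxy)
    -- If |x - y| > r the event is empty, because the graph distance dominates the distance of the
    -- base points.
    rcases le_or_gt |x - y| r with hr' | hr'
    · have hsub : {ω | dist (WithLp.toLp 2 (x, weierstrass β lam (fun n => θ n ω) x))
          (WithLp.toLp 2 (y, weierstrass β lam (fun n => θ n ω) y)) ≤ r} ⊆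
          {ω | dist (weierstrass β lam (fun n => θ n ω) x)
            (weierstrass β lam (fun n => θ n ω) y) ≤ r} :=
        fun ω hω => (WithLp.dist_snd_le (p := 2) _ _).trans hω
      refine (measure_mono hsub).trans ((hP hθ x y (hd x hx y hy) r hr).trans ?_)
      rw [edist_dist, Real.dist_eq, ENNReal.ofReal_rpow_of_pos hxy0,
        ENNReal.ofReal_rpow_of_pos hxy0, ← ENNReal.ofReal_mul (by positivity),
        ← ENNReal.ofReal_mul (by positivity)]
      refine ENNReal.ofReal_le_ofReal ?_
      have h1 : |x - y| ^ (q - 2) ≤ r ^ (q - 2) :=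
        Real.rpow_le_rpow hxy0.le hr' (by linarith)
      calc C * r ^ 2 * |x - y| ^ (-(2 * β))
          = C * r ^ 2 * |x - y| ^ (-(q + 2 * β - 2)) * |x - y| ^ (q - 2) := by
            rw [mul_assoc (C * r ^ 2) (|x - y| ^ (-(q + 2 * β - 2))), ← Real.rpow_add hxy0]
            ring_nf
        _ ≤ C * r ^ 2 * |x - y| ^ (-(q + 2 * β - 2)) * r ^ (q - 2) := by gcongr
        _ = C * r ^ q * |x - y| ^ (-(q + 2 * β - 2)) := by
            rw [Real.rpow_sub hr, Real.rpow_two]; field_simp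
    · have hemp : {ω | dist (WithLp.toLp 2 (x, weierstrass β lam (fun n => θ n ω) x))
          (WithLp.toLp 2 (y, weierstrass β lam (fun n => θ n ω) y)) ≤ r} = ∅ := by
        refine Set.eq_empty_of_forall_notMem fun ω hω => ?_
        have h1 : dist x y ≤ r := (WithLp.dist_fst_le (p := 2) _ _).trans hω
        rw [Real.dist_eq] at h1
        linarith
      rw [hemp, measure_empty]
      exact zero_le

theorem ae_volume_weierstrass_image_pos (hβ : 0 < β) (hlam : 1 < lam) (hθ : IsRandomPhase P θ)
    (hA : MeasurableSet A) (hβA : ENNReal.ofReal (2 * β) < dimH A) :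
    ∀ᵐ ω ∂P, 0 < volume (weierstrass β lam (fun n => θ n ω) '' A) := by
  obtain ⟨C, hC, t₀, ht₀, hP⟩ := exists_measure_increment_le hβ hlam
  obtain ⟨K, hKA, hK, hd, μ, hμ, hμ0, hμK, hE⟩ :=
    exists_energy_lt_top hA (by positivity) hβA ht₀
  have h := ae_volume_image_pos (P := P) (G := fun ω => weierstrass β lam (fun n => θ n ω))
    (measurable_dist_weierstrass hβ hlam hθ.measurable)
    (fun ω => continuous_weierstrass_right hβ hlam _) hK hμ0 hμK hC.le
    (fun x hx y hy r hr => hP hθ x y (hd x hx y hy) r hr) hE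
  filter_upwards [h] with ω hω using hω.trans_le (measure_mono (Set.image_mono hKA))

/-- For |x - y| ≤ 1 one has 1 + |x - y|^β ‖ξ‖ ≥ |x - y|^β (1 + ‖ξ‖). Decay of order γ therefore
separates into (1 + ‖ξ‖)^(-γ) and the energy kernel of order γβ. -/
theorem ae_interior_weierstrass_image_nonempty (hβ : 0 < β) (hlam : 1 < lam)
    (hθ : IsRandomPhase P θ) (hA : MeasurableSet A) (hβA : ENNReal.ofReal (4 * β) < dimH A) :
    ∀ᵐ ω ∂P, (interior (weierstrass β lam (fun n => θ n ω) '' A)).Nonempty := by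
  have h1 : ∀ᶠ γ : ℝ in 𝓝[>] 4, ENNReal.ofReal (γ * β) < dimH A := by
    refine nhdsWithin_le_nhds (Tendsto.eventually ?_ (gt_mem_nhds hβA))
    exact (ENNReal.continuous_ofReal.comp (continuous_id.mul continuous_const)).tendsto _
  -- Keeping γ below 5 lets the integer decay order 5 serve for every γ used.
  have h2 : ∀ᶠ γ : ℝ in 𝓝[>] 4, γ < 5 := nhdsWithin_le_nhds (gt_mem_nhds (by norm_num))
  obtain ⟨γ, hγA, hγ5, hγ4⟩ := (h1.and (h2.and self_mem_nhdsWithin)).exists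
  have hγ4 : 4 < γ := hγ4
  obtain ⟨C, hC, t₀, ht₀, hφ⟩ := exists_norm_charFun_increment_le_one_add hβ hlam 5
  obtain ⟨K, hKA, hK, hd, μ, hμ, hμ0, hμK, hE⟩ :=
    exists_energy_lt_top hA (by positivity : 0 ≤ γ * β) hγA (δ := min t₀ 1) (by positivity)
  have h := ae_interior_image_nonempty (P := P) (G := fun ω => weierstrass β lam (fun n => θ n ω))
    (measurable_weierstrass hβ hlam hθ.measurable)
    (fun ω => continuous_weierstrass_right hβ hlam _) hK hμ0 hμK (C := C) hγ4
    (fun x hx y hy ξ => ?_) hE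
  · filter_upwards [h] with ω hω using hω.mono (interior_mono (Set.image_mono hKA))
  · rcases eq_or_ne x y with rfl | hxy
    · rw [edist_self, ENNReal.zero_rpow_of_neg (by nlinarith),
        ENNReal.mul_top (ENNReal.ofReal_pos.2 (by positivity)).ne']
      exact le_top
    have hxy0 : 0 < |x - y| := abs_pos.2 (sub_ne_zero.2 hxy)
    have hxy1 : |x - y| ≤ 1 := (hd x hx y hy).trans (min_le_right _ _)
    have hb1 : |x - y| ^ β ≤ 1 := Real.rpow_le_one hxy0.le hxy1 hβ.le
    have hb0 : 0 < |x - y| ^ β := Real.rpow_pos_of_pos hxy0 β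
    rw [← ofReal_norm, edist_dist, Real.dist_eq, ENNReal.ofReal_rpow_of_pos hxy0,
      ← ENNReal.ofReal_mul (by positivity)]
    refine ENNReal.ofReal_le_ofReal
      ((hφ hθ x y hxy ((hd x hx y hy).trans (min_le_left _ _)) ξ).trans ?_)
    have hξ := norm_nonneg ξ
    rw [mul_assoc]
    refine mul_le_mul_of_nonneg_left ?_ hC.le
    calc (1 + |x - y| ^ β * ‖ξ‖) ^ (-((5 : ℕ) : ℝ))
        ≤ (1 + |x - y| ^ β * ‖ξ‖) ^ (-γ) :=
          Real.rpow_le_rpow_of_exponent_le (by nlinarith) (by push_cast; linarith)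
      _ ≤ (|x - y| ^ β * (1 + ‖ξ‖)) ^ (-γ) :=
          Real.rpow_le_rpow_of_nonpos (by positivity) (by nlinarith) (by linarith)
      _ = (1 + ‖ξ‖) ^ (-γ) * |x - y| ^ (-(γ * β)) := by
          rw [Real.mul_rpow hb0.le (by positivity), ← Real.rpow_mul hxy0.le, mul_comm,
            show β * -γ = -(γ * β) by ring]

theorem ae_dimH_weierstrass_image (hβ : 0 < β) (hβ' : β ≤ 1) (hlam : 1 < lam)
    (hθ : IsRandomPhase P θ) (hA : MeasurableSet A) {d : ℝ} (hd : 0 ≤ d)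
    (hdA : dimH A = ENNReal.ofReal d) :
    ∀ᵐ ω ∂P, dimH (weierstrass β lam (fun n => θ n ω) '' A) =
      ENNReal.ofReal (min 2 (d / β)) := by
  have h := ae_le_of_forall_nnreal_lt (P := P) (D := ENNReal.ofReal (min 2 (d / β)))
    (f := fun ω => dimH (weierstrass β lam (fun n => θ n ω) '' A)) fun s hs hsD => by
      rw [← ENNReal.ofReal_coe_nnreal, ENNReal.ofReal_lt_ofReal_iff_of_nonneg s.coe_nonneg,
        lt_min_iff, lt_div_iff₀ hβ] at hsD
      refine ae_le_dimH_weierstrass_image hβ hlam hθ hA hs hsD.1 ?_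
      rw [hdA, ENNReal.ofReal_lt_ofReal_iff_of_nonneg (by positivity), mul_comm]
      exact hsD.2
  filter_upwards [h] with ω hω
  refine le_antisymm ?_ hω
  rw [ENNReal.ofReal_min]
  refine le_min ((dimH_complex_le_two _).trans (by simp)) (le_ofReal_of_forall_lt fun v hv => ?_)
  exact (hasDimBound_weierstrass hβ hβ' hlam hd hv _).dimH_image_le hd hdA.le

theorem ae_dimH_graphOver_weierstrass (hβ : 0 < β) (hβ' : β ≤ 1) (hlam : 1 < lam)
    (hθ : IsRandomPhase P θ) (hA : MeasurableSet A) {d : ℝ} (hd : 0 ≤ d)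
    (hdA : dimH A = ENNReal.ofReal d) :
    ∀ᵐ ω ∂P, dimH (graphOver (weierstrass β lam (fun n => θ n ω)) A) =
      ENNReal.ofReal (min (d / β) (d + 2 - 2 * β)) := by
  have h := ae_le_of_forall_nnreal_lt (P := P)
    (D := ENNReal.ofReal (min (d / β) (d + 2 - 2 * β)))
    (f := fun ω => dimH (graphOver (weierstrass β lam (fun n => θ n ω)) A)) fun s hs hsD => by
      rw [← ENNReal.ofReal_coe_nnreal, ENNReal.ofReal_lt_ofReal_iff_of_nonneg s.coe_nonneg,
        lt_min_iff, lt_div_iff₀ hβ] at hsD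
      -- For d ≤ 2β the minimum is d/β, and the projection of the graph onto its values, being
      -- 1-Lipschitz, already has that dimension. Here s < 2 follows from sβ < d.
      rcases le_or_gt d (2 * β) with hdβ | hdβ
      · have := ae_le_dimH_weierstrass_image (P := P) hβ hlam hθ hA hs
          (by nlinarith : (s : ℝ) < 2) (by
            rw [hdA, ENNReal.ofReal_lt_ofReal_iff_of_nonneg (by positivity), mul_comm]
            exact hsD.1)
        filter_upwards [this] with ω hω using hω.trans (dimH_image_le_dimH_graphOver _ _)
      · have hd0 : 0 < d := by linarith
        refine ae_le_dimH_graphOver hβ hlam hθ hA hs ?_ ?_ <;>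
          rw [hdA, ENNReal.ofReal_lt_ofReal_iff hd0] <;> linarith
  filter_upwards [h] with ω hω
  refine le_antisymm (le_ofReal_of_forall_lt fun v hv => ?_) hω
  exact (hasDimBound_graph hβ hβ' hlam hd hv _).dimH_image_le hd hdA.le

end RandomPhase

/-! ### Box dimensions of image and graph, and the theorem -/

theorem hasBoxDim_weierstrass_image {β lam : ℝ} (hβ : 0 < β) (hβ' : β ≤ 1) (hlam : 1 < lam)
    {A : Set ℝ} {d : ℝ} (hd : 0 ≤ d) (hA : HasBoxDim A (ENNReal.ofReal d)) {θ : ℕ → ℝ}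
    (hdim : dimH (weierstrass β lam θ '' A) = ENNReal.ofReal (min 2 (d / β))) :
    HasBoxDim (weierstrass β lam θ '' A) (ENNReal.ofReal (min 2 (d / β))) := by
  have htb : TotallyBounded (weierstrass β lam θ '' A) :=
    (hasDimBound_weierstrass hβ hβ' hlam hd (lt_add_one _) θ).totallyBounded_image hA.1
  refine hasBoxDim_of_dimH_eq htb hdim fun v hv => ?_
  rcases min_lt_iff.1 hv with hv | hv
  · exact eventually_ballCount_le_of_isBounded htb.isBounded hv
  · exact (hasDimBound_weierstrass hβ hβ' hlam hd hv θ).eventually_ballCount_le hd hA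

theorem hasBoxDim_graphOver_weierstrass {β lam : ℝ} (hβ : 0 < β) (hβ' : β ≤ 1) (hlam : 1 < lam)
    {A : Set ℝ} {d : ℝ} (hd : 0 ≤ d) (hA : HasBoxDim A (ENNReal.ofReal d)) {θ : ℕ → ℝ}
    (hdim : dimH (graphOver (weierstrass β lam θ) A) =
      ENNReal.ofReal (min (d / β) (d + 2 - 2 * β))) :
    HasBoxDim (graphOver (weierstrass β lam θ) A)
      (ENNReal.ofReal (min (d / β) (d + 2 - 2 * β))) := by
  refine hasBoxDim_of_dimH_eq
    ((hasDimBound_graph hβ hβ' hlam hd (lt_add_one _) θ).totallyBounded_image hA.1) hdim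
    fun v hv => ?_
  exact (hasDimBound_graph hβ hβ' hlam hd hv θ).eventually_ballCount_le hd hA

theorem corollary1p3 (β lam : ℝ) (hβ : 0 < β) (hβ' : β ≤ 1) (hlam : 1 < lam)
    {Ω : Type*} [MeasurableSpace Ω] (P : Measure Ω) [IsProbabilityMeasure P]
    (θ : ℕ → Ω → ℝ) (hθm : ∀ n, Measurable (θ n)) (hθi : iIndepFun θ P)
    (hθu : ∀ n, pdf.IsUniform (θ n) (Set.Icc 0 1) P volume)
    (A : Set ℝ) (hA : MeasurableSet A) :
    (∀ᵐ ω ∂P,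
      dimH (weierstrass β lam (fun n => θ n ω) '' A) = min 2 (dimH A / ENNReal.ofReal β) ∧
      dimH (graphOver (weierstrass β lam (fun n => θ n ω)) A) =
        min (dimH A / ENNReal.ofReal β) (dimH A + ENNReal.ofReal (2 - 2 * β))) ∧
    (ENNReal.ofReal β < dimH A / 2 →
      ∀ᵐ ω ∂P, 0 < volume (weierstrass β lam (fun n => θ n ω) '' A)) ∧
    (ENNReal.ofReal β < dimH A / 4 →
      ∀ᵐ ω ∂P, (interior (weierstrass β lam (fun n => θ n ω) '' A)).Nonempty) ∧
    (HasBoxDim A (dimH A) →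
      ∀ᵐ ω ∂P,
        HasBoxDim (weierstrass β lam (fun n => θ n ω) '' A)
          (min 2 (dimH A / ENNReal.ofReal β)) ∧
        HasBoxDim (graphOver (weierstrass β lam (fun n => θ n ω)) A)
          (min (dimH A / ENNReal.ofReal β) (dimH A + ENNReal.ofReal (2 - 2 * β)))) := by
  have hθ : IsRandomPhase P θ := ⟨hθm, hθi, hθu⟩
  -- The dimension of a subset of the line is at most 1, so the formulas can be computed with a real
  -- `d`.
  obtain ⟨d, hd, hdA⟩ : ∃ d : ℝ, 0 ≤ d ∧ dimH A = ENNReal.ofReal d :=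
    ⟨(dimH A).toReal, ENNReal.toReal_nonneg,
      (ENNReal.ofReal_toReal ((dimH_real_le_one A).trans_lt ENNReal.one_lt_top).ne).symm⟩
  have h1 : min 2 (dimH A / ENNReal.ofReal β) = ENNReal.ofReal (min 2 (d / β)) := by
    rw [ENNReal.ofReal_min, hdA, ENNReal.ofReal_div_of_pos hβ, ENNReal.ofReal_ofNat]
  have h2 : min (dimH A / ENNReal.ofReal β) (dimH A + ENNReal.ofReal (2 - 2 * β)) =
      ENNReal.ofReal (min (d / β) (d + 2 - 2 * β)) := by
    rw [ENNReal.ofReal_min, hdA, ENNReal.ofReal_div_of_pos hβ,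
      ← ENNReal.ofReal_add hd (by linarith), add_sub_assoc]
  rw [h1, h2]
  have himage := ae_dimH_weierstrass_image hβ hβ' hlam hθ hA hd hdA
  have hgraph := ae_dimH_graphOver_weierstrass hβ hβ' hlam hθ hA hd hdA
  refine ⟨himage.and hgraph, fun h => ?_, fun h => ?_, fun h => ?_⟩
  · refine ae_volume_weierstrass_image_pos hβ hlam hθ hA ?_
    rw [ENNReal.lt_div_iff_mul_lt (by simp) (by simp)] at h
    rwa [mul_comm, ENNReal.ofReal_mul hβ.le, ENNReal.ofReal_ofNat]
  · refine ae_interior_weierstrass_image_nonempty hβ hlam hθ hA ?_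
    rw [ENNReal.lt_div_iff_mul_lt (by simp) (by simp)] at h
    rwa [mul_comm, ENNReal.ofReal_mul hβ.le, ENNReal.ofReal_ofNat]
  · rw [hdA] at h
    -- No further null event arises: once the Hausdorff dimensions are known, the box dimensions
    -- follow for each fixed phase sequence.
    filter_upwards [himage, hgraph] with ω hω1 hω2
    exact ⟨hasBoxDim_weierstrass_image hβ hβ' hlam hd h hω1,
      hasBoxDim_graphOver_weierstrass hβ hβ' hlam hd h hω2⟩
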